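/- **Non-canonical Poisson bracket of the CGL plasma equations.** Let $V_0,V\subseteq\mathbb R^3$ be open (label domain and spatial domain). Indices run over $1,2,3$, repeated indices are summed, $\nabla_j=\partial/\partial x^j$. *Setting.* Let $\rho_0>0$, $S_0$, $\mathbf B_0$ be smooth on $V_0$ (with $\nabla\cdot\mathbf B_0$ unrestricted). Canonical variables are pairs $(\mathbf x,\boldsymbol\pi)$ of smooth fields on $V_0$, where $\mathbf x:V_0\to V$ is a bijection with Jacobian $J=\det(\partial x^i/\partial x_0^j)>0$ and $\boldsymbol\pi=\rho_0\dot{\mathbf x}$. They determine Eulerian fields $Z=(\rho,\sigma,\mathbf M,\mathbf B)$ on $V$ by $\rho=\rho_0/J$, $\sigma=\rho S$ with $S=S_0$, $\mathbf M=\rho\mathbf u$ with $\mathbf u=\dot{\mathbf x}=\boldsymbol\pi/\rho_0$, and $B^i=J^{-1}(\partial x^i/\partial x_0^k)B_0^k$, all evaluated at $\mathbf x(\mathbf x_0)$. A functional $\hat F(Z)$ has the variational derivative $(\hat F_\rho,\hat F_\sigma,\hat F_{\mathbf M},\hat F_{\mathbf B})$ at $Z$ if $\delta \hat F=\int_V(\hat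 F_\rho\delta\rho+\hat F_\sigma\delta\sigma+\hat F_{\mathbf M}\cdot\delta\mathbf M+\hat F_{\mathbf B}\cdot\delta\mathbf B)\,d^3x$ for all smooth one-parameter variations compactly supported in $V$; likewise $\Delta F=\int_{V_0}(F_{\mathbf x}\cdot\Delta\mathbf x+F_{\mathbf p}\cdot\Delta\boldsymbol\pi)\,d^3x_0$ for compactly supported variations of $(\mathbf x,\boldsymbol\pi)$ through Lagrangian maps of $V_0$ onto $V$. The CGL bracket at $Z$ is $$\{F,G\}^{\rm CGL}=-\int_V\big\{\rho(F_{\mathbf M}\cdot\nabla G_\rho-G_{\mathbf M}\cdot\nabla F_\rho)+\sigma(F_{\mathbf M}\cdot\nabla G_\sigma-G_{\mathbf M}\cdot\nabla F_\sigma)+M^i(F_{M^j}\nabla_jG_{M^i}-G_{M^j}\nabla_jF_{M^i})+B^i(F_{M^j}\nabla_jG_{B^i}-G_{M^j}\nabla_jF_{B^i})+B^i\big((\nabla_iF_{M^j})G_{B^j}-(\nabla_iG_{M^j})F_{B^j}\big)\big\}\,d^3x .$$ **1. Chain rule.** If $\hat F$ has a $C^1$ variational derivative at the Eulerian state $Z$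 of $(\mathbf x,\boldsymbol\pi)$, then $F(\mathbf x,\boldsymbol\pi)=\hat F(Z)$ has at $(\mathbf x,\boldsymbol\pi)$ the variational derivative $$F_{x^i}=J\big[M^j\nabla_i\hat F_{M^j}+\sigma\nabla_i\hat F_\sigma+\rho\nabla_i\hat F_\rho+B^j\nabla_i\hat F_{B^j}-B^j\nabla_j\hat F_{B^i}-(\nabla\cdot\mathbf B)\hat F_{B^i}\big],\qquad F_{\mathbf p}=\hat F_{\mathbf M},$$ the right sides being evaluated at $\mathbf x(\mathbf x_0)$, and this is its only continuous one. **2. The bracket.** Let $\hat F,\hat G$ have $C^1$ variational derivatives at $Z$, let $F_{\mathbf x},F_{\mathbf p},G_{\mathbf x},G_{\mathbf p}$ be the continuous variational derivatives of the corresponding functionals of $(\mathbf x,\boldsymbol\pi)$, and suppose that the integrand of $\{F,G\}^{\rm CGL}$ is integrable on $V$. Put $\mathbf W=\mathbf B\,(G_{\mathbf M}\cdot F_{\mathbf B}-G_{\mathbf B}\cdot F_{\mathbf M})$. If $\nabla\cdot\mathbf W$ is integrable on $V$, then the canonical bracket integral converges and $$\int_{V_0}(F_{\mathbf x}\cdot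 G_{\mathbf p}-F_{\mathbf p}\cdot G_{\mathbf x})\,d^3x_0=\{F,G\}^{\rm CGL}-\int_V\nabla\cdot\mathbf W\,d^3x .$$ If $\mathbf W$ has compact support in $V$, the canonical bracket equals $\{F,G\}^{\rm CGL}$. **3. Hamiltonian operator.** Let $Z$ and $f=(F_\rho,F_\sigma,F_{\mathbf M},F_{\mathbf B})$, $g=(G_\rho,G_\sigma,G_{\mathbf M},G_{\mathbf B})$ be $C^1$ on $V$, with the integrand of $\{F,G\}^{\rm CGL}$ integrable. Let $$\mathcal D=-\begin{pmatrix}0&0&\nabla^j\circ\rho&0\\0&0&\nabla^j\circ\sigma&0\\\rho\nabla^i&\sigma\nabla^i&M^j\nabla^i+\nabla^j\circ M^i&B^j\nabla^i-\delta^{ij}B^k\nabla_k\\0&0&\nabla^j\circ B^i-\delta^{ij}\nabla_k\circ B^k&0\end{pmatrix}$$ and let $\mathcal D'$ be $\mathcal D$ with $\delta^{ij}B^k\nabla_k$ and $\delta^{ij}\nabla_k\circ B^k$ interchanged. Put $\mathbf N=(\rho F_\rho+\sigma F_\sigma+\mathbf M\cdot F_{\mathbf M}+\mathbf B\cdot F_{\mathbf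 B})\,G_{\mathbf M}-(F_{\mathbf M}\cdot G_{\mathbf B})\,\mathbf B$. If $\nabla\cdot\mathbf N$ is integrable on $V$, then $\{F,G\}^{\rm CGL}=\int_V f\cdot\mathcal D'g\,d^3x+\int_V\nabla\cdot\mathbf N\,d^3x$, and the last integral may be omitted if instead $\mathbf N$ has compact support in $V$. If $\nabla\cdot\mathbf B=0$ on $V$, both statements hold with $\mathcal D$ in place of $\mathcal D'$. **4. CGL equations.** Let $\mu_0>0$, let $\Phi$ be smooth on $V$, let $e(\rho,S,B)$ be smooth for $\rho,B>0$, and put $p_\parallel=\rho^2e_\rho$, $p_\parallel-p_\perp=-\rho Be_B$, $\boldsymbol\tau=\mathbf B/B$, $B=|\mathbf B|$. Let $I\subseteq\mathbb R$ be open and let $Z(t)=(\rho,\sigma,\mathbf M,\mathbf B)$, $t\in I$, be smooth on $I\times V$ with $\rho>0$, $\mathbf B\ne0$, and finite energy $H=\int_V\big(\tfrac12\rho u^2+\rho\Phi+\rho e(\rho,S,B)+\tfrac1{2\mu_0}B^2\big)d^3x$ (integrable density) for each $t\in I$, where $\mathbf u=\mathbf M/\rho$, $S=\sigma/\rho$.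 Then $H$ has a $C^1$ variational derivative $\delta H/\delta Z$ at each $Z(t)$, and the following hold. (a) Hamilton's equations $\frac{d}{dt}\int_V\varphi\cdot Z\,d^3x=\{\int_V\varphi\cdot Z\,d^3x,\,H\}^{\rm CGL}$, for all $t\in I$ and all smooth $\varphi$ with compact support in $V$, are equivalent to the system $$\rho_t+\nabla\cdot(\rho\mathbf u)=0,\qquad S_t+\mathbf u\cdot\nabla S=0,\qquad \mathbf B_t-\nabla\times(\mathbf u\times\mathbf B)+\mathbf u\,\nabla\cdot\mathbf B=0,$$ $$(\rho\mathbf u)_t+\nabla\cdot\Big(\rho\mathbf u\mathbf u+p_\perp\mathsf I+(p_\parallel-p_\perp)\boldsymbol\tau\boldsymbol\tau+\tfrac1{\mu_0}\big(\tfrac12B^2\mathsf I-\mathbf B\mathbf B\big)\Big)=-\rho\nabla\Phi$$ on $I\times V$. (b) If $\nabla\cdot\mathbf B=0$ on $I\times V$, then Hamilton's equations as in (a), and likewise the equations $\partial Z/\partial t=\mathcal D\,\delta H/\delta Z$ on $I\times V$, are equivalent to the same system with $\mathbf B_t-\nabla\times(\mathbf u\times\mathbf B)=0$ as its third equation. (c)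 If moreover the equation of state is the double adiabatic one, $e=c_\perp(S)B+c_\parallel(S)\rho^2/(2B^2)$, then (with or without $\nabla\cdot\mathbf B=0$) Hamilton's equations as in (a) imply the pressure equations $$(p_\parallel)_t+\nabla\cdot(p_\parallel\mathbf u)+2p_\parallel\boldsymbol\tau\boldsymbol\tau:\nabla\mathbf u=0,\qquad (p_\perp)_t+\nabla\cdot(p_\perp\mathbf u)+p_\perp(\mathsf I-\boldsymbol\tau\boldsymbol\tau):\nabla\mathbf u=0 .$$ -/

import Mathlib

open Set MeasureTheory
open scoped ContDiff

namespace CGL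

noncomputable section

/-- Euclidean three-space, for the Eulerian positions `x` as well as for the labels `x₀`. -/
abbrev Space := EuclideanSpace ℝ (Fin 3)

/-! ### Vector calculus in Cartesian coordinates -/

/-- The partial derivative `∂f/∂xⁱ` at `x`. -/
def pd (i : Fin 3) (f : Space → ℝ) (x : Space) : ℝ :=
  fderiv ℝ f x (EuclideanSpace.single i 1)

/-- The divergence `∇·F`. -/
def div (F : Space → Space) (x : Space) : ℝ :=
  ∑ i, pd i (fun y => F y i) x

/-- The curl `∇×F`. -/
def curl (F : Space → Space) (x : Space) : Space :=
  !₂[pd 1 (fun y => F y 2) x - pd 2 (fun y => F y 1) x,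
     pd 2 (fun y => F y 0) x - pd 0 (fun y => F y 2) x,
     pd 0 (fun y => F y 1) x - pd 1 (fun y => F y 0) x]

/-- The vector product `a × b`. -/
def cross (a b : Space) : Space :=
  !₂[a 1 * b 2 - a 2 * b 1, a 2 * b 0 - a 0 * b 2, a 0 * b 1 - a 1 * b 0]

/-- The Jacobian determinant `J = det (∂Xⁱ/∂x₀ʲ)` of a map. -/
def jac (X : Space → Space) (a : Space) : ℝ := (fderiv ℝ X a).det

/-! ### Eulerian fields and variational derivatives -/

/-- Four fields in the order `(ρ, σ, M, B)`.  The same type holds Eulerian states `Z`, and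
the variational derivatives `(F_ρ, F_σ, F_M, F_B)` of functionals of such states. -/
structure EulerFields where
  rho : Space → ℝ
  sigma : Space → ℝ
  mom : Space → Space
  mag : Space → Space

/-- All four fields are of class `C^n` on `V`. -/
def EulerFields.IsContDiffOn (n : WithTop ℕ∞) (V : Set Space) (Z : EulerFields) : Prop :=
  ContDiffOn ℝ n Z.rho V ∧ ContDiffOn ℝ n Z.sigma V ∧
    ContDiffOn ℝ n Z.mom V ∧ ContDiffOn ℝ n Z.mag V

/-- The pointwise pairing `f_ρ ρ + f_σ σ + f_M · M + f_B · B`. -/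
def EulerFields.pair (f Z : EulerFields) (x : Space) : ℝ :=
  f.rho x * Z.rho x + f.sigma x * Z.sigma x +
    inner ℝ (f.mom x) (Z.mom x) + inner ℝ (f.mag x) (Z.mag x)

/-- The one-parameter family `w ε` of functions, `|ε| < δ`, is jointly smooth on `(-δ, δ) × U`
and does not depend on `ε` outside `K`. -/
def IsSmoothFamily {W : Type*} [NormedAddCommGroup W] [NormedSpace ℝ W]
    (U K : Set Space) (δ : ℝ) (w : ℝ → Space → W) : Prop :=
  ContDiffOn ℝ ∞ (fun z : ℝ × Space => w z.1 z.2) (Ioo (-δ) δ ×ˢ U) ∧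
    ∀ ε ∈ Ioo (-δ) δ, ∀ x, x ∉ K → w ε x = w 0 x

/-- `γ` is a smooth variation of the Eulerian state `Z` with compact support in `V`. -/
def IsEulerVariation (V : Set Space) (Z : EulerFields) (γ : ℝ → EulerFields) : Prop :=
  γ 0 = Z ∧ ∃ δ > 0, ∃ K, IsCompact K ∧ K ⊆ V ∧
    IsSmoothFamily V K δ (fun ε => (γ ε).rho) ∧ IsSmoothFamily V K δ (fun ε => (γ ε).sigma) ∧
    IsSmoothFamily V K δ (fun ε => (γ ε).mom) ∧ IsSmoothFamily V K δ (fun ε => (γ ε).mag)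

/-- The Eulerian variation `δZ = ∂γ/∂ε` at `ε = 0`, at fixed position. -/
def eulerVelocity (γ : ℝ → EulerFields) : EulerFields where
  rho x := deriv (fun ε => (γ ε).rho x) 0
  sigma x := deriv (fun ε => (γ ε).sigma x) 0
  mom x := deriv (fun ε => (γ ε).mom x) 0
  mag x := deriv (fun ε => (γ ε).mag x) 0

/-- `f = (F_ρ, F_σ, F_M, F_B)` is the variational derivative of the functional `F` at `Z`:
`δF = ∫_V (F_ρ δρ + F_σ δσ + F_M · δM + F_B · δB) d³x` for every variation. -/
def HasEulerVarDeriv (V : Set Space) (F : EulerFields → ℝ) (Z f : EulerFields) : Prop :=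
  ∀ γ, IsEulerVariation V Z γ →
    HasDerivAt (fun ε => F (γ ε)) (∫ x in V, f.pair (eulerVelocity γ) x) 0

/-! ### Lagrangian variables -/

/-- `X` is a smooth, invertible, orientation preserving Lagrangian map of the label domain `V₀`
onto the spatial domain `V`. -/
def IsLagrangianMap (V₀ V : Set Space) (X : Space → Space) : Prop :=
  ContDiffOn ℝ ∞ X V₀ ∧ BijOn X V₀ V ∧ ∀ a ∈ V₀, 0 < jac X a

/-- Canonical fields `(q, p) = (x(x₀), π(x₀))` on label space.  The same type holds the
variational derivatives `(F_q, F_p)`. -/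
structure CanonicalFields where
  pos : Space → Space
  mom : Space → Space

/-- `γ` is a smooth variation of the canonical variables `ζ`, with compact support in `V₀`,
through Lagrangian maps of `V₀` onto `V`. -/
def IsCanonicalVariation (V₀ V : Set Space) (ζ : CanonicalFields) (γ : ℝ → CanonicalFields) :
    Prop :=
  γ 0 = ζ ∧ ∃ δ > 0, ∃ K, IsCompact K ∧ K ⊆ V₀ ∧
    IsSmoothFamily V₀ K δ (fun ε => (γ ε).pos) ∧ IsSmoothFamily V₀ K δ (fun ε => (γ ε).mom) ∧
    ∀ ε ∈ Ioo (-δ) δ, IsLagrangianMap V₀ V (γ ε).pos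

/-- `k = (F_q, F_p)` is the variational derivative of `F` at `ζ`:
`ΔF = ∫_{V₀} (F_q · Δx + F_p · Δπ) d³x₀` for every variation, at fixed labels. -/
def HasCanonicalVarDeriv (V₀ V : Set Space) (F : CanonicalFields → ℝ)
    (ζ k : CanonicalFields) : Prop :=
  ∀ γ, IsCanonicalVariation V₀ V ζ γ →
    HasDerivAt (fun ε => F (γ ε))
      (∫ a in V₀, (inner ℝ (k.pos a) (deriv (fun ε => (γ ε).pos a) 0) +
        inner ℝ (k.mom a) (deriv (fun ε => (γ ε).mom a) 0))) 0

/-- The frozen-in data on label space: density `ρ₀`, entropy `S₀`, magnetic field `B₀`. -/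
structure LabelData where
  rho : Space → ℝ
  ent : Space → ℝ
  mag : Space → Space

/-- Smooth label data with positive density.  The divergence of `B₀` is unrestricted. -/
def LabelData.IsAdmissible (V₀ : Set Space) (d : LabelData) : Prop :=
  ContDiffOn ℝ ∞ d.rho V₀ ∧ ContDiffOn ℝ ∞ d.ent V₀ ∧ ContDiffOn ℝ ∞ d.mag V₀ ∧
    ∀ a ∈ V₀, 0 < d.rho a

/-- A function of the label, viewed as a function of the position `y = X(a)`, `a ∈ V₀`
(and extended by zero outside the image of `V₀`). -/
def atPosition {W : Type*} [Zero W] (V₀ : Set Space) (X : Space → Space) (f : Space → W) :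
    Space → W :=
  (X '' V₀).indicator fun y => f (Function.invFunOn X V₀ y)

/-- The Eulerian fields of the canonical variables `(x, π)` with `π = ρ₀ ẋ`: at the position
`x(x₀)`, `ρ = ρ₀ / J`, `S = S₀`, `u = ẋ = π / ρ₀`, `Bⁱ = (∂xⁱ/∂x₀ᵏ) B₀ᵏ / J`, and
`σ = ρ S`, `M = ρ u`. -/
def toEuler (V₀ : Set Space) (d : LabelData) (ζ : CanonicalFields) : EulerFields where
  rho := atPosition V₀ ζ.pos fun a => d.rho a / jac ζ.pos a
  sigma := atPosition V₀ ζ.pos fun a => (d.rho a / jac ζ.pos a) * d.ent a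
  mom := atPosition V₀ ζ.pos fun a => (d.rho a / jac ζ.pos a) • ((d.rho a)⁻¹ • ζ.mom a)
  mag := atPosition V₀ ζ.pos fun a => (jac ζ.pos a)⁻¹ • fderiv ℝ ζ.pos a (d.mag a)

/-- The canonical bracket `∫ (F_q · G_p - F_p · G_q) d³x₀`: the integrand. -/
def canonicalDensity (k l : CanonicalFields) (a : Space) : ℝ :=
  inner ℝ (k.pos a) (l.mom a) - inner ℝ (k.mom a) (l.pos a)

/-- The canonical bracket `{F, G} = ∫ (F_q · G_p - F_p · G_q) d³x₀`, in terms of the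
variational derivatives `k` of `F` and `l` of `G`. -/
def canonicalBracket (V₀ : Set Space) (k l : CanonicalFields) : ℝ :=
  ∫ a in V₀, canonicalDensity k l a

/-! ### The chain rule for variational derivatives -/

/-- The Eulerian vector field
`(∇F_M)·M + σ∇F_σ + ρ∇F_ρ + (∇F_B)·B - (B·∇)F_B - (∇·B)F_B`. -/
def chainVector (Z f : EulerFields) (x : Space) : Space :=
  WithLp.toLp 2 fun i =>
    (∑ j, pd i (fun y => f.mom y j) x * Z.mom x j) + Z.sigma x * pd i f.sigma x
      + Z.rho x * pd i f.rho x + (∑ j, pd i (fun y => f.mag y j) x * Z.mag x j)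
      - (∑ j, Z.mag x j * pd j (fun y => f.mag y i) x) - div Z.mag x * f.mag x i

/-- The transformed variational derivatives: `F_x = J [chainVector]`, `F_p = F_M`, evaluated
along the Lagrangian map. -/
def chainRule (X : Space → Space) (Z f : EulerFields) : CanonicalFields where
  pos a := jac X a • chainVector Z f (X a)
  mom a := f.mom (X a)

/-! ### The non-canonical bracket -/

/-- The integrand of the CGL bracket, with its overall minus sign, in terms of the variational
derivatives `f` of `F` and `g` of `G`. -/
def cglDensity (Z f g : EulerFields) (x : Space) : ℝ :=
  -(Z.rho x * ∑ j, (f.mom x j * pd j g.rho x - g.mom x j * pd j f.rho x)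
    + Z.sigma x * ∑ j, (f.mom x j * pd j g.sigma x - g.mom x j * pd j f.sigma x)
    + ∑ i, Z.mom x i * ∑ j, (f.mom x j * pd j (fun y => g.mom y i) x
        - g.mom x j * pd j (fun y => f.mom y i) x)
    + ∑ i, Z.mag x i * ∑ j, (f.mom x j * pd j (fun y => g.mag y i) x
        - g.mom x j * pd j (fun y => f.mag y i) x)
    + ∑ i, Z.mag x i * ∑ j, (pd i (fun y => f.mom y j) x * g.mag x j
        - pd i (fun y => g.mom y j) x * f.mag x j))

/-- The CGL bracket `{F, G}` at the state `Z`. -/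
def cglBracket (V : Set Space) (Z f g : EulerFields) : ℝ :=
  ∫ x in V, cglDensity Z f g x

/-- The field `B (G_M · F_B - G_B · F_M)`, whose divergence is discarded. -/
def discardedFlux (Z f g : EulerFields) (x : Space) : Space :=
  (inner ℝ (g.mom x) (f.mag x) - inner ℝ (g.mag x) (f.mom x)) • Z.mag x

/-- The vector field `w` on `V` has compact support inside `V`. -/
def VanishesNearBoundary (V : Set Space) (w : Space → Space) : Prop :=
  ∃ K, IsCompact K ∧ K ⊆ V ∧ ∀ x ∈ V, x ∉ K → w x = 0

/-! ### The Hamiltonian operator -/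

/-- The Hamiltonian operator `𝒟` applied to `g = (g_ρ, g_σ, g_M, g_B)`:
the matrix of differential operators, with an overall minus sign, whose rows are
`(0, 0, ∇ʲ∘ρ, 0)`, `(0, 0, ∇ʲ∘σ, 0)`,
`(ρ∇ⁱ, σ∇ⁱ, Mʲ∇ⁱ + ∇ʲ∘Mⁱ, Bʲ∇ⁱ - δⁱʲ Bᵏ∇ₖ)`, `(0, 0, ∇ʲ∘Bⁱ - δⁱʲ ∇ₖ∘Bᵏ, 0)`. -/
def hamOperator (Z g : EulerFields) : EulerFields where
  rho x := -∑ j, pd j (fun y => Z.rho y * g.mom y j) x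
  sigma x := -∑ j, pd j (fun y => Z.sigma y * g.mom y j) x
  mom x := WithLp.toLp 2 fun i =>
    -(Z.rho x * pd i g.rho x + Z.sigma x * pd i g.sigma x
      + ∑ j, (Z.mom x j * pd i (fun y => g.mom y j) x
          + pd j (fun y => Z.mom y i * g.mom y j) x)
      + ∑ j, Z.mag x j * pd i (fun y => g.mag y j) x
      - ∑ k, Z.mag x k * pd k (fun y => g.mag y i) x)
  mag x := WithLp.toLp 2 fun i =>
    -(∑ j, pd j (fun y => Z.mag y i * g.mom y j) x
      - ∑ k, pd k (fun y => Z.mag y k * g.mom y i) x)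

/-- The form of the operator that is valid without Gauss's law: `δⁱʲ Bᵏ∇ₖ` in the
`(M, B)` block and `δⁱʲ ∇ₖ∘Bᵏ` in the `(B, M)` block of `𝒟` are interchanged. -/
def hamOperatorGen (Z g : EulerFields) : EulerFields where
  rho x := -∑ j, pd j (fun y => Z.rho y * g.mom y j) x
  sigma x := -∑ j, pd j (fun y => Z.sigma y * g.mom y j) x
  mom x := WithLp.toLp 2 fun i =>
    -(Z.rho x * pd i g.rho x + Z.sigma x * pd i g.sigma x
      + ∑ j, (Z.mom x j * pd i (fun y => g.mom y j) x
          + pd j (fun y => Z.mom y i * g.mom y j) x)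
      + ∑ j, Z.mag x j * pd i (fun y => g.mag y j) x
      - ∑ k, pd k (fun y => Z.mag y k * g.mag y i) x)
  mag x := WithLp.toLp 2 fun i =>
    -(∑ j, pd j (fun y => Z.mag y i * g.mom y j) x
      - ∑ k, Z.mag x k * pd k (fun y => g.mom y i) x)

/-- The field `(ρ F_ρ + σ F_σ + M · F_M + B · F_B) G_M - (F_M · G_B) B`, whose divergence is the
boundary term of the integration by parts leading to the operator form. -/
def operatorFlux (Z f g : EulerFields) (x : Space) : Space :=
  Z.pair f x • g.mom x - inner ℝ (f.mom x) (g.mag x) • Z.mag x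

/-! ### The total energy and the CGL equations -/

/-- Physical data: vacuum permeability `μ₀`, external potential `Φ`, and the equation of state,
the internal energy `e(ρ, S, B)` per unit mass. -/
structure PlasmaData where
  mu : ℝ
  pot : Space → ℝ
  en : ℝ → ℝ → ℝ → ℝ

/-- `μ₀ > 0`, `Φ` is smooth on `V`, and `e(ρ, S, B)` is smooth for `ρ, B > 0`. -/
def PlasmaData.IsAdmissible (V : Set Space) (P : PlasmaData) : Prop :=
  0 < P.mu ∧ ContDiffOn ℝ ∞ P.pot V ∧
    ContDiffOn ℝ ∞ (fun z : ℝ × ℝ × ℝ => P.en z.1 z.2.1 z.2.2) {z | 0 < z.1 ∧ 0 < z.2.2}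

/-- The velocity `u = M / ρ`. -/
def EulerFields.vel (Z : EulerFields) (x : Space) : Space := (Z.rho x)⁻¹ • Z.mom x

/-- The entropy `S = σ / ρ`. -/
def EulerFields.ent (Z : EulerFields) (x : Space) : ℝ := Z.sigma x / Z.rho x

/-- The total energy density `ρu²/2 + ρΦ + ε + B²/(2μ₀)`, with `ε = ρ e(ρ, S, B)`. -/
def PlasmaData.energyDensity (P : PlasmaData) (Z : EulerFields) (x : Space) : ℝ :=
  Z.rho x * ‖Z.vel x‖ ^ 2 / 2 + Z.rho x * P.pot x
    + Z.rho x * P.en (Z.rho x) (Z.ent x) ‖Z.mag x‖ + ‖Z.mag x‖ ^ 2 / (2 * P.mu)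

/-- The total energy. -/
def PlasmaData.energy (P : PlasmaData) (V : Set Space) (Z : EulerFields) : ℝ :=
  ∫ x in V, P.energyDensity Z x

/-- The parallel pressure `p_∥ = ρ² e_ρ`. -/
def PlasmaData.pPar (P : PlasmaData) (Z : EulerFields) (x : Space) : ℝ :=
  Z.rho x ^ 2 * deriv (fun r => P.en r (Z.ent x) ‖Z.mag x‖) (Z.rho x)

/-- The perpendicular pressure: `p_∥ - p_⊥ = -ρ B e_B`. -/
def PlasmaData.pPerp (P : PlasmaData) (Z : EulerFields) (x : Space) : ℝ :=
  P.pPar Z x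
    + Z.rho x * ‖Z.mag x‖ * deriv (fun b => P.en (Z.rho x) (Z.ent x) b) ‖Z.mag x‖

/-- The unit vector `τ = B / |B|`. -/
def EulerFields.tau (Z : EulerFields) (x : Space) : Space := ‖Z.mag x‖⁻¹ • Z.mag x

/-- The momentum flux tensor `ρuu + p_⊥ I + (p_∥ - p_⊥)ττ + (B²/2 I - BB)/μ₀`. -/
def PlasmaData.momentumFlux (P : PlasmaData) (Z : EulerFields) (i j : Fin 3) (x : Space) : ℝ :=
  Z.rho x * Z.vel x i * Z.vel x j
    + ((if i = j then P.pPerp Z x else 0)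
        + (P.pPar Z x - P.pPerp Z x) * Z.tau x i * Z.tau x j)
    + ((if i = j then ‖Z.mag x‖ ^ 2 / 2 else 0) - Z.mag x i * Z.mag x j) / P.mu

/-- The double contraction `ττ:∇u`. -/
def EulerFields.strain (Z : EulerFields) (x : Space) : ℝ :=
  ∑ i, ∑ j, Z.tau x i * Z.tau x j * pd j (fun y => Z.vel y i) x

/-- Mass continuity: `ρ_t + ∇·(ρu) = 0`. -/
def MassEq (I : Set ℝ) (V : Set Space) (Z : ℝ → EulerFields) : Prop :=
  ∀ t ∈ I, ∀ x ∈ V,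
    deriv (fun s => (Z s).rho x) t + div (fun y => (Z t).rho y • (Z t).vel y) x = 0

/-- Momentum: `(ρu)_t + ∇·(ρuu + p + M_B) = -ρ∇Φ`. -/
def MomentumEq (P : PlasmaData) (I : Set ℝ) (V : Set Space) (Z : ℝ → EulerFields) : Prop :=
  ∀ t ∈ I, ∀ x ∈ V, ∀ i : Fin 3,
    deriv (fun s => (Z s).rho x * (Z s).vel x i) t
      + ∑ j, pd j (P.momentumFlux (Z t) i j) x = -((Z t).rho x * pd i P.pot x)

/-- Entropy transport: `S_t + u·∇S = 0`. -/
def EntropyEq (I : Set ℝ) (V : Set Space) (Z : ℝ → EulerFields) : Prop :=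
  ∀ t ∈ I, ∀ x ∈ V,
    deriv (fun s => (Z s).ent x) t + ∑ j, (Z t).vel x j * pd j (Z t).ent x = 0

/-- Faraday's equation: `B_t - ∇×(u×B) = 0`. -/
def FaradayEq (I : Set ℝ) (V : Set Space) (Z : ℝ → EulerFields) : Prop :=
  ∀ t ∈ I, ∀ x ∈ V,
    deriv (fun s => (Z s).mag x) t - curl (fun y => cross ((Z t).vel y) ((Z t).mag y)) x = 0

/-- Faraday's equation in the form used when Gauss's law is not imposed:
`B_t - ∇×(u×B) + u ∇·B = 0`. -/
def FaradayEqGen (I : Set ℝ) (V : Set Space) (Z : ℝ → EulerFields) : Prop :=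
  ∀ t ∈ I, ∀ x ∈ V,
    deriv (fun s => (Z s).mag x) t - curl (fun y => cross ((Z t).vel y) ((Z t).mag y)) x
      + div (Z t).mag x • (Z t).vel x = 0

/-- Gauss's law: `∇·B = 0`. -/
def GaussLaw (V : Set Space) (Z : EulerFields) : Prop := ∀ x ∈ V, div Z.mag x = 0

/-- The pressure equation `(p_∥)_t + ∇·(p_∥ u) + 2 p_∥ ττ:∇u = 0`. -/
def ParallelPressureEq (P : PlasmaData) (I : Set ℝ) (V : Set Space) (Z : ℝ → EulerFields) :
    Prop :=
  ∀ t ∈ I, ∀ x ∈ V,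
    deriv (fun s => P.pPar (Z s) x) t + div (fun y => P.pPar (Z t) y • (Z t).vel y) x
      + 2 * (P.pPar (Z t) x * (Z t).strain x) = 0

/-- The pressure equation `(p_⊥)_t + ∇·(p_⊥ u) + p_⊥ (I - ττ):∇u = 0`. -/
def PerpPressureEq (P : PlasmaData) (I : Set ℝ) (V : Set Space) (Z : ℝ → EulerFields) :
    Prop :=
  ∀ t ∈ I, ∀ x ∈ V,
    deriv (fun s => P.pPerp (Z s) x) t + div (fun y => P.pPerp (Z t) y • (Z t).vel y) x
      + P.pPerp (Z t) x * (div (Z t).vel x - (Z t).strain x) = 0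

/-- The double adiabatic equation of state `e = c_⊥(S) B + c_∥(S) ρ² / (2B²)`. -/
def PlasmaData.IsDoubleAdiabatic (P : PlasmaData) : Prop :=
  ∃ cPerp cPar : ℝ → ℝ, ∀ r s b : ℝ, 0 < r → 0 < b →
    P.en r s b = cPerp s * b + cPar s * (r ^ 2 / (2 * b ^ 2))

/-- `Z` is a smooth evolution on `I × V` with `ρ > 0`, `B ≠ 0` and finite total energy. -/
def IsEvolution (P : PlasmaData) (I : Set ℝ) (V : Set Space) (Z : ℝ → EulerFields) : Prop :=
  ContDiffOn ℝ ∞ (fun z : ℝ × Space => (Z z.1).rho z.2) (I ×ˢ V) ∧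
  ContDiffOn ℝ ∞ (fun z : ℝ × Space => (Z z.1).sigma z.2) (I ×ˢ V) ∧
  ContDiffOn ℝ ∞ (fun z : ℝ × Space => (Z z.1).mom z.2) (I ×ˢ V) ∧
  ContDiffOn ℝ ∞ (fun z : ℝ × Space => (Z z.1).mag z.2) (I ×ˢ V) ∧
  (∀ t ∈ I, ∀ x ∈ V, 0 < (Z t).rho x ∧ (Z t).mag x ≠ 0) ∧
  ∀ t ∈ I, IntegrableOn (P.energyDensity (Z t)) V

/-- Smooth test fields with compact support in `V`. -/
def IsTestField (V : Set Space) (φ : EulerFields) : Prop :=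
  φ.IsContDiffOn ∞ univ ∧ ∃ K, IsCompact K ∧ K ⊆ V ∧
    ∀ x, x ∉ K → φ.rho x = 0 ∧ φ.sigma x = 0 ∧ φ.mom x = 0 ∧ φ.mag x = 0

/-- Hamilton's equations `𝒵_t = {𝒵, H}` in the CGL bracket, for the functionals
`𝒵(Z) = ∫_V φ · Z d³x`, whose variational derivative is `φ`; `h t` is the variational derivative
of the Hamiltonian at `Z t`. -/
def BracketHamiltonEq (I : Set ℝ) (V : Set Space) (Z h : ℝ → EulerFields) : Prop :=
  ∀ t ∈ I, ∀ φ, IsTestField V φ →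
    HasDerivAt (fun s => ∫ x in V, φ.pair (Z s) x) (cglBracket V (Z t) φ (h t)) t

/-- Hamilton's equations in operator form, `Z_t = 𝒟 δH/δZ`. -/
def OperatorHamiltonEq (I : Set ℝ) (V : Set Space) (Z h : ℝ → EulerFields) : Prop :=
  ∀ t ∈ I, ∀ x ∈ V,
    deriv (fun s => (Z s).rho x) t = (hamOperator (Z t) (h t)).rho x ∧
    deriv (fun s => (Z s).sigma x) t = (hamOperator (Z t) (h t)).sigma x ∧
    deriv (fun s => (Z s).mom x) t = (hamOperator (Z t) (h t)).mom x ∧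
    deriv (fun s => (Z s).mag x) t = (hamOperator (Z t) (h t)).mag x

end

end CGL

open CGL

/-! All four statements rest on pointwise identities between polynomial expressions in first partial
derivatives, each exact up to an explicit divergence. Such a divergence integrates to zero when its
flux has compact support in the open domain (`div_integral_of_vanishesNearBoundary`); otherwise it
is the boundary term recorded in the theorem.

Chain rule. A canonical variation with Eulerian displacement `ξ` induces `δρ = -∇·(ρξ)`, `δσ =
-∇·(σξ)`, and the Lie-transport formulas for `M` (plus a source from `Δπ`) and `B`
(`eulerVelocity_toEuler`). Here Jacobi's formula gives the variation of `J`, symmetry of second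
derivatives gives that of the deformation gradient, and the Eulerian variation is the variation at
fixed label minus advection by `ξ`. Pairing with `f` and moving derivatives off `ξ` produces
`chainVector` (`pair_advected_eq`); the change of variables `x = X(x₀)` supplies the factor `J`.
Uniqueness is the fundamental lemma of the calculus of variations. It needs every compactly
supported label field to be the velocity of a family of bijections `V₀ → V`, which a contraction
argument provides (`exists_perturbation_of_id`).

Brackets. The canonical integrand is `J` times the CGL integrand minus `J ∇·W`, by
`inner_chainVector_sub`. Moving the derivatives off `F` in the CGL integrand gives `f · 𝒟'g + ∇·N`
(`cglDensity_eq_pair_hamOperatorGen`). The operators `𝒟` and `𝒟'` differ only by multiples of `∇·B`.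

Dynamics. The energy has the explicit derivative `energyDeriv`, and any other `C¹` variational
derivative agrees with it on `V`. Testing against compactly supported fields turns Hamilton's
equations into the pointwise system `Z_t = 𝒟' δH/δZ` (`bracketHamiltonEq_iff`). Its rows are
continuity, entropy transport multiplied by `ρ` and combined with continuity, momentum balance, and
Faraday's law corrected by `u ∇·B`. The momentum row depends on the Legendre-type identity `Z ·
δH/δZ - 𝓗 = p_⊥ + B²/(2μ₀)`, with `𝓗` the energy density (`momentumFlux_eq`, `div_momentumFlux`). In
the double adiabatic case `p_∥ = c_∥(S)ρ³/B²` and `p_⊥ = c_⊥(S)ρB`, and the pressure equations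
follow from the rates of `ρ`, `S` and `B` along the flow (`hasDerivAt_flow`). -/

namespace CGL

open Filter Topology

/-! ### Partial derivatives -/

section Partial

variable {f g : Space → ℝ} {x : Space} {i : Fin 3} {V : Set Space}

theorem pd_mul (hf : DifferentiableAt ℝ f x) (hg : DifferentiableAt ℝ g x) :
    pd i (fun y => f y * g y) x = pd i f x * g x + f x * pd i g x := by
  simp only [pd]
  rw [fderiv_fun_mul hf hg]
  simp [mul_comm, add_comm]

theorem pd_add (hf : DifferentiableAt ℝ f x) (hg : DifferentiableAt ℝ g x) :
    pd i (fun y => f y + g y) x = pd i f x + pd i g x := by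
  simp only [pd]
  rw [fderiv_fun_add hf hg]
  simp

theorem pd_sub (hf : DifferentiableAt ℝ f x) (hg : DifferentiableAt ℝ g x) :
    pd i (fun y => f y - g y) x = pd i f x - pd i g x := by
  simp only [pd]
  rw [fderiv_fun_sub hf hg]
  simp

theorem pd_congr (h : f =ᶠ[𝓝 x] g) : pd i f x = pd i g x := by
  simp only [pd, h.fderiv_eq]

theorem pd_congr_of_isOpen (hV : IsOpen V) (h : EqOn f g V) (hx : x ∈ V) :
    pd i f x = pd i g x :=
  pd_congr (h.eventuallyEq_of_mem (hV.mem_nhds hx))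

theorem fderiv_eq_sum_pd (f : Space → ℝ) (x v : Space) :
    fderiv ℝ f x v = ∑ i, v i * pd i f x := by
  have hv : v = ∑ i, v i • EuclideanSpace.single i (1 : ℝ) := by
    ext j; fin_cases j <;> simp [Fin.sum_univ_three]
  conv_lhs => rw [hv]
  simp [pd]

theorem pd_continuousOn (hV : IsOpen V) (hf : ContDiffOn ℝ 1 f V) : ContinuousOn (pd i f) V :=
  (hf.continuousOn_fderiv_of_isOpen hV le_rfl).clm_apply continuousOn_const

theorem differentiableAt_coord {F : Space → Space} (h : DifferentiableAt ℝ F x) :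
    DifferentiableAt ℝ (fun y => F y i) x := by
  fun_prop

theorem contDiffOn_coord {n : WithTop ℕ∞} {E : Type*} [NormedAddCommGroup E] [NormedSpace ℝ E]
    {F : E → Space} {s : Set E} (h : ContDiffOn ℝ n F s) (i : Fin 3) :
    ContDiffOn ℝ n (fun y => F y i) s :=
  (contDiffOn_euclidean.1 h) i

theorem div_continuousOn {F : Space → Space} (hV : IsOpen V) (hF : ContDiffOn ℝ 1 F V) :
    ContinuousOn (div F) V :=
  continuousOn_finsetSum _ fun i _ => pd_continuousOn hV (contDiffOn_coord hF i)

theorem pd_coord (F : Space → Space) (hF : DifferentiableAt ℝ F x) (j : Fin 3) :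
    pd i (fun y => F y j) x = fderiv ℝ F x (EuclideanSpace.single i 1) j := by
  have h := ((EuclideanSpace.proj (𝕜 := ℝ) j).hasFDerivAt (x := F x)).comp x hF.hasFDerivAt
  simp only [pd]
  have : HasFDerivAt (fun y => F y j) ((EuclideanSpace.proj (𝕜 := ℝ) j).comp (fderiv ℝ F x)) x := h
  rw [this.fderiv]
  simp

theorem inner_eq_sum (a b : Space) : inner ℝ a b = ∑ i, a i * b i := by
  rw [PiLp.inner_apply]
  exact Finset.sum_congr rfl fun i _ => by simp [mul_comm]

theorem inner_eq_three (a b : Space) : inner ℝ a b = a 0 * b 0 + a 1 * b 1 + a 2 * b 2 := by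
  rw [inner_eq_sum, Fin.sum_univ_three]

end Partial

/-! ### Functions supported in a compact subset of an open set -/

section Support

variable {E : Type*} [NormedAddCommGroup E] {V K : Set Space}

/-- `V` and the complement of `K` form an open cover of space; on the first the extension is `w`, on
the second it is zero. No regularity of the boundary of `V` enters. -/
theorem contDiff_indicator_of_support [NormedSpace ℝ E] {n : WithTop ℕ∞} (hV : IsOpen V) (hK : IsCompact K)
    (hKV : K ⊆ V) {w : Space → E} (hw : ContDiffOn ℝ n w V) (h0 : ∀ x ∈ V, x ∉ K → w x = 0) :
    ContDiff ℝ n (V.indicator w) := by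
  rw [contDiff_iff_contDiffAt]
  intro x
  by_cases hx : x ∈ V
  · refine (hw.contDiffAt (hV.mem_nhds hx)).congr_of_eventuallyEq ?_
    filter_upwards [hV.mem_nhds hx] with y hy
    simp [hy]
  · have hxK : x ∉ K := fun h => hx (hKV h)
    refine (contDiffAt_const (c := (0 : E))).congr_of_eventuallyEq ?_
    filter_upwards [hK.isClosed.isOpen_compl.mem_nhds hxK] with y hy
    by_cases hyV : y ∈ V
    · simp [hyV, h0 y hyV hy]
    · simp [hyV]

theorem integrableOn_of_support (hV : IsOpen V) (hK : IsCompact K)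
    (hKV : K ⊆ V) {w : Space → E} (hw : ContinuousOn w V) (h0 : ∀ x ∈ V, x ∉ K → w x = 0) :
    IntegrableOn w V := by
  have h : IntegrableOn w K := (hw.mono hKV).integrableOn_compact hK
  exact h.of_forall_sdiff_eq_zero hV.measurableSet fun x hx => h0 x hx.1 hx.2

/-- Integration by parts against the constant function 1; only its products with `w` and with the
derivative of `w` have to be integrable. -/
theorem integral_pd_eq_zero {w : Space → ℝ} (hw : ContDiff ℝ 1 w) (hs : HasCompactSupport w)
    (i : Fin 3) : ∫ x, pd i w x = 0 := by
  have hc : Continuous (fun x => fderiv ℝ w x (EuclideanSpace.single i 1)) :=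
    (hw.continuous_fderiv one_ne_zero).clm_apply continuous_const
  have hcs : HasCompactSupport (fun x => fderiv ℝ w x (EuclideanSpace.single i 1)) :=
    hs.fderiv_apply (𝕜 := ℝ) _
  have := integral_mul_fderiv_eq_neg_fderiv_mul_of_integrable (μ := volume)
    (f := fun _ : Space => (1 : ℝ)) (g := w) (v := EuclideanSpace.single i 1)
    (by simp) (by simpa using hc.integrable_of_hasCompactSupport hcs)
    (by simpa using hw.continuous.integrable_of_hasCompactSupport hs)
    (fun _ _ => by fun_prop) (fun x _ => hw.differentiable one_ne_zero x)
  simpa [pd] using this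

/-- Each component extends by zero to a compactly supported `C¹` function on the whole space, where
the integral of a partial derivative vanishes. Every integration by parts with compactly supported
flux goes through this lemma. -/
theorem div_integral_of_vanishesNearBoundary (hV : IsOpen V) {w : Space → Space}
    (hw : ContDiffOn ℝ 1 w V) (h : VanishesNearBoundary V w) :
    IntegrableOn (div w) V ∧ ∫ x in V, div w x = 0 := by
  obtain ⟨K, hK, hKV, h0⟩ := h
  have hd0 : ∀ x ∈ V, x ∉ K → ∀ i, pd i (fun y => w y i) x = 0 := by
    intro x hx hxK i
    have : (fun y => w y i) =ᶠ[𝓝 x] fun _ => 0 := by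
      filter_upwards [hV.mem_nhds hx, hK.isClosed.isOpen_compl.mem_nhds hxK] with y hy hyK
      simp [h0 y hy hyK]
    rw [pd_congr this]
    simp [pd]
  have hint : ∀ i, IntegrableOn (pd i (fun y => w y i)) V := fun i =>
    integrableOn_of_support hV hK hKV (pd_continuousOn hV (contDiffOn_coord hw i))
      fun x hx hxK => hd0 x hx hxK i
  refine ⟨integrable_finsetSum _ fun i _ => hint i, ?_⟩
  have hz : ∀ i, ∫ x in V, pd i (fun y => w y i) x = 0 := by
    intro i
    set u : Space → ℝ := V.indicator (fun y => w y i) with hu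
    have hu1 : ContDiff ℝ 1 u := contDiff_indicator_of_support hV hK hKV (contDiffOn_coord hw i)
      fun x hx hxK => by simp [h0 x hx hxK]
    have hus : HasCompactSupport u := by
      refine HasCompactSupport.intro hK fun x hx => ?_
      by_cases hxV : x ∈ V
      · simp [hu, hxV, h0 x hxV hx]
      · simp [hu, hxV]
    rw [← integral_pd_eq_zero hu1 hus i, ← integral_indicator hV.measurableSet]
    congr 1
    ext x
    by_cases hx : x ∈ V
    · rw [indicator_of_mem hx]
      refine pd_congr_of_isOpen hV (fun y hy => ?_) hx
      simp [hu, hy]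
    · have hxK : x ∉ K := fun hh => hx (hKV hh)
      rw [indicator_of_notMem hx]
      have : u =ᶠ[𝓝 x] fun _ => 0 := by
        filter_upwards [hK.isClosed.isOpen_compl.mem_nhds hxK] with y hy
        by_cases hyV : y ∈ V
        · simp [hu, hyV, h0 y hyV hy]
        · simp [hu, hyV]
      rw [pd_congr this]
      simp [pd]
  simp only [div]
  rw [integral_finsetSum _ fun i _ => hint i]
  exact Finset.sum_eq_zero fun i _ => hz i

end Support

/-! ### The pointwise identities behind the brackets -/

section Algebra

variable {Z f g : EulerFields} {x : Space} {V : Set Space}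

/-- All four fields are differentiable at `x`. -/
def EulerFields.IsDifferentiableAt (Z : EulerFields) (x : Space) : Prop :=
  DifferentiableAt ℝ Z.rho x ∧ DifferentiableAt ℝ Z.sigma x ∧
    (∀ i, DifferentiableAt ℝ (fun y => Z.mom y i) x) ∧
    ∀ i, DifferentiableAt ℝ (fun y => Z.mag y i) x

theorem EulerFields.IsContDiffOn.isDifferentiableAt (hV : IsOpen V) (h : Z.IsContDiffOn 1 V)
    (hx : x ∈ V) : Z.IsDifferentiableAt x :=
  have hd {E : Type} [NormedAddCommGroup E] [NormedSpace ℝ E] {w : Space → E}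
      (hw : ContDiffOn ℝ 1 w V) : DifferentiableAt ℝ w x :=
    (hw.contDiffAt (hV.mem_nhds hx)).differentiableAt one_ne_zero
  ⟨hd h.1, hd h.2.1, fun _ => differentiableAt_coord (hd h.2.2.1),
    fun _ => differentiableAt_coord (hd h.2.2.2)⟩

theorem EulerFields.IsContDiffOn.of_le {m n : WithTop ℕ∞} (h : Z.IsContDiffOn n V) (hm : m ≤ n) :
    Z.IsContDiffOn m V :=
  ⟨h.1.of_le hm, h.2.1.of_le hm, h.2.2.1.of_le hm, h.2.2.2.of_le hm⟩

/-- The product rule is carried out in full, so that only partial derivatives of single components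
remain and the later comparisons become polynomial identities. -/
theorem div_discardedFlux (hZ : Z.IsDifferentiableAt x) (hf : f.IsDifferentiableAt x)
    (hg : g.IsDifferentiableAt x) :
    div (discardedFlux Z f g) x = ∑ j,
      ((∑ i, (pd j (fun y => g.mom y i) x * f.mag x i + g.mom x i * pd j (fun y => f.mag y i) x
          - (pd j (fun y => g.mag y i) x * f.mom x i
            + g.mag x i * pd j (fun y => f.mom y i) x))) * Z.mag x j
        + (∑ i, (g.mom x i * f.mag x i - g.mag x i * f.mom x i)) * pd j (fun y => Z.mag y j) x) := by
  obtain ⟨-, -, -, hZB⟩ := hZ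
  obtain ⟨-, -, hfM, hfB⟩ := hf
  obtain ⟨-, -, hgM, hgB⟩ := hg
  refine Finset.sum_congr rfl fun j _ => ?_
  have e : (fun y => discardedFlux Z f g y j) = fun y =>
      ((g.mom y 0 * f.mag y 0 + g.mom y 1 * f.mag y 1 + g.mom y 2 * f.mag y 2)
        - (g.mag y 0 * f.mom y 0 + g.mag y 1 * f.mom y 1 + g.mag y 2 * f.mom y 2)) * Z.mag y j := by
    ext y
    simp [discardedFlux, inner_eq_three]
  have hd : ∀ i, DifferentiableAt ℝ (fun y => g.mom y i * f.mag y i) x :=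
    fun i => (hgM i).fun_mul (hfB i)
  have hd' : ∀ i, DifferentiableAt ℝ (fun y => g.mag y i * f.mom y i) x :=
    fun i => (hgB i).fun_mul (hfM i)
  rw [e, pd_mul ((((hd 0).fun_add (hd 1)).fun_add (hd 2)).fun_sub
      (((hd' 0).fun_add (hd' 1)).fun_add (hd' 2))) (hZB j),
    pd_sub (((hd 0).fun_add (hd 1)).fun_add (hd 2)) (((hd' 0).fun_add (hd' 1)).fun_add (hd' 2)),
    pd_add ((hd 0).fun_add (hd 1)) (hd 2), pd_add (hd 0) (hd 1),
    pd_add ((hd' 0).fun_add (hd' 1)) (hd' 2), pd_add (hd' 0) (hd' 1)]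
  simp only [pd_mul (hgM _) (hfB _), pd_mul (hgB _) (hfM _), Fin.sum_univ_three]
  ring

/-- All terms already match the CGL integrand except those from `-(B·∇)F_B - (∇·B)F_B = -∇ₖ(Bᵏ
F_B)`. Contracted with `G_M`, this is `F_B·(B·∇)G_M - ∇·(B (G_M·F_B))`; the same with `F` and `G`
exchanged completes both the last bracket term and the flux `W`. -/
theorem inner_chainVector_sub (hZ : Z.IsDifferentiableAt x) (hf : f.IsDifferentiableAt x)
    (hg : g.IsDifferentiableAt x) :
    inner ℝ (chainVector Z f x) (g.mom x) - inner ℝ (f.mom x) (chainVector Z g x)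
      = cglDensity Z f g x - div (discardedFlux Z f g) x := by
  rw [div_discardedFlux hZ hf hg]
  simp only [inner_eq_three, chainVector, cglDensity, div, Fin.sum_univ_three]
  ring

theorem div_operatorFlux (hZ : Z.IsDifferentiableAt x) (hf : f.IsDifferentiableAt x)
    (hg : g.IsDifferentiableAt x) :
    div (operatorFlux Z f g) x = ∑ j,
      ((pd j Z.rho x * f.rho x + Z.rho x * pd j f.rho x
          + (pd j Z.sigma x * f.sigma x + Z.sigma x * pd j f.sigma x)
          + (∑ i, (pd j (fun y => Z.mom y i) x * f.mom x i
              + Z.mom x i * pd j (fun y => f.mom y i) x))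
          + ∑ i, (pd j (fun y => Z.mag y i) x * f.mag x i
              + Z.mag x i * pd j (fun y => f.mag y i) x)) * g.mom x j
        + Z.pair f x * pd j (fun y => g.mom y j) x
        - ((∑ i, (pd j (fun y => f.mom y i) x * g.mag x i
              + f.mom x i * pd j (fun y => g.mag y i) x)) * Z.mag x j
          + (∑ i, f.mom x i * g.mag x i) * pd j (fun y => Z.mag y j) x)) := by
  obtain ⟨hZr, hZs, hZM, hZB⟩ := hZ
  obtain ⟨hfr, hfs, hfM, hfB⟩ := hf
  obtain ⟨-, -, hgM, hgB⟩ := hg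
  refine Finset.sum_congr rfl fun j _ => ?_
  have e : (fun y => operatorFlux Z f g y j) = fun y =>
      ((Z.rho y * f.rho y + Z.sigma y * f.sigma y
        + (Z.mom y 0 * f.mom y 0 + Z.mom y 1 * f.mom y 1 + Z.mom y 2 * f.mom y 2)
        + (Z.mag y 0 * f.mag y 0 + Z.mag y 1 * f.mag y 1 + Z.mag y 2 * f.mag y 2)) * g.mom y j
        - (f.mom y 0 * g.mag y 0 + f.mom y 1 * g.mag y 1 + f.mom y 2 * g.mag y 2) * Z.mag y j) := by
    ext y
    simp [operatorFlux, EulerFields.pair, inner_eq_three]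
  have h1 : ∀ i, DifferentiableAt ℝ (fun y => Z.mom y i * f.mom y i) x :=
    fun i => (hZM i).fun_mul (hfM i)
  have h2 : ∀ i, DifferentiableAt ℝ (fun y => Z.mag y i * f.mag y i) x :=
    fun i => (hZB i).fun_mul (hfB i)
  have h3 : ∀ i, DifferentiableAt ℝ (fun y => f.mom y i * g.mag y i) x :=
    fun i => (hfM i).fun_mul (hgB i)
  have s1 := ((h1 0).fun_add (h1 1)).fun_add (h1 2)
  have s2 := ((h2 0).fun_add (h2 1)).fun_add (h2 2)
  have s3 := ((h3 0).fun_add (h3 1)).fun_add (h3 2)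
  have s0 := (hZr.fun_mul hfr).fun_add (hZs.fun_mul hfs)
  rw [e, pd_sub (((s0.fun_add s1).fun_add s2).fun_mul (hgM j)) (s3.fun_mul (hZB j)),
    pd_mul ((s0.fun_add s1).fun_add s2) (hgM j), pd_mul s3 (hZB j),
    pd_add (s0.fun_add s1) s2, pd_add s0 s1, pd_add (hZr.fun_mul hfr) (hZs.fun_mul hfs),
    pd_add ((h1 0).fun_add (h1 1)) (h1 2), pd_add (h1 0) (h1 1),
    pd_add ((h2 0).fun_add (h2 1)) (h2 2), pd_add (h2 0) (h2 1),
    pd_add ((h3 0).fun_add (h3 1)) (h3 2), pd_add (h3 0) (h3 1),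
    pd_mul hZr hfr, pd_mul hZs hfs]
  simp only [pd_mul (hZM _) (hfM _), pd_mul (hZB _) (hfB _), pd_mul (hfM _) (hgB _),
    Fin.sum_univ_three, EulerFields.pair, inner_eq_three]

/-- Every derivative falling on a component of `f` is moved by the product rule. The terms `G_M·∇F`
yield the flux along `G_M`, and `B·∇F_M` yields the flux along `B`, leaving `∇ₖ∘Bᵏ` in the `(M, B)`
block: this is why the interchanged operator appears when `∇·B` is arbitrary. -/
theorem cglDensity_eq_pair_hamOperatorGen (hZ : Z.IsDifferentiableAt x)
    (hf : f.IsDifferentiableAt x) (hg : g.IsDifferentiableAt x) :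
    cglDensity Z f g x = f.pair (hamOperatorGen Z g) x + div (operatorFlux Z f g) x := by
  rw [div_operatorFlux hZ hf hg]
  obtain ⟨hZr, hZs, hZM, hZB⟩ := hZ
  obtain ⟨hgr, hgs, hgM, hgB⟩ := hg
  simp only [EulerFields.pair, hamOperatorGen, inner_eq_three, cglDensity, Fin.sum_univ_three,
    pd_mul hZr (hgM _), pd_mul hZs (hgM _), pd_mul (hZM _) (hgM _), pd_mul (hZB _) (hgB _),
    pd_mul (hZB _) (hgM _)]
  ring

/-- Passing between `Bᵏ∇ₖ` and `∇ₖ∘Bᵏ` costs `g_B ∇·B` in the momentum row and `g_M ∇·B` in the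
magnetic row. -/
theorem hamOperator_eq_hamOperatorGen (hZ : Z.IsDifferentiableAt x) (hg : g.IsDifferentiableAt x)
    (hB : div Z.mag x = 0) :
    (hamOperator Z g).mom x = (hamOperatorGen Z g).mom x ∧
      (hamOperator Z g).mag x = (hamOperatorGen Z g).mag x := by
  obtain ⟨-, -, hgM, hgB⟩ := hg
  obtain ⟨-, -, -, hZB⟩ := hZ
  simp only [div, Fin.sum_univ_three] at hB
  constructor
  · ext i
    simp only [hamOperator, hamOperatorGen, Fin.sum_univ_three, pd_mul (hZB _) (hgB _)]
    linear_combination (-g.mag x i) * hB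
  · ext i
    simp only [hamOperator, hamOperatorGen, Fin.sum_univ_three, pd_mul (hZB _) (hgM _)]
    linear_combination (g.mom x i) * hB

theorem pair_hamOperator_eq (hZ : Z.IsDifferentiableAt x) (hg : g.IsDifferentiableAt x)
    (hB : div Z.mag x = 0) : f.pair (hamOperator Z g) x = f.pair (hamOperatorGen Z g) x := by
  obtain ⟨h1, h2⟩ := hamOperator_eq_hamOperatorGen hZ hg hB
  simp only [EulerFields.pair, h1, h2]
  rfl

theorem EulerFields.pair_comm : f.pair g x = g.pair f x := by
  simp only [EulerFields.pair, real_inner_comm, mul_comm]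

theorem EulerFields.IsContDiffOn.pair {n : WithTop ℕ∞} (hf : f.IsContDiffOn n V)
    (hg : g.IsContDiffOn n V) : ContDiffOn ℝ n (f.pair g) V :=
  (((hf.1.mul hg.1).add (hf.2.1.mul hg.2.1)).add (hf.2.2.1.inner ℝ hg.2.2.1)).add
    (hf.2.2.2.inner ℝ hg.2.2.2)

theorem operatorFlux_contDiffOn (hZ : Z.IsContDiffOn 1 V) (hf : f.IsContDiffOn 1 V)
    (hg : g.IsContDiffOn 1 V) : ContDiffOn ℝ 1 (operatorFlux Z f g) V :=
  ((hZ.pair hf).smul hg.2.2.1).sub ((hf.2.2.1.inner ℝ hg.2.2.2).smul hZ.2.2.2)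

theorem discardedFlux_contDiffOn (hZ : Z.IsContDiffOn 1 V) (hf : f.IsContDiffOn 1 V)
    (hg : g.IsContDiffOn 1 V) : ContDiffOn ℝ 1 (discardedFlux Z f g) V :=
  ((hg.2.2.1.inner ℝ hf.2.2.2).sub (hg.2.2.2.inner ℝ hf.2.2.1)).smul hZ.2.2.2

end Algebra

/-! ### The Hamiltonian operator -/

section HamiltonianOperator

variable {Z f g : EulerFields} {V : Set Space}

theorem cglBracket_eq_integral_hamOperatorGen (hV : IsOpen V) (hZ : Z.IsContDiffOn 1 V)
    (hf : f.IsContDiffOn 1 V) (hg : g.IsContDiffOn 1 V) (hi : IntegrableOn (cglDensity Z f g) V)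
    (hd : IntegrableOn (div (operatorFlux Z f g)) V) :
    cglBracket V Z f g = (∫ x in V, f.pair (hamOperatorGen Z g) x)
      + ∫ x in V, div (operatorFlux Z f g) x := by
  have key : ∀ x ∈ V, f.pair (hamOperatorGen Z g) x
      = cglDensity Z f g x - div (operatorFlux Z f g) x := fun x hx => by
    rw [cglDensity_eq_pair_hamOperatorGen (hZ.isDifferentiableAt hV hx)
      (hf.isDifferentiableAt hV hx) (hg.isDifferentiableAt hV hx)]
    ring
  rw [setIntegral_congr_fun hV.measurableSet key, integral_sub hi hd, cglBracket]
  ring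

theorem cglBracket_eq_integral_hamOperatorGen_of_vanishes (hV : IsOpen V)
    (hZ : Z.IsContDiffOn 1 V) (hf : f.IsContDiffOn 1 V) (hg : g.IsContDiffOn 1 V)
    (hi : IntegrableOn (cglDensity Z f g) V)
    (hw : VanishesNearBoundary V (operatorFlux Z f g)) :
    cglBracket V Z f g = ∫ x in V, f.pair (hamOperatorGen Z g) x := by
  obtain ⟨h1, h2⟩ := div_integral_of_vanishesNearBoundary hV (operatorFlux_contDiffOn hZ hf hg) hw
  rw [cglBracket_eq_integral_hamOperatorGen hV hZ hf hg hi h1, h2, add_zero]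

theorem integral_pair_hamOperator_eq (hV : IsOpen V) (hZ : Z.IsContDiffOn 1 V)
    (hg : g.IsContDiffOn 1 V) (hB : GaussLaw V Z) :
    ∫ x in V, f.pair (hamOperator Z g) x = ∫ x in V, f.pair (hamOperatorGen Z g) x :=
  setIntegral_congr_fun hV.measurableSet fun x hx =>
    pair_hamOperator_eq (hZ.isDifferentiableAt hV hx) (hg.isDifferentiableAt hV hx) (hB x hx)

end HamiltonianOperator

/-! ### Smooth inverses -/

section Inverse

/-- The inverse function theorem gives a smooth local inverse near `Ψ a`, and any left inverse of
`Ψ` on `S` has to coincide with it there. The general `E` allows use both on space and on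
parameter-space products. -/
theorem contDiffOn_leftInverse {E : Type*} [NormedAddCommGroup E] [NormedSpace ℝ E]
    [FiniteDimensional ℝ E] {Ψ Φ : E → E} {S T : Set E} (hS : IsOpen S)
    (hΨ : ContDiffOn ℝ ∞ Ψ S) (hb : SurjOn Ψ S T) (hΦ : ∀ a ∈ S, Φ (Ψ a) = a)
    (hd : ∀ a ∈ S, Function.Injective (fderiv ℝ Ψ a)) : ContDiffOn ℝ ∞ Φ T := by
  have : CompleteSpace E := FiniteDimensional.complete ℝ E
  intro y hy
  obtain ⟨a, ha, rfl⟩ := hb hy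
  have hca : ContDiffAt ℝ ∞ Ψ a := hΨ.contDiffAt (hS.mem_nhds ha)
  let e : E ≃L[ℝ] E :=
    (LinearEquiv.ofInjectiveEndo (fderiv ℝ Ψ a : E →ₗ[ℝ] E) (hd a ha)).toContinuousLinearEquiv
  have he : (e : E →L[ℝ] E) = fderiv ℝ Ψ a := by
    ext v; rfl
  have hfd : HasFDerivAt Ψ (e : E →L[ℝ] E) a := by
    rw [he]; exact (hca.differentiableAt (by simp)).hasFDerivAt
  have hstr : HasStrictFDerivAt Ψ (e : E →L[ℝ] E) a := hca.hasStrictFDerivAt' hfd (by simp)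
  have hloc : ContDiffAt ℝ ∞ (hca.localInverse hfd (by simp)) (Ψ a) :=
    hca.to_localInverse hfd (by simp)
  have hga : hca.localInverse hfd (by simp) (Ψ a) = a := hstr.localInverse_apply_image
  refine (hloc.congr_of_eventuallyEq ?_).contDiffWithinAt
  -- Near `Ψ a` the local inverse takes values in `S` and is a right inverse of `Ψ`; applying `Φ ∘ Ψ
  -- = id` at those values identifies it with `Φ`.
  have h1 : ∀ᶠ q in 𝓝 (Ψ a), Ψ (hca.localInverse hfd (by simp) q) = q :=
    hstr.eventually_right_inverse
  have h2 : ∀ᶠ q in 𝓝 (Ψ a), hca.localInverse hfd (by simp) q ∈ S := by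
    refine hloc.continuousAt.eventually_mem ?_
    rw [hga]
    exact hS.mem_nhds ha
  filter_upwards [h1, h2] with q hq1 hq2
  rw [← hΦ _ hq2, hq1]

theorem clm_apply_coord (L : Space →L[ℝ] Space) (v : Space) (i : Fin 3) :
    L v i = ∑ k, v k * L (EuclideanSpace.single k 1) i := by
  have hv : v = ∑ i, v i • EuclideanSpace.single i (1 : ℝ) := by
    ext j; fin_cases j <;> simp [Fin.sum_univ_three]
  conv_lhs => rw [hv]
  simp

theorem clm_det_eq (A : Space →L[ℝ] Space) :
    A.det = Matrix.det (Matrix.of fun i j => A (EuclideanSpace.single j 1) i) := by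
  rw [ContinuousLinearMap.det,
    ← LinearMap.det_toMatrix (EuclideanSpace.basisFun (Fin 3) ℝ).toBasis]
  congr 1

theorem contDiff_clm_det : ContDiff ℝ ∞ fun A : Space →L[ℝ] Space => A.det := by
  have h : ∀ i j : Fin 3, ContDiff ℝ ∞
      fun A : Space →L[ℝ] Space => A (EuclideanSpace.single j 1) i := fun i j =>
    (contDiff_euclidean.1 (contDiff_id.clm_apply contDiff_const)) i
  simp only [clm_det_eq, Matrix.det_fin_three, Matrix.of_apply]
  exact ((((((((h 0 0).mul (h 1 1)).mul (h 2 2)).sub (((h 0 0).mul (h 1 2)).mul (h 2 1))).sub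
    (((h 0 1).mul (h 1 0)).mul (h 2 2))).add (((h 0 1).mul (h 1 2)).mul (h 2 0))).add
    (((h 0 2).mul (h 1 0)).mul (h 2 1))).sub (((h 0 2).mul (h 1 1)).mul (h 2 0)))

/-- Jacobi's formula in the form `(det A)' = det A · tr L` when `A' = L A`, with `L` to be the
Eulerian displacement gradient. Writing the derivative as `L A` avoids the adjugate and the inverse
of `A`. -/
theorem hasDerivAt_clm_det {A : ℝ → Space →L[ℝ] Space} {L : Space →L[ℝ] Space} {t : ℝ}
    (hA : HasDerivAt A (L.comp (A t)) t) :
    HasDerivAt (fun s => (A s).det)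
      ((A t).det * ∑ i, L (EuclideanSpace.single i 1) i) t := by
  have h : ∀ i j : Fin 3, HasDerivAt (fun s => A s (EuclideanSpace.single j 1) i)
      (∑ k, A t (EuclideanSpace.single j 1) k * L (EuclideanSpace.single k 1) i) t := by
    intro i j
    have h1 : HasDerivAt (fun s => A s (EuclideanSpace.single j 1))
        (L (A t (EuclideanSpace.single j 1))) t := by
      simpa using hA.clm_apply (hasDerivAt_const t (EuclideanSpace.single j (1 : ℝ)))
    have h2 := (EuclideanSpace.proj (𝕜 := ℝ) i).hasFDerivAt.comp_hasDerivAt t h1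
    rw [← clm_apply_coord]
    simpa [Function.comp_def] using h2
  simp only [clm_det_eq, Matrix.det_fin_three, Matrix.of_apply]
  convert! ((((((((h 0 0).mul (h 1 1)).mul (h 2 2)).sub (((h 0 0).mul (h 1 2)).mul (h 2 1))).sub
    (((h 0 1).mul (h 1 0)).mul (h 2 2))).add (((h 0 1).mul (h 1 2)).mul (h 2 0))).add
    (((h 0 2).mul (h 1 0)).mul (h 2 1))).sub (((h 0 2).mul (h 1 1)).mul (h 2 0))) using 1
  simp only [Fin.sum_univ_three, Pi.mul_apply]
  ring

theorem injective_of_det_pos {A : Space →L[ℝ] Space} (h : 0 < A.det) : Function.Injective A := by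
  have hu : IsUnit (A : Space →ₗ[ℝ] Space) := by
    rw [LinearMap.isUnit_iff_isUnit_det]
    exact h.ne'.isUnit
  exact ((Module.End.isUnit_iff _).1 hu).injective

end Inverse

/-! ### Fields at a moving position -/

section Position

variable {V₀ V : Set Space} {X : Space → Space}

theorem IsLagrangianMap.hasFDerivAt (hV₀ : IsOpen V₀) (hX : IsLagrangianMap V₀ V X) {a : Space}
    (ha : a ∈ V₀) : HasFDerivAt X (fderiv ℝ X a) a :=
  ((hX.1.contDiffAt (hV₀.mem_nhds ha)).differentiableAt (by simp)).hasFDerivAt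

theorem IsLagrangianMap.contDiffOn_inverse (hV₀ : IsOpen V₀) (hX : IsLagrangianMap V₀ V X) :
    ContDiffOn ℝ ∞ (Function.invFunOn X V₀) V :=
  contDiffOn_leftInverse hV₀ hX.1 hX.2.1.surjOn (fun _ ha => hX.2.1.injOn.leftInvOn_invFunOn ha)
    fun a ha => injective_of_det_pos (hX.2.2 a ha)

theorem IsLagrangianMap.inverse_mem (hX : IsLagrangianMap V₀ V X) {y : Space} (hy : y ∈ V) :
    Function.invFunOn X V₀ y ∈ V₀ := by
  obtain ⟨a, ha, rfl⟩ := hX.2.1.surjOn hy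
  rwa [hX.2.1.injOn.leftInvOn_invFunOn ha]

variable {W : Type*} [NormedAddCommGroup W] [NormedSpace ℝ W] {c : Space → W}

omit [NormedSpace ℝ W] in
theorem atPosition_apply (hX : IsLagrangianMap V₀ V X) (c : Space → W) {a : Space} (ha : a ∈ V₀) :
    atPosition V₀ X c (X a) = c a := by
  rw [atPosition, indicator_of_mem (mem_image_of_mem X ha),
    hX.2.1.injOn.leftInvOn_invFunOn ha]

omit [NormedSpace ℝ W] in
theorem atPosition_of_mem (hX : IsLagrangianMap V₀ V X) (c : Space → W) {y : Space} (hy : y ∈ V) :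
    atPosition V₀ X c y = c (Function.invFunOn X V₀ y) := by
  rw [atPosition, hX.2.1.image_eq, indicator_of_mem hy]

omit [NormedSpace ℝ W] in
theorem atPosition_of_notMem (hX : IsLagrangianMap V₀ V X) (c : Space → W) {y : Space}
    (hy : y ∉ V) : atPosition V₀ X c y = 0 := by
  rw [atPosition, hX.2.1.image_eq, indicator_of_notMem hy]

theorem atPosition_contDiffOn (hV₀ : IsOpen V₀) (hX : IsLagrangianMap V₀ V X)
    (hc : ContDiffOn ℝ ∞ c V₀) : ContDiffOn ℝ ∞ (atPosition V₀ X c) V :=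
  (hc.comp (hX.contDiffOn_inverse hV₀) fun _ hy => hX.inverse_mem hy).congr
    fun _ hy => atPosition_of_mem hX c hy

/-- Change of variables; the absolute value of the Jacobian is dropped because Lagrangian maps
preserve orientation. -/
theorem integral_eq_integral_label (hV₀ : IsOpen V₀) (hX : IsLagrangianMap V₀ V X)
    (h : Space → ℝ) : ∫ x in V, h x = ∫ a in V₀, jac X a * h (X a) := by
  rw [← hX.2.1.image_eq, integral_image_eq_integral_abs_det_fderiv_smul volume hV₀.measurableSet
    (fun a ha => (hX.hasFDerivAt hV₀ ha).hasFDerivWithinAt) hX.2.1.injOn]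
  refine setIntegral_congr_fun hV₀.measurableSet fun a ha => ?_
  simp only [smul_eq_mul, jac]
  rw [abs_of_pos (show 0 < (fderiv ℝ X a).det from hX.2.2 a ha)]

theorem integrableOn_iff_integrableOn_label (hV₀ : IsOpen V₀) (hX : IsLagrangianMap V₀ V X)
    (h : Space → ℝ) : IntegrableOn h V ↔ IntegrableOn (fun a => jac X a * h (X a)) V₀ := by
  rw [← hX.2.1.image_eq, integrableOn_image_iff_integrableOn_abs_det_fderiv_smul volume
    hV₀.measurableSet (fun a ha => (hX.hasFDerivAt hV₀ ha).hasFDerivWithinAt) hX.2.1.injOn]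
  refine integrableOn_congr_fun (fun a ha => ?_) hV₀.measurableSet
  simp only [smul_eq_mul, jac]
  rw [abs_of_pos (show 0 < (fderiv ℝ X a).det from hX.2.2 a ha)]

end Position

/-! ### Smooth families of Lagrangian maps -/

section Family

variable {V₀ V K : Set Space} {δ : ℝ} {X : ℝ → Space → Space}
variable {W : Type*} [NormedAddCommGroup W] [NormedSpace ℝ W] {c : ℝ → Space → W}

theorem hasFDerivAt_family_slice (hV₀ : IsOpen V₀)
    (hc : ContDiffOn ℝ ∞ (fun z : ℝ × Space => c z.1 z.2) (Ioo (-δ) δ ×ˢ V₀)) {ε : ℝ}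
    (hε : ε ∈ Ioo (-δ) δ) {a : Space} (ha : a ∈ V₀) :
    HasFDerivAt (c ε) ((fderiv ℝ (fun z : ℝ × Space => c z.1 z.2) (ε, a)).comp
      (ContinuousLinearMap.inr ℝ ℝ Space)) a := by
  have h : HasFDerivAt (fun z : ℝ × Space => c z.1 z.2)
      (fderiv ℝ (fun z : ℝ × Space => c z.1 z.2) (ε, a)) (ε, a) :=
    ((hc.contDiffAt ((isOpen_Ioo.prod hV₀).mem_nhds ⟨hε, ha⟩)).differentiableAt
      (by simp)).hasFDerivAt
  exact h.comp a (hasFDerivAt_prodMk_right ε a)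

theorem hasDerivAt_family_slice (hV₀ : IsOpen V₀)
    (hc : ContDiffOn ℝ ∞ (fun z : ℝ × Space => c z.1 z.2) (Ioo (-δ) δ ×ˢ V₀)) {ε : ℝ}
    (hε : ε ∈ Ioo (-δ) δ) {a : Space} (ha : a ∈ V₀) :
    HasDerivAt (fun s => c s a) (fderiv ℝ (fun z : ℝ × Space => c z.1 z.2) (ε, a) (1, 0)) ε := by
  have h : HasFDerivAt (fun z : ℝ × Space => c z.1 z.2)
      (fderiv ℝ (fun z : ℝ × Space => c z.1 z.2) (ε, a)) (ε, a) :=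
    ((hc.contDiffAt ((isOpen_Ioo.prod hV₀).mem_nhds ⟨hε, ha⟩)).differentiableAt
      (by simp)).hasFDerivAt
  exact h.comp_hasDerivAt ε ((hasDerivAt_id ε).prodMk (hasDerivAt_const ε a))

theorem contDiffOn_family_velocity (hV₀ : IsOpen V₀) (hδ : 0 < δ)
    (hc : ContDiffOn ℝ ∞ (fun z : ℝ × Space => c z.1 z.2) (Ioo (-δ) δ ×ˢ V₀)) :
    ContDiffOn ℝ ∞ (fun a => deriv (fun s => c s a) 0) V₀ := by
  have h0 : (0 : ℝ) ∈ Ioo (-δ) δ := ⟨by linarith, hδ⟩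
  have h1 := (hc.fderiv_of_isOpen (isOpen_Ioo.prod hV₀) (m := ∞) (by simp)).clm_apply
    (contDiffOn_const (c := ((1 : ℝ), (0 : Space))))
  have h2 : ContDiffOn ℝ ∞ (fun a : Space => ((0 : ℝ), a)) V₀ :=
    contDiffOn_const.prodMk contDiffOn_id
  exact (h1.comp h2 fun a ha => ⟨h0, ha⟩).congr fun a ha =>
    (hasDerivAt_family_slice hV₀ hc h0 ha).deriv

theorem contDiffOn_family_fderiv (hV₀ : IsOpen V₀)
    (hc : ContDiffOn ℝ ∞ (fun z : ℝ × Space => c z.1 z.2) (Ioo (-δ) δ ×ˢ V₀)) :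
    ContDiffOn ℝ ∞ (fun z : ℝ × Space => fderiv ℝ (c z.1) z.2) (Ioo (-δ) δ ×ˢ V₀) :=
  ((hc.fderiv_of_isOpen (isOpen_Ioo.prod hV₀) (m := ∞) (by simp)).clm_comp
    contDiffOn_const).congr fun _ hz => (hasFDerivAt_family_slice hV₀ hc hz.1 hz.2).fderiv

theorem contDiffOn_family_jac (hV₀ : IsOpen V₀)
    (hX : ContDiffOn ℝ ∞ (fun z : ℝ × Space => X z.1 z.2) (Ioo (-δ) δ ×ˢ V₀)) :
    ContDiffOn ℝ ∞ (fun z : ℝ × Space => jac (X z.1) z.2) (Ioo (-δ) δ ×ˢ V₀) :=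
  contDiff_clm_det.comp_contDiffOn (contDiffOn_family_fderiv hV₀ hX)

/-- The velocity and the label gradient of a family commute. -/
theorem hasDerivAt_family_fderiv (hV₀ : IsOpen V₀) (hδ : 0 < δ)
    (hc : ContDiffOn ℝ ∞ (fun z : ℝ × Space => c z.1 z.2) (Ioo (-δ) δ ×ˢ V₀)) {a : Space}
    (ha : a ∈ V₀) :
    HasDerivAt (fun s => fderiv ℝ (c s) a) (fderiv ℝ (fun b => deriv (fun s => c s b) 0) a) 0 := by
  have h0 : (0 : ℝ) ∈ Ioo (-δ) δ := ⟨by linarith, hδ⟩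
  set w : ℝ × Space → W := fun z => c z.1 z.2 with hw
  have hopen := isOpen_Ioo.prod hV₀ (s := Ioo (-δ) δ)
  have hwa : ContDiffAt ℝ ∞ w (0, a) := hc.contDiffAt (hopen.mem_nhds ⟨h0, ha⟩)
  have hsymm : IsSymmSndFDerivAt ℝ w (0, a) :=
    hwa.isSymmSndFDerivAt (by rw [minSmoothness_of_isRCLikeNormedField]; exact WithTop.coe_le_coe.2 (le_top (a := 2)))
  have hD : HasFDerivAt (fderiv ℝ w) (fderiv ℝ (fderiv ℝ w) (0, a)) (0, a) :=
    ((hwa.fderiv_right (m := ∞) (by simp)).differentiableAt (by simp)).hasFDerivAt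
  have e2 : HasFDerivAt (fun b => deriv (fun s => c s b) 0)
      (((ContinuousLinearMap.apply ℝ W ((1 : ℝ), (0 : Space))).comp
        (fderiv ℝ (fderiv ℝ w) (0, a))).comp (ContinuousLinearMap.inr ℝ ℝ Space)) a := by
    have h1 : HasFDerivAt (fun z => fderiv ℝ w z (1, 0))
        ((ContinuousLinearMap.apply ℝ W ((1 : ℝ), (0 : Space))).comp
          (fderiv ℝ (fderiv ℝ w) (0, a))) (0, a) :=
      (ContinuousLinearMap.apply ℝ W ((1 : ℝ), (0 : Space))).hasFDerivAt.comp _ hD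
    refine (h1.comp a (hasFDerivAt_prodMk_right 0 a)).congr_of_eventuallyEq ?_
    filter_upwards [hV₀.mem_nhds ha] with b hb
    exact (hasDerivAt_family_slice hV₀ hc h0 hb).deriv
  have e1 : HasDerivAt (fun s => fderiv ℝ (c s) a)
      ((fderiv ℝ (fderiv ℝ w) (0, a) (1, 0)).comp (ContinuousLinearMap.inr ℝ ℝ Space)) 0 := by
    have h1 : HasDerivAt (fun s : ℝ => fderiv ℝ w (s, a)) (fderiv ℝ (fderiv ℝ w) (0, a) (1, 0)) 0 :=
      hD.comp_hasDerivAt (0 : ℝ) ((hasDerivAt_id (0 : ℝ)).prodMk (hasDerivAt_const (0 : ℝ) a))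
    have h2 := (((ContinuousLinearMap.compL ℝ Space (ℝ × Space) W).flip
      (ContinuousLinearMap.inr ℝ ℝ Space)).hasFDerivAt).comp_hasDerivAt (0 : ℝ) h1
    refine HasDerivAt.congr_of_eventuallyEq h2 ?_
    filter_upwards [isOpen_Ioo.mem_nhds h0] with s hs
    exact (hasFDerivAt_family_slice hV₀ hc hs ha).fderiv
  convert! e1 using 1
  rw [e2.fderiv]
  ext v
  -- Both sides are mixed second derivatives of the joint function of parameter and label, in the
  -- two orders.
  simpa using hsymm (0, v) (1, 0)

/-- Joint smoothness in the parameter comes from inverting `(ε, a) ↦ (ε, X_ε(a))` as a single map.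
Its derivative is block triangular, hence injective once the label block is, and that block has
positive determinant. -/
theorem contDiffOn_family_inverse (hV₀ : IsOpen V₀)
    (hX : ContDiffOn ℝ ∞ (fun z : ℝ × Space => X z.1 z.2) (Ioo (-δ) δ ×ˢ V₀))
    (hL : ∀ ε ∈ Ioo (-δ) δ, IsLagrangianMap V₀ V (X ε)) :
    ContDiffOn ℝ ∞ (fun z : ℝ × Space => Function.invFunOn (X z.1) V₀ z.2)
      (Ioo (-δ) δ ×ˢ V) := by
  have hopen := isOpen_Ioo.prod hV₀ (s := Ioo (-δ) δ)
  have key : ContDiffOn ℝ ∞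
      (fun z : ℝ × Space => (z.1, Function.invFunOn (X z.1) V₀ z.2)) (Ioo (-δ) δ ×ˢ V) := by
    refine contDiffOn_leftInverse (Ψ := fun z : ℝ × Space => (z.1, X z.1 z.2)) hopen
      (contDiffOn_fst.prodMk hX) ?_ ?_ ?_
    · rintro ⟨ε, y⟩ ⟨hε, hy⟩
      obtain ⟨a, ha, rfl⟩ := (hL ε hε).2.1.surjOn hy
      exact ⟨(ε, a), ⟨hε, ha⟩, rfl⟩
    · rintro ⟨ε, a⟩ ⟨hε, ha⟩
      simp only [(hL ε hε).2.1.injOn.leftInvOn_invFunOn ha]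
    · rintro ⟨ε, a⟩ ⟨hε, ha⟩
      have h : HasFDerivAt (fun z : ℝ × Space => X z.1 z.2)
          (fderiv ℝ (fun z : ℝ × Space => X z.1 z.2) (ε, a)) (ε, a) :=
        ((hX.contDiffAt (hopen.mem_nhds ⟨hε, ha⟩)).differentiableAt (by simp)).hasFDerivAt
      have hΨ : HasFDerivAt (fun z : ℝ × Space => (z.1, X z.1 z.2))
          ((ContinuousLinearMap.fst ℝ ℝ Space).prod
            (fderiv ℝ (fun z : ℝ × Space => X z.1 z.2) (ε, a))) (ε, a) :=
        hasFDerivAt_fst.prodMk h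
      rw [hΨ.fderiv, injective_iff_map_eq_zero]
      rintro ⟨s, v⟩ hsv
      simp only [ContinuousLinearMap.prod_apply, ContinuousLinearMap.coe_fst', Prod.mk_eq_zero] at hsv
      obtain ⟨rfl, hv⟩ := hsv
      have hs := (hasFDerivAt_family_slice hV₀ hX hε ha).fderiv
      have hinj := injective_of_det_pos (A := fderiv ℝ (X ε) a) ((hL ε hε).2.2 a ha)
      rw [hs] at hinj
      have : v = 0 := hinj (by rw [map_zero]; simpa using hv)
      rw [this]; rfl
  exact contDiff_snd.comp_contDiffOn key

/-- A position in `V` outside `X₀(K)` has its label outside `K`; this label stays at the same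
position for every `ε`, so the transported field does not change there. The support of the Eulerian
family is thus the fixed compact set `X₀(K)`. -/
theorem isSmoothFamily_atPosition (hV₀ : IsOpen V₀) (hδ : 0 < δ)
    (hX : IsSmoothFamily V₀ K δ X) (hL : ∀ ε ∈ Ioo (-δ) δ, IsLagrangianMap V₀ V (X ε))
    (hc : ContDiffOn ℝ ∞ (fun z : ℝ × Space => c z.1 z.2) (Ioo (-δ) δ ×ˢ V₀))
    (hcK : ∀ ε ∈ Ioo (-δ) δ, ∀ a ∈ V₀, a ∉ K → c ε a = c 0 a) :
    IsSmoothFamily V (X 0 '' K) δ (fun ε => atPosition V₀ (X ε) (c ε)) := by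
  constructor
  · refine (hc.comp (contDiffOn_fst.prodMk (contDiffOn_family_inverse hV₀ hX.1 hL)) ?_).congr ?_
    · rintro ⟨ε, y⟩ ⟨hε, hy⟩
      exact ⟨hε, (hL ε hε).inverse_mem hy⟩
    · rintro ⟨ε, y⟩ ⟨hε, hy⟩
      exact atPosition_of_mem (hL ε hε) (c ε) hy
  · intro ε hε x hx
    have h0 := hL 0 ⟨by linarith, hδ⟩
    beta_reduce
    by_cases hxV : x ∈ V
    · obtain ⟨a, ha, rfl⟩ := h0.2.1.surjOn hxV
      have haK : a ∉ K := fun h => hx (mem_image_of_mem _ h)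
      rw [atPosition_apply h0 _ ha]
      conv_lhs => rw [← hX.2 ε hε a haK]
      rw [atPosition_apply (hL ε hε) _ ha, hcK ε hε a ha haK]
    · rw [atPosition_of_notMem (hL ε hε) _ hxV, atPosition_of_notMem h0 _ hxV]

/-- The complement of `K` is open, so equality of values off `K` passes to derivatives; the Jacobian
and the transported magnetic field need this. -/
theorem fderiv_eq_of_isSmoothFamily (hK : IsCompact K) (hX : IsSmoothFamily V₀ K δ X) {ε : ℝ}
    (hε : ε ∈ Ioo (-δ) δ) {a : Space} (ha : a ∉ K) : fderiv ℝ (X ε) a = fderiv ℝ (X 0) a := by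
  refine Filter.EventuallyEq.fderiv_eq ?_
  filter_upwards [hK.isClosed.isOpen_compl.mem_nhds ha] with b hb
  exact hX.2 ε hε b hb

/-- The Eulerian variation is the Lagrangian variation minus the advection by the displacement. -/
theorem deriv_atPosition (hV₀ : IsOpen V₀) (hV : IsOpen V) (hδ : 0 < δ)
    (hX : IsSmoothFamily V₀ K δ X) (hL : ∀ ε ∈ Ioo (-δ) δ, IsLagrangianMap V₀ V (X ε))
    (hc : ContDiffOn ℝ ∞ (fun z : ℝ × Space => c z.1 z.2) (Ioo (-δ) δ ×ˢ V₀))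
    (hcK : ∀ ε ∈ Ioo (-δ) δ, ∀ a ∈ V₀, a ∉ K → c ε a = c 0 a) {a : Space} (ha : a ∈ V₀) {c' : W}
    (hc' : HasDerivAt (fun s => c s a) c' 0) :
    HasDerivAt (fun s => atPosition V₀ (X s) (c s) (X 0 a))
      (c' - fderiv ℝ (atPosition V₀ (X 0) (c 0)) (X 0 a) (deriv (fun s => X s a) 0)) 0 := by
  have h0 : (0 : ℝ) ∈ Ioo (-δ) δ := ⟨by linarith, hδ⟩
  have hx : X 0 a ∈ V := (hL 0 h0).2.1.mapsTo ha
  have hR := (isSmoothFamily_atPosition hV₀ hδ hX hL hc hcK).1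
  set R : ℝ → Space → W := fun ε => atPosition V₀ (X ε) (c ε) with hRdef
  have hD : HasFDerivAt (fun z : ℝ × Space => R z.1 z.2)
      (fderiv ℝ (fun z : ℝ × Space => R z.1 z.2) (0, X 0 a)) (0, X 0 a) :=
    ((hR.contDiffAt ((isOpen_Ioo.prod hV).mem_nhds ⟨h0, hx⟩)).differentiableAt
      (by simp)).hasFDerivAt
  have hXd : HasDerivAt (fun s => X s a) (deriv (fun s => X s a) 0) 0 :=
    (hasDerivAt_family_slice hV₀ hX.1 h0 ha).differentiableAt.hasDerivAt
  have htot : HasDerivAt (fun s => R s (X s a))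
      (fderiv ℝ (fun z : ℝ × Space => R z.1 z.2) (0, X 0 a) (1, deriv (fun s => X s a) 0)) 0 :=
    HasFDerivAt.comp_hasDerivAt (f := fun s => (s, X s a)) (0 : ℝ) hD
      ((hasDerivAt_id (0 : ℝ)).prodMk hXd)
  -- Following the moving position recovers the label field. Its rate `c'` is therefore the total
  -- derivative, namely the rate at fixed position plus the spatial derivative along the
  -- displacement velocity.
  have hc'' : HasDerivAt (fun s => R s (X s a)) c' 0 := by
    refine hc'.congr_of_eventuallyEq ?_
    filter_upwards [isOpen_Ioo.mem_nhds h0] with s hs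
    exact atPosition_apply (hL s hs) _ ha
  have hslice := hasDerivAt_family_slice hV hR h0 hx
  convert! hslice using 1
  rw [← htot.unique hc'', (hasFDerivAt_family_slice hV hR h0 hx).fderiv, sub_eq_iff_eq_add,
    ContinuousLinearMap.comp_apply, ← map_add]
  simp

end Family

/-! ### The chain rule for variational derivatives -/

section ChainRule

variable {V₀ V K : Set Space} {δ : ℝ} {d : LabelData} {γ : ℝ → CanonicalFields}

theorem chainVector_continuousOn {Z f : EulerFields} (hV : IsOpen V) (hZ : Z.IsContDiffOn 1 V)
    (hf : f.IsContDiffOn 1 V) : ContinuousOn (chainVector Z f) V := by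
  have h1 : ∀ i, ContinuousOn (pd i f.rho) V := fun i => pd_continuousOn hV hf.1
  have h2 : ∀ i, ContinuousOn (pd i f.sigma) V := fun i => pd_continuousOn hV hf.2.1
  have h3 : ∀ i j, ContinuousOn (pd i fun y => f.mom y j) V := fun i j =>
    pd_continuousOn hV (contDiffOn_coord hf.2.2.1 j)
  have h4 : ∀ i j, ContinuousOn (pd i fun y => f.mag y j) V := fun i j =>
    pd_continuousOn hV (contDiffOn_coord hf.2.2.2 j)
  have h5 := div_continuousOn hV hZ.2.2.2
  have c1 := hZ.1.continuousOn
  have c2 := hZ.2.1.continuousOn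
  have c3 : ∀ j, ContinuousOn (fun y => Z.mom y j) V := fun j =>
    (contDiffOn_coord hZ.2.2.1 j).continuousOn
  have c4 : ∀ j, ContinuousOn (fun y => Z.mag y j) V := fun j =>
    (contDiffOn_coord hZ.2.2.2 j).continuousOn
  have c5 : ∀ j, ContinuousOn (fun y => f.mag y j) V := fun j =>
    (contDiffOn_coord hf.2.2.2 j).continuousOn
  refine (PiLp.continuous_toLp 2 _).comp_continuousOn (continuousOn_pi.2 fun i => ?_)
  refine ((((((continuousOn_finsetSum _ fun j _ => (h3 i j).mul (c3 j))).add
    (c2.mul (h2 i))).add (c1.mul (h1 i))).add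
    (continuousOn_finsetSum _ fun j _ => (h4 i j).mul (c4 j))).sub
    (continuousOn_finsetSum _ fun j _ => (c4 j).mul (h4 j i))).sub (h5.mul (c5 i))

theorem toEuler_isContDiffOn (hV₀ : IsOpen V₀) (hd : d.IsAdmissible V₀) {ζ : CanonicalFields}
    (hX : IsLagrangianMap V₀ V ζ.pos) (hM : ContDiffOn ℝ ∞ ζ.mom V₀) :
    (toEuler V₀ d ζ).IsContDiffOn ∞ V := by
  obtain ⟨h1, h2, h3, h4⟩ := hd
  have hD : ContDiffOn ℝ ∞ (fun a => fderiv ℝ ζ.pos a) V₀ :=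
    hX.1.fderiv_of_isOpen hV₀ (by simp)
  have hJ : ContDiffOn ℝ ∞ (jac ζ.pos) V₀ := contDiff_clm_det.comp_contDiffOn hD
  have hJ0 : ∀ a ∈ V₀, jac ζ.pos a ≠ 0 := fun a ha => (hX.2.2 a ha).ne'
  have hr := h1.div hJ hJ0
  exact ⟨atPosition_contDiffOn hV₀ hX hr, atPosition_contDiffOn hV₀ hX (hr.mul h2),
    atPosition_contDiffOn hV₀ hX (hr.smul ((h1.inv fun a ha => (h4 a ha).ne').smul hM)),
    atPosition_contDiffOn hV₀ hX ((hJ.inv hJ0).smul (hD.clm_apply h3))⟩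

/-- The label fields of a canonical variation, smooth in the parameter and the label. -/
theorem labelFields_contDiffOn (hV₀ : IsOpen V₀) (hd : d.IsAdmissible V₀)
    (hX : IsSmoothFamily V₀ K δ fun ε => (γ ε).pos) (hM : IsSmoothFamily V₀ K δ fun ε => (γ ε).mom)
    (hL : ∀ ε ∈ Ioo (-δ) δ, IsLagrangianMap V₀ V (γ ε).pos) :
    ContDiffOn ℝ ∞ (fun z : ℝ × Space => d.rho z.2 / jac (γ z.1).pos z.2) (Ioo (-δ) δ ×ˢ V₀) ∧
    ContDiffOn ℝ ∞ (fun z : ℝ × Space => d.rho z.2 / jac (γ z.1).pos z.2 * d.ent z.2)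
      (Ioo (-δ) δ ×ˢ V₀) ∧
    ContDiffOn ℝ ∞ (fun z : ℝ × Space => (d.rho z.2 / jac (γ z.1).pos z.2) •
      ((d.rho z.2)⁻¹ • (γ z.1).mom z.2)) (Ioo (-δ) δ ×ˢ V₀) ∧
    ContDiffOn ℝ ∞ (fun z : ℝ × Space => (jac (γ z.1).pos z.2)⁻¹ •
      fderiv ℝ (γ z.1).pos z.2 (d.mag z.2)) (Ioo (-δ) δ ×ˢ V₀) := by
  obtain ⟨h1, h2, h3, h4⟩ := hd
  have hm : MapsTo (Prod.snd : ℝ × Space → Space) (Ioo (-δ) δ ×ˢ V₀) V₀ := fun z hz => hz.2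
  have g1 := h1.comp contDiffOn_snd hm
  have g2 := h2.comp contDiffOn_snd hm
  have g3 := h3.comp contDiffOn_snd hm
  have hJ := contDiffOn_family_jac (X := fun ε => (γ ε).pos) hV₀ hX.1
  have hJ0 : ∀ z ∈ Ioo (-δ) δ ×ˢ V₀, jac (γ z.1).pos z.2 ≠ 0 := fun z hz =>
    ((hL z.1 hz.1).2.2 z.2 hz.2).ne'
  have hr := g1.div hJ hJ0
  exact ⟨hr, hr.mul g2, hr.smul ((g1.inv fun z hz => (h4 z.2 hz.2).ne').smul hM.1),
    (hJ.inv hJ0).smul ((contDiffOn_family_fderiv (c := fun ε => (γ ε).pos) hV₀ hX.1).clm_apply g3)⟩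

/-- This makes the hypothesis on the Eulerian functional applicable to canonical variations. The
four label fields depend on `X` through at most its first derivative, so they too are unchanged off
`K`. -/
theorem isEulerVariation_toEuler (hV₀ : IsOpen V₀) (hd : d.IsAdmissible V₀) {ζ : CanonicalFields}
    (hγ : IsCanonicalVariation V₀ V ζ γ) :
    IsEulerVariation V (toEuler V₀ d ζ) (fun ε => toEuler V₀ d (γ ε)) := by
  obtain ⟨rfl, δ, hδ, K, hK, hKV, hX, hM, hL⟩ := hγ
  have h0 := hL 0 ⟨by linarith, hδ⟩
  have hD : ∀ ε ∈ Ioo (-δ) δ, ∀ a, a ∉ K → fderiv ℝ (γ ε).pos a = fderiv ℝ (γ 0).pos a :=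
    fun ε hε a ha => fderiv_eq_of_isSmoothFamily hK hX hε ha
  have hJ : ∀ ε ∈ Ioo (-δ) δ, ∀ a, a ∉ K → jac (γ ε).pos a = jac (γ 0).pos a :=
    fun ε hε a ha => by rw [jac, jac, hD ε hε a ha]
  have hM' : ∀ ε ∈ Ioo (-δ) δ, ∀ a, a ∉ K → (γ ε).mom a = (γ 0).mom a := hM.2
  obtain ⟨c1, c2, c3, c4⟩ := labelFields_contDiffOn hV₀ hd hX hM hL
  refine ⟨rfl, δ, hδ, (γ 0).pos '' K, hK.image_of_continuousOn (h0.1.continuousOn.mono hKV),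
    h0.2.1.image_eq ▸ image_mono hKV, ?_, ?_, ?_, ?_⟩
  · exact isSmoothFamily_atPosition
      (c := fun ε a => d.rho a / jac (γ ε).pos a) hV₀ hδ hX hL c1 fun ε hε a _ ha => by rw [hJ ε hε a ha]
  · exact isSmoothFamily_atPosition
      (c := fun ε a => d.rho a / jac (γ ε).pos a * d.ent a) hV₀ hδ hX hL c2 fun ε hε a _ ha => by rw [hJ ε hε a ha]
  · exact isSmoothFamily_atPosition
      (c := fun ε a => (d.rho a / jac (γ ε).pos a) • ((d.rho a)⁻¹ • (γ ε).mom a)) hV₀ hδ hX hL c3 fun ε hε a _ ha => by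
      rw [hJ ε hε a ha, hM' ε hε a ha]
  · exact isSmoothFamily_atPosition
      (c := fun ε a => (jac (γ ε).pos a)⁻¹ • fderiv ℝ (γ ε).pos a (d.mag a)) hV₀ hδ hX hL c4 fun ε hε a _ ha => by
      rw [hJ ε hε a ha, hD ε hε a ha]

/-- The Eulerian displacement `ξ`: the variation of the position at fixed label, as a function
of the position. -/
noncomputable def displacement (V₀ : Set Space) (γ : ℝ → CanonicalFields) : Space → Space :=
  atPosition V₀ (γ 0).pos fun a => deriv (fun ε => (γ ε).pos a) 0

/-- The momentum variation at fixed label, per unit Eulerian volume. -/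
noncomputable def momentumShift (V₀ : Set Space) (γ : ℝ → CanonicalFields) : Space → Space :=
  atPosition V₀ (γ 0).pos fun a => (jac (γ 0).pos a)⁻¹ • deriv (fun ε => (γ ε).mom a) 0

/-- The Eulerian velocity of a canonical variation. -/
theorem eulerVelocity_toEuler (hV₀ : IsOpen V₀) (hV : IsOpen V) (hd : d.IsAdmissible V₀)
    (hδ : 0 < δ) (hK : IsCompact K)
    (hX : IsSmoothFamily V₀ K δ fun ε => (γ ε).pos) (hM : IsSmoothFamily V₀ K δ fun ε => (γ ε).mom)
    (hL : ∀ ε ∈ Ioo (-δ) δ, IsLagrangianMap V₀ V (γ ε).pos) {x : Space} (hx : x ∈ V) :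
    (eulerVelocity fun ε => toEuler V₀ d (γ ε)).rho x =
      -((toEuler V₀ d (γ 0)).rho x * div (displacement V₀ γ) x)
        - fderiv ℝ (toEuler V₀ d (γ 0)).rho x (displacement V₀ γ x) ∧
    (eulerVelocity fun ε => toEuler V₀ d (γ ε)).sigma x =
      -((toEuler V₀ d (γ 0)).sigma x * div (displacement V₀ γ) x)
        - fderiv ℝ (toEuler V₀ d (γ 0)).sigma x (displacement V₀ γ x) ∧
    (eulerVelocity fun ε => toEuler V₀ d (γ ε)).mom x =
      momentumShift V₀ γ x - div (displacement V₀ γ) x • (toEuler V₀ d (γ 0)).mom x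
        - fderiv ℝ (toEuler V₀ d (γ 0)).mom x (displacement V₀ γ x) ∧
    (eulerVelocity fun ε => toEuler V₀ d (γ ε)).mag x =
      fderiv ℝ (displacement V₀ γ) x ((toEuler V₀ d (γ 0)).mag x)
        - div (displacement V₀ γ) x • (toEuler V₀ d (γ 0)).mag x
        - fderiv ℝ (toEuler V₀ d (γ 0)).mag x (displacement V₀ γ x) := by
  have h0 : (0 : ℝ) ∈ Ioo (-δ) δ := ⟨by linarith, hδ⟩
  have hL0 := hL 0 h0
  obtain ⟨a, ha, rfl⟩ := hL0.2.1.surjOn hx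
  have hD : ∀ ε ∈ Ioo (-δ) δ, ∀ a, a ∉ K → fderiv ℝ (γ ε).pos a = fderiv ℝ (γ 0).pos a :=
    fun ε hε a ha => fderiv_eq_of_isSmoothFamily hK hX hε ha
  have hJ : ∀ ε ∈ Ioo (-δ) δ, ∀ a, a ∉ K → jac (γ ε).pos a = jac (γ 0).pos a :=
    fun ε hε a ha => by rw [jac, jac, hD ε hε a ha]
  have hM' : ∀ ε ∈ Ioo (-δ) δ, ∀ a, a ∉ K → (γ ε).mom a = (γ 0).mom a := hM.2
  obtain ⟨c1, c2, c3, c4⟩ := labelFields_contDiffOn hV₀ hd hX hM hL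
  set ξ := displacement V₀ γ with hξ
  have hξs : ContDiffOn ℝ ∞ ξ V :=
    atPosition_contDiffOn hV₀ hL0 (contDiffOn_family_velocity (c := fun ε => (γ ε).pos) hV₀ hδ hX.1)
  have hξa : ξ ((γ 0).pos a) = deriv (fun ε => (γ ε).pos a) 0 :=
    atPosition_apply hL0 (fun a => deriv (fun ε => (γ ε).pos a) 0) ha
  have hξd : DifferentiableAt ℝ ξ ((γ 0).pos a) :=
    (hξs.contDiffAt (hV.mem_nhds hx)).differentiableAt (by simp)
  -- On labels the velocity is `ξ ∘ X`, so its label gradient is `∇ξ ∘ DX`: exactly the form `A' = L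
  -- A` required by Jacobi's formula.
  have hgrad : fderiv ℝ (fun b => deriv (fun ε => (γ ε).pos b) 0) a
      = (fderiv ℝ ξ ((γ 0).pos a)).comp (fderiv ℝ (γ 0).pos a) := by
    refine HasFDerivAt.fderiv ?_
    refine (hξd.hasFDerivAt.comp a (hL0.hasFDerivAt hV₀ ha)).congr_of_eventuallyEq ?_
    filter_upwards [hV₀.mem_nhds ha] with b hb
    exact (atPosition_apply hL0 (fun a => deriv (fun ε => (γ ε).pos a) 0) hb).symm
  have hA : HasDerivAt (fun s => fderiv ℝ (γ s).pos a)
      ((fderiv ℝ ξ ((γ 0).pos a)).comp (fderiv ℝ (γ 0).pos a)) 0 := by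
    rw [← hgrad]
    exact hasDerivAt_family_fderiv (c := fun ε => (γ ε).pos) hV₀ hδ hX.1 ha
  have hdiv : ∑ i, fderiv ℝ ξ ((γ 0).pos a) (EuclideanSpace.single i 1) i
      = div ξ ((γ 0).pos a) :=
    Finset.sum_congr rfl fun i _ => (pd_coord ξ hξd i).symm
  have hJd : HasDerivAt (fun s => jac (γ s).pos a)
      (jac (γ 0).pos a * div ξ ((γ 0).pos a)) 0 := by
    have := hasDerivAt_clm_det hA
    rwa [hdiv] at this
  have hJ0 : jac (γ 0).pos a ≠ 0 := (hL0.2.2 a ha).ne'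
  have hJi : HasDerivAt (fun s => (jac (γ s).pos a)⁻¹)
      (-(div ξ ((γ 0).pos a) * (jac (γ 0).pos a)⁻¹)) 0 := by
    convert! hJd.inv hJ0 using 1
    field_simp
  have hMd : HasDerivAt (fun s => (γ s).mom a) (deriv (fun ε => (γ ε).mom a) 0) 0 :=
    (hasDerivAt_family_slice (c := fun ε => (γ ε).mom) hV₀ hM.1 h0 ha).differentiableAt.hasDerivAt
  have hr0 : d.rho a ≠ 0 := (hd.2.2.2 a ha).ne'
  -- The variations at fixed label: each division by `J` contributes `-(∇·ξ)` times the field, the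
  -- momentum gains `J⁻¹Δπ`, and the magnetic field is stretched by `∇ξ`. Advection is subtracted at
  -- the end by `deriv_atPosition`.
  have e1 : HasDerivAt (fun s => d.rho a / jac (γ s).pos a)
      (-((d.rho a / jac (γ 0).pos a) * div ξ ((γ 0).pos a))) 0 := by
    convert! hJi.const_mul (d.rho a) using 1
    field_simp
  have e2 : HasDerivAt (fun s => d.rho a / jac (γ s).pos a * d.ent a)
      (-((d.rho a / jac (γ 0).pos a * d.ent a) * div ξ ((γ 0).pos a))) 0 := by
    convert! e1.mul_const (d.ent a) using 1
    ring
  have e3 : HasDerivAt (fun s => (d.rho a / jac (γ s).pos a) • ((d.rho a)⁻¹ • (γ s).mom a))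
      ((jac (γ 0).pos a)⁻¹ • deriv (fun ε => (γ ε).mom a) 0 - div ξ ((γ 0).pos a) •
        ((d.rho a / jac (γ 0).pos a) • ((d.rho a)⁻¹ • (γ 0).mom a))) 0 := by
    convert! e1.smul (hMd.const_smul (d.rho a)⁻¹) using 1
    simp only [smul_smul, Pi.smul_apply]
    have : d.rho a / jac (γ 0).pos a * (d.rho a)⁻¹ = (jac (γ 0).pos a)⁻¹ := by field_simp
    rw [this, sub_eq_add_neg, ← neg_smul]
    congr 2
    field_simp
  have e4 : HasDerivAt (fun s => (jac (γ s).pos a)⁻¹ • fderiv ℝ (γ s).pos a (d.mag a))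
      (fderiv ℝ ξ ((γ 0).pos a) ((jac (γ 0).pos a)⁻¹ • fderiv ℝ (γ 0).pos a (d.mag a))
        - div ξ ((γ 0).pos a) • ((jac (γ 0).pos a)⁻¹ • fderiv ℝ (γ 0).pos a (d.mag a))) 0 := by
    have hA' : HasDerivAt (fun s => fderiv ℝ (γ s).pos a (d.mag a))
        (fderiv ℝ ξ ((γ 0).pos a) (fderiv ℝ (γ 0).pos a (d.mag a))) 0 := by
      simpa using hA.clm_apply (hasDerivAt_const (0 : ℝ) (d.mag a))
    convert! hJi.smul hA' using 1
    simp only [smul_smul, map_smul, neg_smul]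
    abel
  have hZ1 : (toEuler V₀ d (γ 0)).rho ((γ 0).pos a) = d.rho a / jac (γ 0).pos a :=
    atPosition_apply hL0 (fun a => d.rho a / jac (γ 0).pos a) ha
  have hZ2 : (toEuler V₀ d (γ 0)).sigma ((γ 0).pos a) = d.rho a / jac (γ 0).pos a * d.ent a :=
    atPosition_apply hL0 (fun a => d.rho a / jac (γ 0).pos a * d.ent a) ha
  have hZ3 : (toEuler V₀ d (γ 0)).mom ((γ 0).pos a)
      = (d.rho a / jac (γ 0).pos a) • ((d.rho a)⁻¹ • (γ 0).mom a) :=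
    atPosition_apply hL0
      (fun a => (d.rho a / jac (γ 0).pos a) • ((d.rho a)⁻¹ • (γ 0).mom a)) ha
  have hZ4 : (toEuler V₀ d (γ 0)).mag ((γ 0).pos a)
      = (jac (γ 0).pos a)⁻¹ • fderiv ℝ (γ 0).pos a (d.mag a) :=
    atPosition_apply hL0 (fun a => (jac (γ 0).pos a)⁻¹ • fderiv ℝ (γ 0).pos a (d.mag a)) ha
  have hP : momentumShift V₀ γ ((γ 0).pos a)
      = (jac (γ 0).pos a)⁻¹ • deriv (fun ε => (γ ε).mom a) 0 :=
    atPosition_apply hL0 (fun a => (jac (γ 0).pos a)⁻¹ • deriv (fun ε => (γ ε).mom a) 0) ha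
  rw [hZ1, hZ2, hZ3, hZ4, hP, hξa]
  refine ⟨?_, ?_, ?_, ?_⟩
  · exact (deriv_atPosition
      (c := fun ε a => d.rho a / jac (γ ε).pos a) hV₀ hV hδ hX hL c1
      (fun ε hε a _ ha => by rw [hJ ε hε a ha]) ha e1).deriv
  · exact (deriv_atPosition
      (c := fun ε a => d.rho a / jac (γ ε).pos a * d.ent a) hV₀ hV hδ hX hL c2
      (fun ε hε a _ ha => by rw [hJ ε hε a ha]) ha e2).deriv
  · exact (deriv_atPosition
      (c := fun ε a => (d.rho a / jac (γ ε).pos a) • ((d.rho a)⁻¹ • (γ ε).mom a)) hV₀ hV hδ hX hL c3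
      (fun ε hε a _ ha => by rw [hJ ε hε a ha, hM' ε hε a ha]) ha e3).deriv
  · exact (deriv_atPosition
      (c := fun ε a => (jac (γ ε).pos a)⁻¹ • fderiv ℝ (γ ε).pos a (d.mag a)) hV₀ hV hδ hX hL c4
      (fun ε hε a _ ha => by rw [hJ ε hε a ha, hD ε hε a ha]) ha e4).deriv

end ChainRule

/-! ### Integrating the chain rule by parts -/

section ChainRuleIntegral

variable {V₀ V K : Set Space} {δ : ℝ} {d : LabelData} {γ : ℝ → CanonicalFields}

/-- The Eulerian variation paired with `f`, up to divergences. -/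
theorem pair_advected_eq {Z f v : EulerFields} {ξ P : Space → Space} {x : Space}
    (hZ : Z.IsContDiffOn 1 V) (hf : f.IsContDiffOn 1 V) (hξ : ContDiffOn ℝ 1 ξ V)
    (hV : IsOpen V) (hx : x ∈ V)
    (h1 : v.rho x = -(Z.rho x * div ξ x) - fderiv ℝ Z.rho x (ξ x))
    (h2 : v.sigma x = -(Z.sigma x * div ξ x) - fderiv ℝ Z.sigma x (ξ x))
    (h3 : v.mom x = P x - div ξ x • Z.mom x - fderiv ℝ Z.mom x (ξ x))
    (h4 : v.mag x = fderiv ℝ ξ x (Z.mag x) - div ξ x • Z.mag x - fderiv ℝ Z.mag x (ξ x)) :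
    f.pair v x = inner ℝ (chainVector Z f x) (ξ x) + inner ℝ (f.mom x) (P x)
      + (div (discardedFlux Z f ⟨0, 0, ξ, 0⟩) x - div (operatorFlux Z f ⟨0, 0, ξ, 0⟩) x) := by
  -- With `ξ` as the only nonzero entry, in the `G_M` slot, the two bracket fluxes become `(ξ·F_B)
  -- B` and `(f·Z) ξ`, precisely the fluxes produced by moving derivatives off `ξ`.
  have hg : (⟨0, 0, ξ, 0⟩ : EulerFields).IsContDiffOn 1 V :=
    ⟨contDiffOn_const, contDiffOn_const, hξ, contDiffOn_const⟩
  have hd {w : Space → Space} (hw : ContDiffOn ℝ 1 w V) : DifferentiableAt ℝ w x :=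
    (hw.contDiffAt (hV.mem_nhds hx)).differentiableAt one_ne_zero
  have hc {w : Space → Space} (hw : ContDiffOn ℝ 1 w V) (u : Space) (i : Fin 3) :
      fderiv ℝ w x u i = ∑ k, u k * pd k (fun y => w y i) x := by
    rw [clm_apply_coord]
    exact Finset.sum_congr rfl fun k _ => by rw [pd_coord w (hd hw)]
  rw [div_discardedFlux (hZ.isDifferentiableAt hV hx) (hf.isDifferentiableAt hV hx)
      (hg.isDifferentiableAt hV hx), div_operatorFlux (hZ.isDifferentiableAt hV hx)
      (hf.isDifferentiableAt hV hx) (hg.isDifferentiableAt hV hx), EulerFields.pair, h1, h2, h3, h4]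
  simp only [inner_eq_three, PiLp.sub_apply, PiLp.smul_apply, smul_eq_mul, hc hξ, hc hZ.2.2.1,
    hc hZ.2.2.2, fderiv_eq_sum_pd, chainVector, div, Fin.sum_univ_three, EulerFields.pair,
    Pi.zero_apply, PiLp.zero_apply]
  ring

/-- The derivative of the functional along the variation is already known from the Eulerian side;
what remains is the equality of two integrals. -/
theorem hasCanonicalVarDeriv_chainRule (hV₀ : IsOpen V₀) (hV : IsOpen V)
    (hd : d.IsAdmissible V₀) {ζ : CanonicalFields} (hX : IsLagrangianMap V₀ V ζ.pos)
    (hM : ContDiffOn ℝ ∞ ζ.mom V₀) {F : EulerFields → ℝ} {f : EulerFields}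
    (hf : f.IsContDiffOn 1 V) (hF : HasEulerVarDeriv V F (toEuler V₀ d ζ) f) :
    HasCanonicalVarDeriv V₀ V (fun ξ => F (toEuler V₀ d ξ)) ζ
      (chainRule ζ.pos (toEuler V₀ d ζ) f) := by
  intro γ hγ
  have key := hF _ (isEulerVariation_toEuler hV₀ hd hγ)
  convert! key using 1
  obtain ⟨rfl, δ, hδ, K, hK, hKV, hXs, hMs, hL⟩ := hγ
  have hZ := (toEuler_isContDiffOn hV₀ hd hX hM).of_le (m := 1) (by simp)
  set Z := toEuler V₀ d (γ 0)
  set ξ := displacement V₀ γ with hξ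
  set P := momentumShift V₀ γ with hP
  have h0 : (0 : ℝ) ∈ Ioo (-δ) δ := ⟨by linarith, hδ⟩
  have hJ : ContDiffOn ℝ ∞ (jac (γ 0).pos) V₀ :=
    contDiff_clm_det.comp_contDiffOn (hX.1.fderiv_of_isOpen hV₀ (by simp))
  have hξs : ContDiffOn ℝ 1 ξ V := (atPosition_contDiffOn hV₀ hX
    (contDiffOn_family_velocity (c := fun ε => (γ ε).pos) hV₀ hδ hXs.1)).of_le (by simp)
  have hPs : ContDiffOn ℝ 1 P V := (atPosition_contDiffOn hV₀ hX
    ((hJ.inv fun a ha => (hX.2.2 a ha).ne').smul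
      (contDiffOn_family_velocity (c := fun ε => (γ ε).mom) hV₀ hδ hMs.1))).of_le (by simp)
  have hξa : ∀ a ∈ V₀, ξ ((γ 0).pos a) = deriv (fun ε => (γ ε).pos a) 0 := fun a ha =>
    atPosition_apply hX (fun a => deriv (fun ε => (γ ε).pos a) 0) ha
  have hPa : ∀ a ∈ V₀, P ((γ 0).pos a) = (jac (γ 0).pos a)⁻¹ • deriv (fun ε => (γ ε).mom a) 0 :=
    fun a ha =>
      atPosition_apply hX (fun a => (jac (γ 0).pos a)⁻¹ • deriv (fun ε => (γ ε).mom a) 0) ha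
  have hz {w : ℝ → Space → Space} (hw : IsSmoothFamily V₀ K δ w) (a : Space) (ha : a ∉ K) :
      deriv (fun ε => w ε a) 0 = 0 := by
    have : (fun ε => w ε a) =ᶠ[𝓝 0] fun _ => w 0 a := by
      filter_upwards [isOpen_Ioo.mem_nhds h0] with ε hε
      exact hw.2 ε hε a ha
    rw [this.deriv_eq, deriv_const]
  have hξ0 : ∀ x ∈ V, x ∉ (γ 0).pos '' K → ξ x = 0 := by
    intro x hx hxK
    obtain ⟨a, ha, rfl⟩ := hX.2.1.surjOn hx
    rw [hξa a ha, hz hXs a fun h => hxK (mem_image_of_mem _ h)]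
  have hP0 : ∀ x ∈ V, x ∉ (γ 0).pos '' K → P x = 0 := by
    intro x hx hxK
    obtain ⟨a, ha, rfl⟩ := hX.2.1.surjOn hx
    rw [hPa a ha, hz hMs a fun h => hxK (mem_image_of_mem _ h), smul_zero]
  have hK' : IsCompact ((γ 0).pos '' K) :=
    hK.image_of_continuousOn (hX.1.continuousOn.mono hKV)
  have hKV' : (γ 0).pos '' K ⊆ V := hX.2.1.image_eq ▸ image_mono hKV
  have hg : (⟨0, 0, ξ, 0⟩ : EulerFields).IsContDiffOn 1 V :=
    ⟨contDiffOn_const, contDiffOn_const, hξs, contDiffOn_const⟩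
  obtain ⟨i1, j1⟩ := div_integral_of_vanishesNearBoundary hV (discardedFlux_contDiffOn hZ hf hg)
    ⟨_, hK', hKV', fun x hx hxK => by simp [discardedFlux, hξ0 x hx hxK]⟩
  obtain ⟨i2, j2⟩ := div_integral_of_vanishesNearBoundary hV (operatorFlux_contDiffOn hZ hf hg)
    ⟨_, hK', hKV', fun x hx hxK => by simp [operatorFlux, hξ0 x hx hxK]⟩
  have i3 : IntegrableOn
      (fun x => inner ℝ (chainVector Z f x) (ξ x) + inner ℝ (f.mom x) (P x)) V := by
    refine integrableOn_of_support hV hK' hKV' (((chainVector_continuousOn hV hZ hf).inner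
      hξs.continuousOn).add (hf.2.2.1.continuousOn.inner hPs.continuousOn)) fun x hx hxK => ?_
    simp [hξ0 x hx hxK, hP0 x hx hxK]
  have i12 : IntegrableOn (fun x => div (discardedFlux Z f ⟨0, 0, ξ, 0⟩) x
      - div (operatorFlux Z f ⟨0, 0, ξ, 0⟩) x) V := i1.sub i2
  have hvel : ∀ x ∈ V, f.pair (eulerVelocity fun ε => toEuler V₀ d (γ ε)) x
      = inner ℝ (chainVector Z f x) (ξ x) + inner ℝ (f.mom x) (P x)
      + (div (discardedFlux Z f ⟨0, 0, ξ, 0⟩) x - div (operatorFlux Z f ⟨0, 0, ξ, 0⟩) x) := by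
    intro x hx
    obtain ⟨e1, e2, e3, e4⟩ := eulerVelocity_toEuler hV₀ hV hd hδ hK hXs hMs hL hx
    exact pair_advected_eq hZ hf hξs hV hx e1 e2 e3 e4
  -- Both fluxes vanish off `X₀(K)`, so their divergences drop out, and the remainder is pulled back
  -- to the labels.
  rw [setIntegral_congr_fun hV.measurableSet hvel, integral_add i3 i12,
    integral_sub i1 i2, j1, j2, sub_zero, add_zero, integral_eq_integral_label hV₀ hX]
  -- The Jacobian survives as the factor `J` in `F_x`, while in the momentum term it cancels the
  -- `J⁻¹` of `momentumShift`.
  refine setIntegral_congr_fun hV₀.measurableSet fun a ha => ?_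
  have hJ0 : jac (γ 0).pos a ≠ 0 := (hX.2.2 a ha).ne'
  simp only [hξa a ha, hPa a ha, chainRule, inner_smul_left, inner_smul_right]
  simp only [conj_trivial]
  field_simp

end ChainRuleIntegral

/-! ### Uniqueness of variational derivatives -/

section Uniqueness

variable {V₀ V K : Set Space}

/-- The fundamental lemma of the calculus of variations. -/
theorem eqOn_of_integral_mul_eq (hV : IsOpen V) {h k : Space → ℝ} (hh : ContinuousOn h V)
    (hk : ContinuousOn k V)
    (H : ∀ g : Space → ℝ, ContDiff ℝ ∞ g → HasCompactSupport g → tsupport g ⊆ V →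
      ∫ x in V, h x * g x = ∫ x in V, k x * g x) : EqOn h k V := by
  have hint : ∀ w : Space → ℝ, ContinuousOn w V → ∀ g : Space → ℝ, ContDiff ℝ ∞ g →
      HasCompactSupport g → tsupport g ⊆ V → IntegrableOn (fun x => w x * g x) V := by
    intro w hw g hg hgc hgV
    refine integrableOn_of_support hV hgc hgV (hw.mul hg.continuous.continuousOn) fun x _ hx => ?_
    rw [image_eq_zero_of_notMem_tsupport hx, mul_zero]
  have hae : ∀ᵐ x, x ∈ V → h x - k x = 0 := by
    refine hV.ae_eq_zero_of_integral_contDiff_smul_eq_zero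
      ((hh.sub hk).locallyIntegrableOn hV.measurableSet) fun g hg hgc hgV => ?_
    have h1 : ∫ x in V, g x • (h x - k x) = 0 := by
      have : ∀ x, g x • (h x - k x) = h x * g x - k x * g x := fun x => by
        rw [smul_eq_mul]; ring
      simp only [this]
      rw [integral_sub (hint h hh g hg hgc hgV) (hint k hk g hg hgc hgV), H g hg hgc hgV, sub_self]
    rw [← h1]
    refine (setIntegral_eq_integral_of_forall_compl_eq_zero fun x hx => ?_).symm
    rw [image_eq_zero_of_notMem_tsupport fun hxs => hx (hgV hxs), zero_smul]
  refine Measure.eqOn_open_of_ae_eq (μ := volume) ?_ hV hh hk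
  rw [EventuallyEq, ae_restrict_iff' hV.measurableSet]
  filter_upwards [hae] with x hx hxV
  exact sub_eq_zero.1 (hx hxV)

/-- The fundamental lemma of the calculus of variations, for vector fields. -/
theorem eqOn_of_integral_inner_eq (hV : IsOpen V) {h k : Space → Space} (hh : ContinuousOn h V)
    (hk : ContinuousOn k V)
    (H : ∀ g : Space → Space, ContDiff ℝ ∞ g → HasCompactSupport g → tsupport g ⊆ V →
      ∫ x in V, inner ℝ (h x) (g x) = ∫ x in V, inner ℝ (k x) (g x)) : EqOn h k V := by
  have hcoord : ∀ i : Fin 3, EqOn (fun x => h x i) (fun x => k x i) V := by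
    intro i
    have hp : Continuous fun v : Space => v i := (EuclideanSpace.proj (𝕜 := ℝ) i).continuous
    refine eqOn_of_integral_mul_eq hV (hp.comp_continuousOn hh) (hp.comp_continuousOn hk)
      fun g hg hgc hgV => ?_
    have := H (fun x => g x • EuclideanSpace.single i 1) (hg.smul contDiff_const)
      (hgc.smul_right) ((tsupport_smul_subset_left g _).trans hgV)
    simpa [inner_smul_right, EuclideanSpace.inner_single_right, mul_comm] using this
  intro x hx
  ext i
  exact hcoord i hx

/-- For small `ε` the equation `y + εφ(y) = z` is a fixed point problem for the contraction `y ↦ z -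
εφ(y)`, so the map is a bijection of space. It is the identity outside `V`, hence it restricts to a
bijection of `V`. The determinant is controlled uniformly because the Lipschitz constant bounds the
derivative of `φ`. -/
theorem exists_perturbation_of_id {φ : Space → Space} (hφ : ContDiff ℝ ∞ φ) (hK : IsCompact K)
    (hKV : K ⊆ V) (h0 : ∀ x, x ∉ K → φ x = 0) :
    ∃ δ : ℝ, 0 < δ ∧ ∀ ε ∈ Ioo (-δ) δ, BijOn (fun y => y + ε • φ y) V V ∧
      ∀ y, 0 < (ContinuousLinearMap.id ℝ Space + ε • fderiv ℝ φ y).det := by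
  have hs : HasCompactSupport φ := HasCompactSupport.intro hK h0
  obtain ⟨C, hC⟩ := ContDiff.lipschitzWith_of_hasCompactSupport hs hφ (by simp)
  have hdet : ∀ᶠ A : Space →L[ℝ] Space in 𝓝 0, 0 < (ContinuousLinearMap.id ℝ Space + A).det := by
    have hc : Continuous fun A : Space →L[ℝ] Space => (ContinuousLinearMap.id ℝ Space + A).det :=
      contDiff_clm_det.continuous.comp (continuous_const.add continuous_id)
    refine hc.continuousAt.eventually_mem (isOpen_Ioi.mem_nhds ?_)
    have : (ContinuousLinearMap.id ℝ Space).det = 1 := LinearMap.det_id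
    simp [this]
  obtain ⟨r, hr, hrdet⟩ := Metric.eventually_nhds_iff.1 hdet
  have hC1 : (0 : ℝ) < C + 1 := by positivity
  -- The choice gives `|ε|C < 1` for the contraction and `|ε|C < r` for the determinant; `C + 1`
  -- avoids division by zero.
  refine ⟨min 1 r / (C + 1), by positivity, fun ε hε => ?_⟩
  have hε' : |ε| * (C + 1) < min 1 r := (lt_div_iff₀ hC1).1 (abs_lt.2 hε)
  have hε1 : |ε| * C < 1 := by
    have := min_le_left 1 r
    nlinarith [abs_nonneg ε]
  have hεr : |ε| * C < r := by
    have := min_le_right 1 r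
    nlinarith [abs_nonneg ε]
  have hcon : ∀ z, ContractingWith (‖ε‖₊ * C) fun y => z - ε • φ y := by
    intro z
    refine ⟨by rw [← NNReal.coe_lt_coe]; simpa using hε1, ?_⟩
    refine LipschitzWith.of_dist_le_mul fun a b => ?_
    rw [dist_sub_left, dist_smul₀]
    have := hC.dist_le_mul a b
    simp only [NNReal.coe_mul, coe_nnnorm]
    rw [mul_assoc]
    gcongr
  have hinj : Function.Injective fun y => y + ε • φ y := by
    intro a b hab
    refine (hcon (a + ε • φ a)).fixedPoint_unique' (x := a) (y := b) ?_ ?_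
    · simp [Function.IsFixedPt]
    · simp only at hab
      simp [Function.IsFixedPt, hab]
  have hout : ∀ y, y ∉ V → y + ε • φ y = y := fun y hy => by
    rw [h0 y fun h => hy (hKV h), smul_zero, add_zero]
  refine ⟨⟨fun y hy => ?_, hinj.injOn, fun z hz => ?_⟩, fun y => ?_⟩
  -- If the image of `y` left `V` it would be a fixed point of the map, so injectivity would force
  -- it to equal `y`, which lies in `V`.
  · by_contra hyV
    have := hinj (a₁ := y + ε • φ y) (a₂ := y) (hout _ hyV)
    exact hyV (by simpa only [this] using hy)
  · have hfix : z - ε • φ (hcon z).fixedPoint = (hcon z).fixedPoint := (hcon z).fixedPoint_isFixedPt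
    set y := (hcon z).fixedPoint
    have hy : y + ε • φ y = z := by rw [← sub_eq_iff_eq_add.1 hfix]
    refine ⟨y, ?_, hy⟩
    by_contra hyV
    rw [hout y hyV] at hy
    exact hyV (hy ▸ hz)
  · refine hrdet ?_
    rw [dist_zero_right, norm_smul, Real.norm_eq_abs]
    refine lt_of_le_of_lt ?_ hεr
    gcongr
    exact norm_fderiv_le_of_lipschitz ℝ hC

/-- Compactly supported label fields generate canonical variations. -/
theorem isCanonicalVariation_add (hV₀ : IsOpen V₀) (hV : IsOpen V) {ζ : CanonicalFields}
    (hX : IsLagrangianMap V₀ V ζ.pos) (hM : ContDiffOn ℝ ∞ ζ.mom V₀) {ψ θ : Space → Space}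
    (hψ : ContDiff ℝ ∞ ψ) (hψc : HasCompactSupport ψ) (hψV : tsupport ψ ⊆ V₀)
    (hθ : ContDiff ℝ ∞ θ) (hθc : HasCompactSupport θ) (hθV : tsupport θ ⊆ V₀) :
    IsCanonicalVariation V₀ V ζ fun ε =>
      ⟨fun a => ζ.pos a + ε • ψ a, fun a => ζ.mom a + ε • θ a⟩ := by
  have hK : IsCompact (ζ.pos '' tsupport ψ) :=
    IsCompact.image_of_continuousOn hψc (hX.1.continuousOn.mono hψV)
  have hKV : ζ.pos '' tsupport ψ ⊆ V := hX.2.1.image_eq ▸ image_mono hψV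
  -- The label perturbation, transported to positions and extended by zero: on `V₀` the perturbed
  -- map `X + εψ` factors as `(id + εφ) ∘ X`.
  set φ : Space → Space := V.indicator (atPosition V₀ ζ.pos ψ) with hφdef
  have hz : ∀ x ∈ V, x ∉ ζ.pos '' tsupport ψ → atPosition V₀ ζ.pos ψ x = 0 := by
    intro x hx hxK
    obtain ⟨a, ha, rfl⟩ := hX.2.1.surjOn hx
    rw [atPosition_apply hX ψ ha,
      image_eq_zero_of_notMem_tsupport fun h => hxK (mem_image_of_mem _ h)]
  have hφ : ContDiff ℝ ∞ φ := contDiff_indicator_of_support hV hK hKV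
    (atPosition_contDiffOn hV₀ hX hψ.contDiffOn) hz
  have hφ0 : ∀ x, x ∉ ζ.pos '' tsupport ψ → φ x = 0 := by
    intro x hx
    by_cases hxV : x ∈ V
    · rw [hφdef, indicator_of_mem hxV, hz x hxV hx]
    · rw [hφdef, indicator_of_notMem hxV]
  have hφa : ∀ a ∈ V₀, φ (ζ.pos a) = ψ a := fun a ha => by
    rw [hφdef, indicator_of_mem (hX.2.1.mapsTo ha), atPosition_apply hX ψ ha]
  obtain ⟨δ, hδ, hpert⟩ := exists_perturbation_of_id hφ hK hKV hφ0
  have hfam {w η : Space → Space} (hw : ContDiffOn ℝ ∞ w V₀) (hη : ContDiff ℝ ∞ η)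
      (hηK : tsupport η ⊆ tsupport ψ ∪ tsupport θ) :
      IsSmoothFamily V₀ (tsupport ψ ∪ tsupport θ) δ fun ε a => w a + ε • η a := by
    refine ⟨?_, fun ε _ x hx => ?_⟩
    · exact (hw.comp contDiffOn_snd fun z hz => hz.2).add
        (contDiffOn_fst.smul (hη.comp_contDiffOn contDiffOn_snd))
    · simp [image_eq_zero_of_notMem_tsupport fun h => hx (hηK h)]
  refine ⟨by simp, δ, hδ, tsupport ψ ∪ tsupport θ, IsCompact.union hψc hθc,
    union_subset hψV hθV, hfam hX.1 hψ subset_union_left, hfam hM hθ subset_union_right,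
    fun ε hε => ?_⟩
  obtain ⟨hbij, hdet⟩ := hpert ε hε
  have hEq : EqOn (fun a => ζ.pos a + ε • ψ a) ((fun y => y + ε • φ y) ∘ ζ.pos) V₀ :=
    fun a ha => by simp [hφa a ha]
  refine ⟨hX.1.add (hψ.contDiffOn.const_smul ε), ?_, fun a ha => ?_⟩
  · exact (hbij.comp hX.2.1).congr hEq.symm
  · have hd : HasFDerivAt (fun a => ζ.pos a + ε • ψ a)
        ((ContinuousLinearMap.id ℝ Space + ε • fderiv ℝ φ (ζ.pos a)).comp
          (fderiv ℝ ζ.pos a)) a := by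
      have h1 : HasFDerivAt (fun y => y + ε • φ y)
          (ContinuousLinearMap.id ℝ Space + ε • fderiv ℝ φ (ζ.pos a)) (ζ.pos a) :=
        (hasFDerivAt_id _).add ((hφ.differentiable (by simp) _).hasFDerivAt.const_smul ε)
      exact (h1.comp a (hX.hasFDerivAt hV₀ ha)).congr_of_eventuallyEq
        (hEq.eventuallyEq_of_mem (hV₀.mem_nhds ha))
    have : jac (fun a => ζ.pos a + ε • ψ a) a =
        (ContinuousLinearMap.id ℝ Space + ε • fderiv ℝ φ (ζ.pos a)).det * jac ζ.pos a := by
      rw [jac, hd.fderiv]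
      exact LinearMap.det_comp _ _
    rw [this]
    exact mul_pos (hdet _) (hX.2.2 a ha)

/-- A continuous canonical variational derivative is unique. -/
theorem HasCanonicalVarDeriv.eqOn (hV₀ : IsOpen V₀) (hV : IsOpen V) {ζ : CanonicalFields}
    (hX : IsLagrangianMap V₀ V ζ.pos) (hM : ContDiffOn ℝ ∞ ζ.mom V₀)
    {F : CanonicalFields → ℝ} {k l : CanonicalFields}
    (hk : HasCanonicalVarDeriv V₀ V F ζ k) (hl : HasCanonicalVarDeriv V₀ V F ζ l)
    (hk1 : ContinuousOn k.pos V₀) (hk2 : ContinuousOn k.mom V₀)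
    (hl1 : ContinuousOn l.pos V₀) (hl2 : ContinuousOn l.mom V₀) :
    EqOn k.pos l.pos V₀ ∧ EqOn k.mom l.mom V₀ := by
  have hder (w : Space → Space) (η : Space → Space) (a : Space) :
      deriv (fun ε : ℝ => w a + ε • η a) 0 = η a := by
    have : HasDerivAt (fun ε : ℝ => w a + ε • η a) ((1 : ℝ) • η a) 0 :=
      ((hasDerivAt_id (0 : ℝ)).smul_const (η a)).const_add (w a)
    rw [this.deriv, one_smul]
  have hzc : HasCompactSupport (0 : Space → Space) := HasCompactSupport.zero
  have hzs : tsupport (0 : Space → Space) ⊆ V₀ := by simp [tsupport]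
  constructor
  · refine eqOn_of_integral_inner_eq hV₀ hk1 hl1 fun g hg hgc hgV => ?_
    have hv := isCanonicalVariation_add hV₀ hV hX hM hg hgc hgV contDiff_const hzc hzs
    have := (hk _ hv).unique (hl _ hv)
    simp only [hder] at this
    simpa using this
  · refine eqOn_of_integral_inner_eq hV₀ hk2 hl2 fun g hg hgc hgV => ?_
    have hv := isCanonicalVariation_add hV₀ hV hX hM contDiff_const hzc hzs hg hgc hgV
    have := (hk _ hv).unique (hl _ hv)
    simp only [hder] at this
    simpa using this

/-- All four fields are continuous on `V`. -/
def EulerFields.IsContinuousOn (V : Set Space) (Z : EulerFields) : Prop :=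
  ContinuousOn Z.rho V ∧ ContinuousOn Z.sigma V ∧ ContinuousOn Z.mom V ∧ ContinuousOn Z.mag V

theorem EulerFields.IsContDiffOn.isContinuousOn {n : WithTop ℕ∞} {Z : EulerFields}
    (h : Z.IsContDiffOn n V) : Z.IsContinuousOn V :=
  ⟨h.1.continuousOn, h.2.1.continuousOn, h.2.2.1.continuousOn, h.2.2.2.continuousOn⟩

/-- All four fields agree on `V`. -/
def EulerFields.AgreeOn (V : Set Space) (f g : EulerFields) : Prop :=
  EqOn f.rho g.rho V ∧ EqOn f.sigma g.sigma V ∧ EqOn f.mom g.mom V ∧ EqOn f.mag g.mag V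

theorem isTestField_of_tsupport {φ : EulerFields} (h1 : ContDiff ℝ ∞ φ.rho)
    (h2 : ContDiff ℝ ∞ φ.sigma) (h3 : ContDiff ℝ ∞ φ.mom) (h4 : ContDiff ℝ ∞ φ.mag)
    (hK : IsCompact K) (hKV : K ⊆ V)
    (h0 : ∀ x, x ∉ K → φ.rho x = 0 ∧ φ.sigma x = 0 ∧ φ.mom x = 0 ∧ φ.mag x = 0) :
    IsTestField V φ :=
  ⟨⟨h1.contDiffOn, h2.contDiffOn, h3.contDiffOn, h4.contDiffOn⟩, K, hK, hKV, h0⟩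

/-- Test fields with a single nonzero entry separate the four components and reduce the claim to the
fundamental lemma for each. -/
theorem agreeOn_of_integral_pair_eq (hV : IsOpen V) {f g : EulerFields} (hf : f.IsContinuousOn V)
    (hg : g.IsContinuousOn V)
    (H : ∀ φ, IsTestField V φ → ∫ x in V, f.pair φ x = ∫ x in V, g.pair φ x) :
    f.AgreeOn V g := by
  have c0 : ContDiff ℝ ∞ (0 : Space → ℝ) := contDiff_const
  have c0' : ContDiff ℝ ∞ (0 : Space → Space) := contDiff_const
  refine ⟨?_, ?_, ?_, ?_⟩
  · refine eqOn_of_integral_mul_eq hV hf.1 hg.1 fun w hw hwc hwV => ?_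
    simpa [EulerFields.pair] using H ⟨w, 0, 0, 0⟩ (isTestField_of_tsupport hw c0 c0' c0' hwc hwV
      fun x hx => ⟨image_eq_zero_of_notMem_tsupport hx, rfl, rfl, rfl⟩)
  · refine eqOn_of_integral_mul_eq hV hf.2.1 hg.2.1 fun w hw hwc hwV => ?_
    simpa [EulerFields.pair] using H ⟨0, w, 0, 0⟩ (isTestField_of_tsupport c0 hw c0' c0' hwc hwV
      fun x hx => ⟨rfl, image_eq_zero_of_notMem_tsupport hx, rfl, rfl⟩)
  · refine eqOn_of_integral_inner_eq hV hf.2.2.1 hg.2.2.1 fun w hw hwc hwV => ?_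
    simpa [EulerFields.pair] using H ⟨0, 0, w, 0⟩ (isTestField_of_tsupport c0 c0 hw c0' hwc hwV
      fun x hx => ⟨rfl, rfl, image_eq_zero_of_notMem_tsupport hx, rfl⟩)
  · refine eqOn_of_integral_inner_eq hV hf.2.2.2 hg.2.2.2 fun w hw hwc hwV => ?_
    simpa [EulerFields.pair] using H ⟨0, 0, 0, w⟩ (isTestField_of_tsupport c0 c0 c0' hw hwc hwV
      fun x hx => ⟨rfl, rfl, rfl, image_eq_zero_of_notMem_tsupport hx⟩)

/-- A continuous Eulerian variational derivative is unique on the domain. -/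
theorem HasEulerVarDeriv.agreeOn (hV : IsOpen V) {Z : EulerFields} (hZ : Z.IsContDiffOn ∞ V)
    {F : EulerFields → ℝ} {f g : EulerFields}
    (hf : HasEulerVarDeriv V F Z f) (hg : HasEulerVarDeriv V F Z g)
    (hfc : f.IsContinuousOn V) (hgc : g.IsContinuousOn V) :
    f.AgreeOn V g := by
  have hder {W : Type} [NormedAddCommGroup W] [NormedSpace ℝ W] (w η : Space → W) (a : Space) :
      deriv (fun ε : ℝ => w a + ε • η a) 0 = η a := by
    have : HasDerivAt (fun ε : ℝ => w a + ε • η a) ((1 : ℝ) • η a) 0 :=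
      ((hasDerivAt_id (0 : ℝ)).smul_const (η a)).const_add (w a)
    rw [this.deriv, one_smul]
  have hfam {W : Type} [NormedAddCommGroup W] [NormedSpace ℝ W] {w η : Space → W} {K : Set Space}
      (hw : ContDiffOn ℝ ∞ w V) (hη : ContDiff ℝ ∞ η) (hηK : ∀ x, x ∉ K → η x = 0) :
      IsSmoothFamily V K 1 fun ε a => w a + ε • η a := by
    refine ⟨?_, fun ε _ x hx => by simp [hηK x hx]⟩
    exact (hw.comp contDiffOn_snd fun z hz => hz.2).add
      (contDiffOn_fst.smul (hη.comp_contDiffOn contDiffOn_snd))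
  have hvar (φ : EulerFields) (hφ : IsTestField V φ) :
      IsEulerVariation V Z fun ε => ⟨fun x => Z.rho x + ε • φ.rho x,
        fun x => Z.sigma x + ε • φ.sigma x, fun x => Z.mom x + ε • φ.mom x,
        fun x => Z.mag x + ε • φ.mag x⟩ := by
    obtain ⟨⟨h1, h2, h3, h4⟩, K, hK, hKV, h0⟩ := hφ
    rw [contDiffOn_univ] at h1 h2 h3 h4
    exact ⟨by simp, 1, one_pos, K, hK, hKV, hfam hZ.1 h1 fun x hx => (h0 x hx).1,
      hfam hZ.2.1 h2 fun x hx => (h0 x hx).2.1, hfam hZ.2.2.1 h3 fun x hx => (h0 x hx).2.2.1,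
      hfam hZ.2.2.2 h4 fun x hx => (h0 x hx).2.2.2⟩
  refine agreeOn_of_integral_pair_eq hV hfc hgc fun φ hφ => ?_
  have := (hf _ (hvar φ hφ)).unique (hg _ (hvar φ hφ))
  simpa only [EulerFields.pair, eulerVelocity, hder] using this

end Uniqueness

/-! ### The canonical bracket in Eulerian variables -/

section CanonicalBracket

variable {V₀ V : Set Space} {d : LabelData} {ζ : CanonicalFields}

theorem hasCanonicalVarDeriv_eq_chainRule (hV₀ : IsOpen V₀) (hV : IsOpen V)
    (hd : d.IsAdmissible V₀) (hX : IsLagrangianMap V₀ V ζ.pos) (hM : ContDiffOn ℝ ∞ ζ.mom V₀)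
    {F : EulerFields → ℝ} {f : EulerFields}
    (hf : f.IsContDiffOn 1 V) (hF : HasEulerVarDeriv V F (toEuler V₀ d ζ) f)
    {k : CanonicalFields} (hk1 : ContinuousOn k.pos V₀) (hk2 : ContinuousOn k.mom V₀)
    (hk : HasCanonicalVarDeriv V₀ V (fun ξ => F (toEuler V₀ d ξ)) ζ k) :
    ∀ a ∈ V₀, k.pos a = (chainRule ζ.pos (toEuler V₀ d ζ) f).pos a ∧
      k.mom a = (chainRule ζ.pos (toEuler V₀ d ζ) f).mom a := by
  have hZ := (toEuler_isContDiffOn hV₀ hd hX hM).of_le (m := 1) (by simp)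
  have hJ : ContDiffOn ℝ ∞ (jac ζ.pos) V₀ :=
    contDiff_clm_det.comp_contDiffOn (hX.1.fderiv_of_isOpen hV₀ (by simp))
  have hmap : MapsTo ζ.pos V₀ V := hX.2.1.mapsTo
  obtain ⟨h1, h2⟩ := hk.eqOn hV₀ hV hX hM (hasCanonicalVarDeriv_chainRule hV₀ hV hd hX hM hf hF)
    hk1 hk2
    (hJ.continuousOn.smul ((chainVector_continuousOn hV hZ hf).comp hX.1.continuousOn hmap))
    (hf.2.2.1.continuousOn.comp hX.1.continuousOn hmap)
  exact fun a ha => ⟨h1 ha, h2 ha⟩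

/-- Both position derivatives carry one factor `J` and both momentum derivatives none, so the
canonical integrand is the pullback, Jacobian included, of the CGL integrand minus the divergence of
the flux. -/
theorem canonicalBracket_eq (hV₀ : IsOpen V₀) (hV : IsOpen V)
    (hX : IsLagrangianMap V₀ V ζ.pos) {Z f g : EulerFields} {k l : CanonicalFields}
    (hZ : Z.IsContDiffOn 1 V) (hf : f.IsContDiffOn 1 V) (hg : g.IsContDiffOn 1 V)
    (hk : ∀ a ∈ V₀, k.pos a = (chainRule ζ.pos Z f).pos a ∧ k.mom a = (chainRule ζ.pos Z f).mom a)
    (hl : ∀ a ∈ V₀, l.pos a = (chainRule ζ.pos Z g).pos a ∧ l.mom a = (chainRule ζ.pos Z g).mom a)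
    (hi : IntegrableOn (cglDensity Z f g) V)
    (hw : IntegrableOn (div (discardedFlux Z f g)) V) :
    IntegrableOn (canonicalDensity k l) V₀ ∧
      canonicalBracket V₀ k l = cglBracket V Z f g - ∫ x in V, div (discardedFlux Z f g) x := by
  have key : ∀ a ∈ V₀, canonicalDensity k l a
      = jac ζ.pos a * (cglDensity Z f g (ζ.pos a) - div (discardedFlux Z f g) (ζ.pos a)) := by
    intro a ha
    have hx := hX.2.1.mapsTo ha
    rw [← inner_chainVector_sub (hZ.isDifferentiableAt hV hx) (hf.isDifferentiableAt hV hx)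
      (hg.isDifferentiableAt hV hx), canonicalDensity, (hk a ha).1, (hk a ha).2, (hl a ha).1,
      (hl a ha).2]
    simp only [chainRule, inner_smul_left, inner_smul_right, conj_trivial]
    ring
  have hdiff : IntegrableOn (fun x => cglDensity Z f g x - div (discardedFlux Z f g) x) V :=
    hi.sub hw
  constructor
  · exact ((integrableOn_iff_integrableOn_label hV₀ hX _).1 hdiff).congr_fun
      (fun a ha => (key a ha).symm) hV₀.measurableSet
  · rw [canonicalBracket, setIntegral_congr_fun hV₀.measurableSet key,
      ← integral_eq_integral_label hV₀ hX
        (fun x => cglDensity Z f g x - div (discardedFlux Z f g) x), integral_sub hi hw, cglBracket]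

end CanonicalBracket

/-! ### Differentiation of integrals of compactly supported variations -/

section Parametric

variable {V K : Set Space}

/-- Differentiation under the integral sign. The parameter derivative vanishes off `K` and is
bounded on a compact neighbourhood of `t` times `K`, so a multiple of the indicator of `K` dominates
it. The integrand itself may extend over all of `V`, as the energy density does. -/
theorem hasDerivAt_integral_of_smooth (hV : IsOpen V) (hK : IsCompact K) (hKV : K ⊆ V)
    {J : Set ℝ} (hJ : IsOpen J) {t : ℝ} (ht : t ∈ J) {G : ℝ → Space → ℝ}
    (hG : ContDiffOn ℝ 1 (fun z : ℝ × Space => G z.1 z.2) (J ×ˢ V))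
    (h0 : ∀ s ∈ J, ∀ x ∈ V, x ∉ K → G s x = G t x) (hi : IntegrableOn (G t) V) :
    HasDerivAt (fun s => ∫ x in V, G s x) (∫ x in V, deriv (fun s => G s x) t) t := by
  have hopen := hJ.prod hV
  have hslice : ∀ s ∈ J, ∀ x ∈ V, HasDerivAt (fun s => G s x)
      (fderiv ℝ (fun z : ℝ × Space => G z.1 z.2) (s, x) (1, 0)) s := by
    intro s hs x hx
    have h : HasFDerivAt (fun z : ℝ × Space => G z.1 z.2)
        (fderiv ℝ (fun z : ℝ × Space => G z.1 z.2) (s, x)) (s, x) :=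
      ((hG.contDiffAt (hopen.mem_nhds ⟨hs, hx⟩)).differentiableAt one_ne_zero).hasFDerivAt
    exact h.comp_hasDerivAt s ((hasDerivAt_id s).prodMk (hasDerivAt_const s x))
  have hcont : ContinuousOn
      (fun z : ℝ × Space => fderiv ℝ (fun z : ℝ × Space => G z.1 z.2) z (1, 0)) (J ×ˢ V) :=
    (hG.continuousOn_fderiv_of_isOpen hopen le_rfl).clm_apply continuousOn_const
  obtain ⟨r, hr, hrJ⟩ := Metric.isOpen_iff.1 hJ t ht
  have hball : Metric.closedBall t (r / 2) ⊆ J :=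
    (Metric.closedBall_subset_ball (by linarith)).trans hrJ
  have hcomp : IsCompact (Metric.closedBall t (r / 2) ×ˢ K) :=
    (isCompact_closedBall t (r / 2)).prod hK
  obtain ⟨C, hC⟩ := hcomp.exists_bound_of_continuousOn (hcont.mono (prod_mono hball hKV))
  have hmeas : ∀ s ∈ J, AEStronglyMeasurable (G s) (volume.restrict V) := by
    intro s hs
    have : ContinuousOn (G s) V :=
      hG.continuousOn.comp (by fun_prop : ContinuousOn (fun x : Space => (s, x)) V)
        fun x hx => ⟨hs, hx⟩
    exact this.aestronglyMeasurable hV.measurableSet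
  have hoff : ∀ s ∈ J, ∀ x ∈ V, x ∉ K → deriv (fun s => G s x) s = 0 := by
    intro s hs x hx hxK
    have : (fun s => G s x) =ᶠ[𝓝 s] fun _ => G t x := by
      filter_upwards [hJ.mem_nhds hs] with s' hs'
      exact h0 s' hs' x hx hxK
    rw [this.deriv_eq, deriv_const]
  refine (hasDerivAt_integral_of_dominated_loc_of_deriv_le (μ := volume.restrict V)
    (F' := fun s x => deriv (fun s => G s x) s) (bound := K.indicator fun _ => C)
    (s := Metric.ball t (r / 2)) (Metric.ball_mem_nhds t (by linarith)) ?_ hi ?_ ?_ ?_ ?_).2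
  · filter_upwards [hJ.mem_nhds ht] with s hs using hmeas s hs
  · have : ContinuousOn (fun x => deriv (fun s => G s x) t) V :=
      (hcont.comp (by fun_prop : ContinuousOn (fun x : Space => (t, x)) V)
        fun x hx => ⟨ht, hx⟩).congr fun x hx => (hslice t ht x hx).deriv
    exact this.aestronglyMeasurable hV.measurableSet
  · filter_upwards [ae_restrict_mem hV.measurableSet] with x hx s hs
    have hs' : s ∈ Metric.closedBall t (r / 2) := Metric.ball_subset_closedBall hs
    by_cases hxK : x ∈ K
    · rw [indicator_of_mem hxK, (hslice s (hball hs') x hx).deriv]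
      exact hC (s, x) ⟨hs', hxK⟩
    · rw [indicator_of_notMem hxK, hoff s (hball hs') x hx hxK, norm_zero]
  · refine Integrable.mono_measure ?_ Measure.restrict_le_self
    rw [integrable_indicator_iff hK.measurableSet]
    exact integrableOn_const hK.measure_lt_top.ne
  · filter_upwards [ae_restrict_mem hV.measurableSet] with x hx s hs
    exact (hslice s (hball (Metric.ball_subset_closedBall hs)) x hx).differentiableAt.hasDerivAt

end Parametric

/-! ### The variational derivative of the energy -/

section Energy

variable {V : Set Space} {P : PlasmaData}

/-- The variational derivative of the total energy. -/
noncomputable def PlasmaData.energyDeriv (P : PlasmaData) (Z : EulerFields) : EulerFields where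
  rho x := -(‖Z.vel x‖ ^ 2 / 2) + P.pot x + P.en (Z.rho x) (Z.ent x) ‖Z.mag x‖
    + Z.rho x * deriv (fun r => P.en r (Z.ent x) ‖Z.mag x‖) (Z.rho x)
    - Z.ent x * deriv (fun s => P.en (Z.rho x) s ‖Z.mag x‖) (Z.ent x)
  sigma x := deriv (fun s => P.en (Z.rho x) s ‖Z.mag x‖) (Z.ent x)
  mom x := Z.vel x
  mag x := (Z.rho x * deriv (fun b => P.en (Z.rho x) (Z.ent x) b) ‖Z.mag x‖ * ‖Z.mag x‖⁻¹
    + P.mu⁻¹) • Z.mag x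

/-- The density is positive and the magnetic field does not vanish on `V`. -/
def EulerFields.IsRegularOn (V : Set Space) (Z : EulerFields) : Prop :=
  ∀ x ∈ V, 0 < Z.rho x ∧ Z.mag x ≠ 0

theorem isOpen_thermodynamicDomain : IsOpen {z : ℝ × ℝ × ℝ | 0 < z.1 ∧ 0 < z.2.2} :=
  (isOpen_lt continuous_const continuous_fst).inter
    (isOpen_lt continuous_const (continuous_snd.comp continuous_snd))

/-- The internal energy as a function of the triple `(ρ, S, B)`. -/
def PlasmaData.internal (P : PlasmaData) (z : ℝ × ℝ × ℝ) : ℝ := P.en z.1 z.2.1 z.2.2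

theorem PlasmaData.IsAdmissible.hasFDerivAt_internal (hP : P.IsAdmissible V) {r s b : ℝ}
    (hr : 0 < r) (hb : 0 < b) :
    HasFDerivAt P.internal (fderiv ℝ P.internal (r, s, b)) (r, s, b) :=
  ((hP.2.2.contDiffAt (isOpen_thermodynamicDomain.mem_nhds
    (show (r, s, b) ∈ {z : ℝ × ℝ × ℝ | 0 < z.1 ∧ 0 < z.2.2} from ⟨hr, hb⟩))).differentiableAt
      (by simp)).hasFDerivAt

theorem PlasmaData.IsAdmissible.hasDerivAt_en (hP : P.IsAdmissible V) {r s b : ℝ}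
    (hr : 0 < r) (hb : 0 < b) :
    deriv (fun r => P.en r s b) r = fderiv ℝ P.internal (r, s, b) (1, 0, 0) ∧
    deriv (fun s => P.en r s b) s = fderiv ℝ P.internal (r, s, b) (0, 1, 0) ∧
    deriv (fun b => P.en r s b) b = fderiv ℝ P.internal (r, s, b) (0, 0, 1) := by
  have h := hP.hasFDerivAt_internal (s := s) hr hb
  refine ⟨HasDerivAt.deriv ?_, HasDerivAt.deriv ?_, HasDerivAt.deriv ?_⟩
  · exact HasFDerivAt.comp_hasDerivAt (f := fun r => (r, s, b)) r h
      ((hasDerivAt_id r).prodMk ((hasDerivAt_const r s).prodMk (hasDerivAt_const r b)))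
  · exact HasFDerivAt.comp_hasDerivAt (f := fun s => (r, s, b)) s h
      ((hasDerivAt_const s r).prodMk ((hasDerivAt_id s).prodMk (hasDerivAt_const s b)))
  · exact HasFDerivAt.comp_hasDerivAt (f := fun b => (r, s, b)) b h
      ((hasDerivAt_const b r).prodMk ((hasDerivAt_const b s).prodMk (hasDerivAt_id b)))

theorem fderiv_internal_apply (z v : ℝ × ℝ × ℝ) :
    fderiv ℝ P.internal z v = v.1 * fderiv ℝ P.internal z (1, 0, 0)
      + v.2.1 * fderiv ℝ P.internal z (0, 1, 0) + v.2.2 * fderiv ℝ P.internal z (0, 0, 1) := by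
  obtain ⟨a, b, c⟩ := v
  have : ((a, b, c) : ℝ × ℝ × ℝ) = a • ((1, 0, 0) : ℝ × ℝ × ℝ) + b • ((0, 1, 0) : ℝ × ℝ × ℝ)
      + c • ((0, 0, 1) : ℝ × ℝ × ℝ) := by simp
  rw [this, map_add, map_add, map_smul, map_smul, map_smul]
  simp

theorem hasDerivAt_norm_of_ne {b : ℝ → Space} {b' : Space} {t : ℝ} (hb : HasDerivAt b b' t)
    (h0 : b t ≠ 0) : HasDerivAt (fun s => ‖b s‖) (inner ℝ (b t) b' / ‖b t‖) t := by
  have h1 := hb.norm_sq.sqrt (by positivity)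
  simp only [Real.sqrt_sq (norm_nonneg _)] at h1
  convert! h1 using 1
  field_simp

/-- The chain rule for the energy density along a curve of states and positions. -/
theorem hasDerivAt_energyDensity (hP : P.IsAdmissible V) {Γ : ℝ → EulerFields} {c : ℝ → Space}
    {t r' s' φ' : ℝ} {m' b' : Space} (hr : HasDerivAt (fun s => (Γ s).rho (c s)) r' t)
    (hs : HasDerivAt (fun s => (Γ s).sigma (c s)) s' t)
    (hm : HasDerivAt (fun s => (Γ s).mom (c s)) m' t)
    (hb : HasDerivAt (fun s => (Γ s).mag (c s)) b' t)
    (hφ : HasDerivAt (fun s => P.pot (c s)) φ' t)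
    (hr0 : 0 < (Γ t).rho (c t)) (hb0 : (Γ t).mag (c t) ≠ 0) :
    HasDerivAt (fun s => P.energyDensity (Γ s) (c s))
      ((P.energyDeriv (Γ t)).rho (c t) * r' + (P.energyDeriv (Γ t)).sigma (c t) * s'
        + inner ℝ ((P.energyDeriv (Γ t)).mom (c t)) m'
        + inner ℝ ((P.energyDeriv (Γ t)).mag (c t)) b' + (Γ t).rho (c t) * φ') t := by
  have hn0 : 0 < ‖(Γ t).mag (c t)‖ := norm_pos_iff.2 hb0
  have hmu := hP.1
  obtain ⟨d1, d2, d3⟩ := hP.hasDerivAt_en (s := (Γ t).ent (c t)) hr0 hn0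
  have hS : HasDerivAt (fun s => (Γ s).ent (c s)) _ t := hs.div hr hr0.ne'
  have hB := hasDerivAt_norm_of_ne hb hb0
  have hen : HasDerivAt
      (fun s => P.en ((Γ s).rho (c s)) ((Γ s).ent (c s)) ‖(Γ s).mag (c s)‖) _ t :=
    HasFDerivAt.comp_hasDerivAt
      (f := fun s => ((Γ s).rho (c s), (Γ s).ent (c s), ‖(Γ s).mag (c s)‖)) t
      (hP.hasFDerivAt_internal hr0 hn0) (hr.prodMk (hS.prodMk hB))
  have hu : HasDerivAt (fun s => (Γ s).vel (c s)) _ t := (hr.inv hr0.ne').smul hm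
  have h := (((hr.mul hu.norm_sq).div_const 2).add (hr.mul hφ)).add (hr.mul hen) |>.add
    (hb.norm_sq.div_const (2 * P.mu))
  convert! h using 1
  rw [fderiv_internal_apply, ← d1, ← d2, ← d3]
  simp only [PlasmaData.energyDeriv, EulerFields.vel, inner_smul_left, inner_smul_right,
    inner_add_right, norm_smul, mul_pow, ← real_inner_self_eq_norm_sq, conj_trivial,
    EulerFields.ent, norm_inv, Real.norm_eq_abs, abs_of_pos hr0, Pi.inv_apply]
  field_simp
  ring

/-- The parameter space `E` is left general so that one statement covers joint smoothness in `(ε,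
x)` for a variation and smoothness in `x` for a single state. -/
theorem PlasmaData.IsAdmissible.energyDensity_contDiffOn {E : Type*} [NormedAddCommGroup E]
    [NormedSpace ℝ E] (hP : P.IsAdmissible V) {Γ : E → EulerFields} {c : E → Space} {T : Set E}
    (hc : ContDiffOn ℝ ∞ c T) (h1 : ContDiffOn ℝ ∞ (fun z => (Γ z).rho (c z)) T)
    (h2 : ContDiffOn ℝ ∞ (fun z => (Γ z).sigma (c z)) T)
    (h3 : ContDiffOn ℝ ∞ (fun z => (Γ z).mom (c z)) T)
    (h4 : ContDiffOn ℝ ∞ (fun z => (Γ z).mag (c z)) T)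
    (h0 : ∀ z ∈ T, c z ∈ V ∧ 0 < (Γ z).rho (c z) ∧ (Γ z).mag (c z) ≠ 0) :
    ContDiffOn ℝ ∞ (fun z => P.energyDensity (Γ z) (c z)) T := by
  have hr0 : ∀ z ∈ T, (Γ z).rho (c z) ≠ 0 := fun z hz => (h0 z hz).2.1.ne'
  have hN := h4.norm ℝ fun z hz => (h0 z hz).2.2
  have hE : ContDiffOn ℝ ∞ (fun z =>
      P.en ((Γ z).rho (c z)) ((Γ z).ent (c z)) ‖(Γ z).mag (c z)‖) T :=
    hP.2.2.comp (h1.prodMk ((h2.div h1 hr0).prodMk hN)) fun z hz =>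
      ⟨(h0 z hz).2.1, norm_pos_iff.2 (h0 z hz).2.2⟩
  have hΦ : ContDiffOn ℝ ∞ (fun z => P.pot (c z)) T :=
    hP.2.1.comp hc fun z hz => (h0 z hz).1
  exact ((((h1.mul (((h1.inv hr0).smul h3).norm_sq ℝ)).div_const 2).add (h1.mul hΦ)).add
    (h1.mul hE)).add ((h4.norm_sq ℝ).div_const _)

theorem PlasmaData.IsAdmissible.energyDeriv_isContDiffOn (hP : P.IsAdmissible V)
    {Z : EulerFields} (hZ : Z.IsContDiffOn ∞ V) (hreg : Z.IsRegularOn V) :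
    (P.energyDeriv Z).IsContDiffOn ∞ V := by
  obtain ⟨h1, h2, h3, h4⟩ := hZ
  have hr0 : ∀ x ∈ V, Z.rho x ≠ 0 := fun x hx => (hreg x hx).1.ne'
  have hn0 : ∀ x ∈ V, 0 < ‖Z.mag x‖ := fun x hx => norm_pos_iff.2 (hreg x hx).2
  have hN : ContDiffOn ℝ ∞ (fun x => ‖Z.mag x‖) V := h4.norm ℝ fun x hx => (hreg x hx).2
  have hS : ContDiffOn ℝ ∞ Z.ent V := h2.div h1 hr0
  have hu : ContDiffOn ℝ ∞ Z.vel V := (h1.inv hr0).smul h3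
  have hw : ContDiffOn ℝ ∞ (fun x => (Z.rho x, Z.ent x, ‖Z.mag x‖)) V :=
    h1.prodMk (hS.prodMk hN)
  have hmap : MapsTo (fun x => (Z.rho x, Z.ent x, ‖Z.mag x‖)) V
      {z : ℝ × ℝ × ℝ | 0 < z.1 ∧ 0 < z.2.2} := fun x hx => ⟨(hreg x hx).1, hn0 x hx⟩
  have hE : ContDiffOn ℝ ∞ (fun x => P.en (Z.rho x) (Z.ent x) ‖Z.mag x‖) V :=
    hP.2.2.comp hw hmap
  have hD (v : ℝ × ℝ × ℝ) : ContDiffOn ℝ ∞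
      (fun x => fderiv ℝ P.internal (Z.rho x, Z.ent x, ‖Z.mag x‖) v) V :=
    ((hP.2.2.fderiv_of_isOpen isOpen_thermodynamicDomain (m := ∞) (by simp)).comp hw
      hmap).clm_apply contDiffOn_const
  have e1 : ContDiffOn ℝ ∞
      (fun x => deriv (fun r => P.en r (Z.ent x) ‖Z.mag x‖) (Z.rho x)) V :=
    (hD (1, 0, 0)).congr fun x hx => (hP.hasDerivAt_en (hreg x hx).1 (hn0 x hx)).1
  have e2 : ContDiffOn ℝ ∞
      (fun x => deriv (fun s => P.en (Z.rho x) s ‖Z.mag x‖) (Z.ent x)) V :=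
    (hD (0, 1, 0)).congr fun x hx => (hP.hasDerivAt_en (hreg x hx).1 (hn0 x hx)).2.1
  have e3 : ContDiffOn ℝ ∞
      (fun x => deriv (fun b => P.en (Z.rho x) (Z.ent x) b) ‖Z.mag x‖) V :=
    (hD (0, 0, 1)).congr fun x hx => (hP.hasDerivAt_en (hreg x hx).1 (hn0 x hx)).2.2
  exact ⟨((((((hu.norm_sq ℝ).div_const 2).neg).add hP.2.1).add hE).add (h1.mul e1)).sub
    (hS.mul e2), e2, hu, (((h1.mul e3).mul (hN.inv fun x hx => (hn0 x hx).ne')).add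
      contDiffOn_const).smul h4⟩

/-- The equation of state is only controlled for `ρ > 0` and `B ≠ 0`, so these conditions must first
be shown to persist for small `ε`; then the integral is differentiated under the integral sign. -/
theorem PlasmaData.IsAdmissible.hasEulerVarDeriv_energy (hV : IsOpen V) (hP : P.IsAdmissible V)
    {Z : EulerFields} (hreg : Z.IsRegularOn V) (hi : IntegrableOn (P.energyDensity Z) V) :
    HasEulerVarDeriv V (P.energy V) Z (P.energyDeriv Z) := by
  rintro γ ⟨rfl, δ, hδ, K, hK, hKV, h1, h2, h3, h4⟩
  have h0 : (0 : ℝ) ∈ Ioo (-δ) δ := ⟨by linarith, hδ⟩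
  have hopen := isOpen_Ioo.prod hV (s := Ioo (-δ) δ)
  -- The tube lemma over the compact `K` gives one interval of parameters on which regularity holds
  -- throughout `K`; off `K` the state does not vary.
  obtain ⟨J, hJ, h0J, hJδ, hJreg⟩ : ∃ J : Set ℝ, IsOpen J ∧ 0 ∈ J ∧ J ⊆ Ioo (-δ) δ ∧
      ∀ ε ∈ J, (γ ε).IsRegularOn V := by
    have o1 : IsOpen ((Ioo (-δ) δ ×ˢ V) ∩ (fun z : ℝ × Space => (γ z.1).rho z.2) ⁻¹' Ioi 0) :=
      h1.1.continuousOn.isOpen_inter_preimage hopen isOpen_Ioi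
    have o2 : IsOpen ((Ioo (-δ) δ ×ˢ V) ∩ (fun z : ℝ × Space => (γ z.1).mag z.2) ⁻¹' {0}ᶜ) :=
      h4.1.continuousOn.isOpen_inter_preimage hopen isOpen_compl_singleton
    obtain ⟨u, v, hu, -, h0u, hKv, huv⟩ := generalized_tube_lemma (isCompact_singleton (x := (0 : ℝ)))
      hK (o1.inter o2) (by
        rintro ⟨s, x⟩ ⟨hs, hx⟩
        obtain rfl : s = 0 := hs
        exact ⟨⟨⟨h0, hKV hx⟩, (hreg x (hKV hx)).1⟩, ⟨h0, hKV hx⟩, (hreg x (hKV hx)).2⟩)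
    refine ⟨u ∩ Ioo (-δ) δ, hu.inter isOpen_Ioo, ⟨h0u rfl, h0⟩, inter_subset_right,
      fun ε hε x hx => ?_⟩
    by_cases hxK : x ∈ K
    · have := huv (mk_mem_prod hε.1 (hKv hxK))
      exact ⟨this.1.2, this.2.2⟩
    · have e1 := h1.2 ε hε.2 x hxK
      have e4 := h4.2 ε hε.2 x hxK
      simp only at e1 e4
      rw [e1, e4]
      exact hreg x hx
  have hsub : J ×ˢ V ⊆ Ioo (-δ) δ ×ˢ V := prod_mono hJδ Subset.rfl
  have g1 := h1.1.mono hsub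
  have g2 := h2.1.mono hsub
  have g3 := h3.1.mono hsub
  have g4 := h4.1.mono hsub
  have hsmooth : ContDiffOn ℝ ∞ (fun z : ℝ × Space => P.energyDensity (γ z.1) z.2) (J ×ˢ V) :=
    hP.energyDensity_contDiffOn contDiffOn_snd g1 g2 g3 g4 fun z hz =>
      ⟨hz.2, hJreg z.1 hz.1 z.2 hz.2⟩
  have hder := hasDerivAt_integral_of_smooth hV hK hKV hJ h0J
    (G := fun ε x => P.energyDensity (γ ε) x) (hsmooth.of_le (by simp))
    (fun ε hε x _ hxK => by
      have e1 := h1.2 ε (hJδ hε) x hxK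
      have e2 := h2.2 ε (hJδ hε) x hxK
      have e3 := h3.2 ε (hJδ hε) x hxK
      have e4 := h4.2 ε (hJδ hε) x hxK
      simp only at e1 e2 e3 e4
      simp only [PlasmaData.energyDensity, EulerFields.vel, EulerFields.ent, e1, e2, e3, e4]) hi
  convert! hder using 1
  refine setIntegral_congr_fun hV.measurableSet fun x hx => ?_
  have q1 := (hasDerivAt_family_slice (c := fun ε => (γ ε).rho) hV h1.1 h0 hx).differentiableAt
  have q2 := (hasDerivAt_family_slice (c := fun ε => (γ ε).sigma) hV h2.1 h0 hx).differentiableAt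
  have q3 := (hasDerivAt_family_slice (c := fun ε => (γ ε).mom) hV h3.1 h0 hx).differentiableAt
  have q4 := (hasDerivAt_family_slice (c := fun ε => (γ ε).mag) hV h4.1 h0 hx).differentiableAt
  -- The position is held fixed, so the external potential contributes no rate of its own.
  have := hasDerivAt_energyDensity (c := fun _ => x) hP q1.hasDerivAt q2.hasDerivAt q3.hasDerivAt
    q4.hasDerivAt (hasDerivAt_const (0 : ℝ) (P.pot x)) (hreg x hx).1 (hreg x hx).2
  rw [this.deriv, EulerFields.pair, mul_zero, add_zero]
  rfl

end Energy

/-! ### Hamilton's equations in weak and strong form -/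

section Weak

variable {V : Set Space} {I : Set ℝ} {Z : ℝ → EulerFields}

theorem hamOperatorGen_isContinuousOn (hV : IsOpen V) {Z g : EulerFields}
    (hZ : Z.IsContDiffOn 1 V) (hg : g.IsContDiffOn 1 V) :
    (hamOperatorGen Z g).IsContinuousOn V := by
  obtain ⟨z1, z2, z3, z4⟩ := hZ
  obtain ⟨g1, g2, g3, g4⟩ := hg
  have z3' := contDiffOn_coord z3
  have z4' := contDiffOn_coord z4
  have g3' := contDiffOn_coord g3
  have g4' := contDiffOn_coord g4
  refine ⟨?_, ?_, (PiLp.continuous_toLp 2 _).comp_continuousOn (continuousOn_pi.2 fun i => ?_),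
    (PiLp.continuous_toLp 2 _).comp_continuousOn (continuousOn_pi.2 fun i => ?_)⟩
  · exact (continuousOn_finsetSum _ fun j _ => pd_continuousOn hV (z1.mul (g3' j))).neg
  · exact (continuousOn_finsetSum _ fun j _ => pd_continuousOn hV (z2.mul (g3' j))).neg
  · exact ((((((z1.continuousOn.mul (pd_continuousOn hV g1)).add
      (z2.continuousOn.mul (pd_continuousOn hV g2))).add
      (continuousOn_finsetSum _ fun j _ => ((z3' j).continuousOn.mul
        (pd_continuousOn hV (g3' j))).add (pd_continuousOn hV ((z3' i).mul (g3' j))))).add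
      (continuousOn_finsetSum _ fun j _ => (z4' j).continuousOn.mul
        (pd_continuousOn hV (g4' j)))).sub
      (continuousOn_finsetSum _ fun k _ => pd_continuousOn hV ((z4' k).mul (g4' i))))).neg
  · exact ((continuousOn_finsetSum _ fun j _ => pd_continuousOn hV ((z4' i).mul (g3' j))).sub
      (continuousOn_finsetSum _ fun k _ => (z4' k).continuousOn.mul
        (pd_continuousOn hV (g3' i)))).neg

/-- A differential operator is local: agreement on an open set suffices, so the values of a
variational derivative off `V` are irrelevant. -/
theorem hamOperatorGen_congr (hV : IsOpen V) {Z f g : EulerFields} (h : f.AgreeOn V g) :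
    (hamOperatorGen Z f).AgreeOn V (hamOperatorGen Z g) := by
  obtain ⟨h1, h2, h3, h4⟩ := h
  have p1 {i : Fin 3} {x : Space} (hx : x ∈ V) : pd i f.rho x = pd i g.rho x :=
    pd_congr_of_isOpen hV h1 hx
  have p2 {i : Fin 3} {x : Space} (hx : x ∈ V) : pd i f.sigma x = pd i g.sigma x :=
    pd_congr_of_isOpen hV h2 hx
  have p3 {i j : Fin 3} {x : Space} (hx : x ∈ V) :
      pd i (fun y => f.mom y j) x = pd i (fun y => g.mom y j) x :=
    pd_congr_of_isOpen hV (fun y hy => by simp only [h3 hy]) hx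
  have p4 {i j : Fin 3} {x : Space} (hx : x ∈ V) :
      pd i (fun y => f.mag y j) x = pd i (fun y => g.mag y j) x :=
    pd_congr_of_isOpen hV (fun y hy => by simp only [h4 hy]) hx
  have p5 (w : Space → ℝ) {i j : Fin 3} {x : Space} (hx : x ∈ V) :
      pd i (fun y => w y * f.mom y j) x = pd i (fun y => w y * g.mom y j) x :=
    pd_congr_of_isOpen hV (fun y hy => by simp only [h3 hy]) hx
  have p6 (w : Space → ℝ) {i j : Fin 3} {x : Space} (hx : x ∈ V) :
      pd i (fun y => w y * f.mag y j) x = pd i (fun y => w y * g.mag y j) x :=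
    pd_congr_of_isOpen hV (fun y hy => by simp only [h4 hy]) hx
  refine ⟨fun x hx => ?_, fun x hx => ?_, fun x hx => ?_, fun x hx => ?_⟩
  · simp only [hamOperatorGen, p5 Z.rho hx]
  · simp only [hamOperatorGen, p5 Z.sigma hx]
  · ext i
    simp only [hamOperatorGen, p1 hx, p2 hx, p3 hx, p4 hx, p5 (fun y => Z.mom y i) hx,
      fun k => p6 (fun y => Z.mag y k) (i := k) (j := i) hx]
  · ext i
    simp only [hamOperatorGen, p3 hx, p5 (fun y => Z.mag y i) hx]

/-- The time derivative of an evolution at fixed position. -/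
noncomputable def timeDeriv (Z : ℝ → EulerFields) (t : ℝ) : EulerFields where
  rho x := deriv (fun s => (Z s).rho x) t
  sigma x := deriv (fun s => (Z s).sigma x) t
  mom x := deriv (fun s => (Z s).mom x) t
  mag x := deriv (fun s => (Z s).mag x) t

/-- The fields are jointly smooth in time and position. -/
def IsSmoothEvolution (I : Set ℝ) (V : Set Space) (Z : ℝ → EulerFields) : Prop :=
  ContDiffOn ℝ ∞ (fun z : ℝ × Space => (Z z.1).rho z.2) (I ×ˢ V) ∧
  ContDiffOn ℝ ∞ (fun z : ℝ × Space => (Z z.1).sigma z.2) (I ×ˢ V) ∧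
  ContDiffOn ℝ ∞ (fun z : ℝ × Space => (Z z.1).mom z.2) (I ×ˢ V) ∧
  ContDiffOn ℝ ∞ (fun z : ℝ × Space => (Z z.1).mag z.2) (I ×ˢ V)

section Slices

variable {W : Type*} [NormedAddCommGroup W] [NormedSpace ℝ W] {c : ℝ → Space → W}

theorem contDiffOn_slice (hc : ContDiffOn ℝ ∞ (fun z : ℝ × Space => c z.1 z.2) (I ×ˢ V)) {t : ℝ}
    (ht : t ∈ I) : ContDiffOn ℝ ∞ (c t) V :=
  hc.comp (contDiffOn_const.prodMk contDiffOn_id) fun _ hx => ⟨ht, hx⟩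

theorem hasDerivAt_slice (hI : IsOpen I) (hV : IsOpen V)
    (hc : ContDiffOn ℝ ∞ (fun z : ℝ × Space => c z.1 z.2) (I ×ˢ V)) {t : ℝ}
    (ht : t ∈ I) {x : Space} (hx : x ∈ V) :
    HasDerivAt (fun s => c s x) (fderiv ℝ (fun z : ℝ × Space => c z.1 z.2) (t, x) (1, 0)) t := by
  have h : HasFDerivAt (fun z : ℝ × Space => c z.1 z.2)
      (fderiv ℝ (fun z : ℝ × Space => c z.1 z.2) (t, x)) (t, x) :=
    ((hc.contDiffAt ((hI.prod hV).mem_nhds ⟨ht, hx⟩)).differentiableAt (by simp)).hasFDerivAt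
  exact h.comp_hasDerivAt t ((hasDerivAt_id t).prodMk (hasDerivAt_const t x))

theorem continuousOn_deriv_slice (hI : IsOpen I) (hV : IsOpen V)
    (hc : ContDiffOn ℝ ∞ (fun z : ℝ × Space => c z.1 z.2) (I ×ˢ V)) {t : ℝ} (ht : t ∈ I) :
    ContinuousOn (fun x => deriv (fun s => c s x) t) V := by
  have h := (hc.continuousOn_fderiv_of_isOpen (hI.prod hV) (by simp)).clm_apply
    (continuousOn_const (c := ((1 : ℝ), (0 : Space))))
  exact (h.comp (by fun_prop : ContinuousOn (fun x : Space => (t, x)) V)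
    fun x hx => ⟨ht, hx⟩).congr fun x hx => (hasDerivAt_slice hI hV hc ht hx).deriv

end Slices

theorem IsSmoothEvolution.isContDiffOn (h : IsSmoothEvolution I V Z) {t : ℝ} (ht : t ∈ I) :
    (Z t).IsContDiffOn ∞ V :=
  ⟨contDiffOn_slice (c := fun t => (Z t).rho) h.1 ht,
    contDiffOn_slice (c := fun t => (Z t).sigma) h.2.1 ht,
    contDiffOn_slice (c := fun t => (Z t).mom) h.2.2.1 ht,
    contDiffOn_slice (c := fun t => (Z t).mag) h.2.2.2 ht⟩

theorem IsSmoothEvolution.timeDeriv_isContinuousOn (h : IsSmoothEvolution I V Z) (hI : IsOpen I)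
    (hV : IsOpen V) {t : ℝ} (ht : t ∈ I) : (timeDeriv Z t).IsContinuousOn V :=
  ⟨continuousOn_deriv_slice (c := fun t => (Z t).rho) hI hV h.1 ht,
    continuousOn_deriv_slice (c := fun t => (Z t).sigma) hI hV h.2.1 ht,
    continuousOn_deriv_slice (c := fun t => (Z t).mom) hI hV h.2.2.1 ht,
    continuousOn_deriv_slice (c := fun t => (Z t).mag) hI hV h.2.2.2 ht⟩

theorem IsSmoothEvolution.hasDerivAt (h : IsSmoothEvolution I V Z) (hI : IsOpen I)
    (hV : IsOpen V) {t : ℝ} (ht : t ∈ I) {x : Space} (hx : x ∈ V) :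
    HasDerivAt (fun s => (Z s).rho x) ((timeDeriv Z t).rho x) t ∧
    HasDerivAt (fun s => (Z s).sigma x) ((timeDeriv Z t).sigma x) t ∧
    HasDerivAt (fun s => (Z s).mom x) ((timeDeriv Z t).mom x) t ∧
    HasDerivAt (fun s => (Z s).mag x) ((timeDeriv Z t).mag x) t :=
  ⟨(hasDerivAt_slice (c := fun t => (Z t).rho) hI hV h.1 ht hx).differentiableAt.hasDerivAt,
    (hasDerivAt_slice (c := fun t => (Z t).sigma) hI hV h.2.1 ht hx).differentiableAt.hasDerivAt,
    (hasDerivAt_slice (c := fun t => (Z t).mom) hI hV h.2.2.1 ht hx).differentiableAt.hasDerivAt,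
    (hasDerivAt_slice (c := fun t => (Z t).mag) hI hV h.2.2.2 ht hx).differentiableAt.hasDerivAt⟩

theorem IsSmoothEvolution.hasDerivAt_integral_pair (h : IsSmoothEvolution I V Z) (hI : IsOpen I)
    (hV : IsOpen V) {t : ℝ} (ht : t ∈ I) {φ : EulerFields} (hφ : IsTestField V φ) :
    HasDerivAt (fun s => ∫ x in V, φ.pair (Z s) x) (∫ x in V, φ.pair (timeDeriv Z t) x) t := by
  obtain ⟨hφc, K, hK, hKV, h0⟩ := hφ
  have hφV : φ.IsContDiffOn ∞ V :=
    ⟨hφc.1.mono (subset_univ _), hφc.2.1.mono (subset_univ _), hφc.2.2.1.mono (subset_univ _),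
      hφc.2.2.2.mono (subset_univ _)⟩
  have hzero : ∀ (Y : EulerFields) (x : Space), x ∉ K → φ.pair Y x = 0 := fun Y x hx => by
    obtain ⟨e1, e2, e3, e4⟩ := h0 x hx
    simp [EulerFields.pair, e1, e2, e3, e4]
  have hm : MapsTo (Prod.snd : ℝ × Space → Space) (I ×ˢ V) V := fun z hz => hz.2
  have hG : ContDiffOn ℝ ∞ (fun z : ℝ × Space => φ.pair (Z z.1) z.2) (I ×ˢ V) :=
    ((((hφV.1.comp contDiffOn_snd hm).mul h.1).add
      ((hφV.2.1.comp contDiffOn_snd hm).mul h.2.1)).add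
      ((hφV.2.2.1.comp contDiffOn_snd hm).inner ℝ h.2.2.1)).add
      ((hφV.2.2.2.comp contDiffOn_snd hm).inner ℝ h.2.2.2)
  have hder := hasDerivAt_integral_of_smooth hV hK hKV hI ht (G := fun s => φ.pair (Z s))
    (hG.of_le (by simp)) (fun s _ x _ hx => by rw [hzero _ x hx, hzero _ x hx])
    (integrableOn_of_support hV hK hKV (hφV.pair (h.isContDiffOn ht)).continuousOn
      fun x _ hx => hzero _ x hx)
  convert! hder using 1
  refine setIntegral_congr_fun hV.measurableSet fun x hx => ?_
  obtain ⟨d1, d2, d3, d4⟩ := h.hasDerivAt hI hV ht hx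
  refine (HasDerivAt.deriv ?_).symm
  have i1 : HasDerivAt (fun s => inner ℝ (φ.mom x) ((Z s).mom x))
      (inner ℝ (φ.mom x) ((timeDeriv Z t).mom x)) t := by
    simpa using (hasDerivAt_const t (φ.mom x)).inner ℝ d3
  have i2 : HasDerivAt (fun s => inner ℝ (φ.mag x) ((Z s).mag x))
      (inner ℝ (φ.mag x) ((timeDeriv Z t).mag x)) t := by
    simpa using (hasDerivAt_const t (φ.mag x)).inner ℝ d4
  exact (((d1.const_mul (φ.rho x)).add (d2.const_mul (φ.sigma x))).add i1).add i2

/-- The compact support of the test field kills the operator flux near the boundary. It also yields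
the integrability of the bracket density, which is obtained here as the sum of two compactly
supported continuous terms. -/
theorem cglBracket_testField (hV : IsOpen V) {Z φ g : EulerFields} (hZ : Z.IsContDiffOn 1 V)
    (hφ : IsTestField V φ) (hg : g.IsContDiffOn 1 V) :
    cglBracket V Z φ g = ∫ x in V, φ.pair (hamOperatorGen Z g) x := by
  obtain ⟨hφc, K, hK, hKV, h0⟩ := hφ
  have hφV : φ.IsContDiffOn 1 V := EulerFields.IsContDiffOn.of_le
    ⟨hφc.1.mono (subset_univ _), hφc.2.1.mono (subset_univ _), hφc.2.2.1.mono (subset_univ _),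
      hφc.2.2.2.mono (subset_univ _)⟩ (by simp : (1 : WithTop ℕ∞) ≤ ∞)
  have hvan : VanishesNearBoundary V (operatorFlux Z φ g) := ⟨K, hK, hKV, fun x _ hx => by
    obtain ⟨e1, e2, e3, e4⟩ := h0 x hx
    simp [operatorFlux, EulerFields.pair, e1, e2, e3, e4]⟩
  obtain ⟨i1, -⟩ := div_integral_of_vanishesNearBoundary hV (operatorFlux_contDiffOn hZ hφV hg) hvan
  have hc := hamOperatorGen_isContinuousOn hV hZ hg
  have hφ0 := hφV.isContinuousOn
  have i2 : IntegrableOn (φ.pair (hamOperatorGen Z g)) V := by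
    refine integrableOn_of_support hV hK hKV ((((hφ0.1.mul hc.1).add (hφ0.2.1.mul hc.2.1)).add
      (hφ0.2.2.1.inner hc.2.2.1)).add (hφ0.2.2.2.inner hc.2.2.2)) fun x _ hx => ?_
    obtain ⟨e1, e2, e3, e4⟩ := h0 x hx
    simp [EulerFields.pair, e1, e2, e3, e4]
  refine cglBracket_eq_integral_hamOperatorGen_of_vanishes hV hZ hφV hg ?_ hvan
  refine (i2.add i1).congr_fun (fun x hx => ?_) hV.measurableSet
  exact (cglDensity_eq_pair_hamOperatorGen (hZ.isDifferentiableAt hV hx)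
    (hφV.isDifferentiableAt hV hx) (hg.isDifferentiableAt hV hx)).symm

/-- Hamilton's equations in bracket form are the pointwise equations `Z_t = 𝒟' h`. -/
theorem bracketHamiltonEq_iff (h : IsSmoothEvolution I V Z) (hI : IsOpen I) (hV : IsOpen V)
    {k : ℝ → EulerFields} (hk : ∀ t ∈ I, (k t).IsContDiffOn 1 V) :
    BracketHamiltonEq I V Z k ↔
      ∀ t ∈ I, (timeDeriv Z t).AgreeOn V (hamOperatorGen (Z t) (k t)) := by
  have hZ : ∀ t ∈ I, (Z t).IsContDiffOn 1 V := fun t ht => (h.isContDiffOn ht).of_le (by simp)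
  constructor
  · intro H t ht
    refine agreeOn_of_integral_pair_eq hV (h.timeDeriv_isContinuousOn hI hV ht)
      (hamOperatorGen_isContinuousOn hV (hZ t ht) (hk t ht)) fun φ hφ => ?_
    have := (h.hasDerivAt_integral_pair hI hV ht hφ).unique (H t ht φ hφ)
    rw [cglBracket_testField hV (hZ t ht) hφ (hk t ht)] at this
    simpa only [EulerFields.pair_comm (f := φ)] using this
  · intro H t ht φ hφ
    obtain ⟨e1, e2, e3, e4⟩ := H t ht
    rw [cglBracket_testField hV (hZ t ht) hφ (hk t ht)]
    convert! h.hasDerivAt_integral_pair hI hV ht hφ using 1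
    refine setIntegral_congr_fun hV.measurableSet fun x hx => ?_
    simp only [EulerFields.pair, e1 hx, e2 hx, e3 hx, e4 hx]

/-- Under Gauss's law, Hamilton's equations in operator form are `Z_t = 𝒟' h`. -/
theorem operatorHamiltonEq_iff (h : IsSmoothEvolution I V Z) (hV : IsOpen V)
    {k : ℝ → EulerFields} (hk : ∀ t ∈ I, (k t).IsContDiffOn 1 V)
    (hB : ∀ t ∈ I, GaussLaw V (Z t)) :
    OperatorHamiltonEq I V Z k ↔
      ∀ t ∈ I, (timeDeriv Z t).AgreeOn V (hamOperatorGen (Z t) (k t)) := by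
  have key : ∀ t ∈ I, ∀ x ∈ V, (hamOperator (Z t) (k t)).mom x = (hamOperatorGen (Z t) (k t)).mom x ∧
      (hamOperator (Z t) (k t)).mag x = (hamOperatorGen (Z t) (k t)).mag x := fun t ht x hx =>
    hamOperator_eq_hamOperatorGen
      (((h.isContDiffOn ht).of_le (m := 1) (by simp)).isDifferentiableAt hV hx)
      ((hk t ht).isDifferentiableAt hV hx) (hB t ht x hx)
  constructor
  · intro H t ht
    refine ⟨fun x hx => (H t ht x hx).1, fun x hx => (H t ht x hx).2.1, fun x hx => ?_,
      fun x hx => ?_⟩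
    · rw [← (key t ht x hx).1]; exact (H t ht x hx).2.2.1
    · rw [← (key t ht x hx).2]; exact (H t ht x hx).2.2.2
  · intro H t ht x hx
    obtain ⟨e1, e2, e3, e4⟩ := H t ht
    refine ⟨e1 hx, e2 hx, ?_, ?_⟩
    · rw [(key t ht x hx).1]; exact e3 hx
    · rw [(key t ht x hx).2]; exact e4 hx

end Weak

/-! ### The CGL equations -/

section Equations

variable {V : Set Space} {P : PlasmaData}

theorem pd_pair {f Z : EulerFields} {x : Space} (hf : f.IsDifferentiableAt x)
    (hZ : Z.IsDifferentiableAt x) (i : Fin 3) :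
    pd i (f.pair Z) x = pd i f.rho x * Z.rho x + f.rho x * pd i Z.rho x
      + (pd i f.sigma x * Z.sigma x + f.sigma x * pd i Z.sigma x)
      + ∑ j, (pd i (fun y => f.mom y j) x * Z.mom x j + f.mom x j * pd i (fun y => Z.mom y j) x)
      + ∑ j, (pd i (fun y => f.mag y j) x * Z.mag x j
        + f.mag x j * pd i (fun y => Z.mag y j) x) := by
  obtain ⟨hfr, hfs, hfM, hfB⟩ := hf
  obtain ⟨hZr, hZs, hZM, hZB⟩ := hZ
  have e : f.pair Z = fun y => f.rho y * Z.rho y + f.sigma y * Z.sigma y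
      + (f.mom y 0 * Z.mom y 0 + f.mom y 1 * Z.mom y 1 + f.mom y 2 * Z.mom y 2)
      + (f.mag y 0 * Z.mag y 0 + f.mag y 1 * Z.mag y 1 + f.mag y 2 * Z.mag y 2) := by
    ext y
    simp [EulerFields.pair, inner_eq_three]
  have h1 : ∀ j, DifferentiableAt ℝ (fun y => f.mom y j * Z.mom y j) x :=
    fun j => (hfM j).fun_mul (hZM j)
  have h2 : ∀ j, DifferentiableAt ℝ (fun y => f.mag y j * Z.mag y j) x :=
    fun j => (hfB j).fun_mul (hZB j)
  have s1 := ((h1 0).fun_add (h1 1)).fun_add (h1 2)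
  have s2 := ((h2 0).fun_add (h2 1)).fun_add (h2 2)
  have s0 := (hfr.fun_mul hZr).fun_add (hfs.fun_mul hZs)
  rw [e, pd_add (s0.fun_add s1) s2, pd_add s0 s1, pd_add (hfr.fun_mul hZr) (hfs.fun_mul hZs),
    pd_add ((h1 0).fun_add (h1 1)) (h1 2), pd_add (h1 0) (h1 1),
    pd_add ((h2 0).fun_add (h2 1)) (h2 2), pd_add (h2 0) (h2 1), pd_mul hfr hZr, pd_mul hfs hZs]
  simp only [pd_mul (hfM _) (hZM _), pd_mul (hfB _) (hZB _), Fin.sum_univ_three]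

theorem hasDerivAt_line {W : Type*} [NormedAddCommGroup W] [NormedSpace ℝ W] {w : Space → W}
    {x : Space} (hw : DifferentiableAt ℝ w x) (i : Fin 3) :
    HasDerivAt (fun s : ℝ => w (x + s • EuclideanSpace.single i 1))
      (fderiv ℝ w x (EuclideanSpace.single i 1)) 0 := by
  have hc : HasDerivAt (fun s : ℝ => x + s • EuclideanSpace.single i (1 : ℝ))
      (EuclideanSpace.single i (1 : ℝ)) 0 := by
    simpa using ((hasDerivAt_id (0 : ℝ)).smul_const (EuclideanSpace.single i (1 : ℝ))).const_add x
  exact HasFDerivAt.comp_hasDerivAt_of_eq (0 : ℝ) hw.hasFDerivAt hc (by simp)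

/-- Besides its dependence through the fields, the energy density depends on position only through
the potential; the extra term `ρ∇Φ` becomes the external force. -/
theorem PlasmaData.IsAdmissible.pd_energyDensity (hV : IsOpen V) (hP : P.IsAdmissible V)
    {Z : EulerFields} (hZ : Z.IsContDiffOn ∞ V) (hreg : Z.IsRegularOn V) {x : Space} (hx : x ∈ V)
    (i : Fin 3) :
    pd i (P.energyDensity Z) x = (P.energyDeriv Z).rho x * pd i Z.rho x
      + (P.energyDeriv Z).sigma x * pd i Z.sigma x
      + ∑ j, (P.energyDeriv Z).mom x j * pd i (fun y => Z.mom y j) x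
      + ∑ j, (P.energyDeriv Z).mag x j * pd i (fun y => Z.mag y j) x
      + Z.rho x * pd i P.pot x := by
  have hd {W : Type} [NormedAddCommGroup W] [NormedSpace ℝ W] {w : Space → W}
      (hw : ContDiffOn ℝ ∞ w V) : DifferentiableAt ℝ w x :=
    (hw.contDiffAt (hV.mem_nhds hx)).differentiableAt (by simp)
  have hE : ContDiffOn ℝ ∞ (P.energyDensity Z) V :=
    hP.energyDensity_contDiffOn (Γ := fun _ => Z) (c := fun x => x) contDiffOn_id hZ.1 hZ.2.1
      hZ.2.2.1 hZ.2.2.2 fun x hx => ⟨hx, hreg x hx⟩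
  -- Here the state is frozen and the position moves along a coordinate line.
  have h := hasDerivAt_energyDensity (Γ := fun _ => Z) hP (hasDerivAt_line (hd hZ.1) i)
    (hasDerivAt_line (hd hZ.2.1) i) (hasDerivAt_line (hd hZ.2.2.1) i)
    (hasDerivAt_line (hd hZ.2.2.2) i) (hasDerivAt_line (hd hP.2.1) i)
    (by simpa using (hreg x hx).1) (by simpa using (hreg x hx).2)
  have h' := (hasDerivAt_line (hd hE) i).unique h
  simp only [zero_smul, add_zero, inner_eq_sum, ← pd_coord _ (hd hZ.2.2.1),
    ← pd_coord _ (hd hZ.2.2.2)] at h'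
  exact h'

/-- The momentum flux in terms of the variational derivative of the energy. -/
theorem momentumFlux_eq (hmu : 0 < P.mu) {Z : EulerFields} {x : Space} (hr : 0 < Z.rho x)
    (hB : Z.mag x ≠ 0) (i j : Fin 3) :
    P.momentumFlux Z i j x = Z.mom x i * (P.energyDeriv Z).mom x j
      + (if i = j then (P.energyDeriv Z).pair Z x - P.energyDensity Z x else 0)
      - Z.mag x j * (P.energyDeriv Z).mag x i := by
  have hn : 0 < ‖Z.mag x‖ := norm_pos_iff.2 hB
  have hr' := hr.ne'
  have hm' := hmu.ne'
  have hu : ‖Z.vel x‖ ^ 2 = (Z.rho x)⁻¹ * inner ℝ (Z.vel x) (Z.mom x) := by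
    rw [← real_inner_self_eq_norm_sq]
    conv_lhs => rw [EulerFields.vel, inner_smul_right, ← EulerFields.vel]
  have hb : inner ℝ (Z.mag x) (Z.mag x) = ‖Z.mag x‖ ^ 2 := real_inner_self_eq_norm_sq _
  -- The isotropic stress is the Legendre-type expression `Z·δH/δZ - 𝓗`: kinetic, potential and
  -- entropy terms cancel, leaving `ρ²e_ρ + ρBe_B + B²/(2μ₀)`.
  have hQ : (P.energyDeriv Z).pair Z x - P.energyDensity Z x
      = P.pPerp Z x + ‖Z.mag x‖ ^ 2 / 2 / P.mu := by
    simp only [EulerFields.pair, PlasmaData.energyDeriv, PlasmaData.energyDensity,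
      PlasmaData.pPerp, PlasmaData.pPar, inner_smul_left, conj_trivial, hu, hb, EulerFields.ent]
    field_simp
    ring
  have hvel : ∀ k, Z.vel x k = (Z.rho x)⁻¹ * Z.mom x k := fun k => rfl
  have htau : ∀ k, Z.tau x k = ‖Z.mag x‖⁻¹ * Z.mag x k := fun k => rfl
  -- Since `ρe_B/B = -(p_∥ - p_⊥)/B²`, the single term `-Bʲ H_{Bⁱ}` accounts for both the
  -- anisotropic stress and the magnetic tension.
  have hg : (P.energyDeriv Z).mag x i
      = (-(P.pPar Z x - P.pPerp Z x) * ‖Z.mag x‖⁻¹ * ‖Z.mag x‖⁻¹ + P.mu⁻¹) * Z.mag x i := by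
    simp only [PlasmaData.energyDeriv, PlasmaData.pPerp, PiLp.smul_apply, smul_eq_mul]
    field_simp
    ring
  have hgm : (P.energyDeriv Z).mom x j = (Z.rho x)⁻¹ * Z.mom x j := rfl
  rw [hQ, hg, hgm, PlasmaData.momentumFlux, hvel, hvel, htau, htau]
  split_ifs <;> field_simp <;> ring

/-- In `∇ᵢ(Z·δH/δZ - 𝓗)` the terms `δH/δZ·∇ᵢZ` cancel, leaving `Z·∇ᵢ(δH/δZ) - ρ∇ᵢΦ`. The first part
supplies the gradient terms of the momentum row and the second cancels the external force. -/
theorem div_momentumFlux (hV : IsOpen V) (hP : P.IsAdmissible V) {Z : EulerFields}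
    (hZ : Z.IsContDiffOn ∞ V) (hreg : Z.IsRegularOn V) {x : Space} (hx : x ∈ V) (i : Fin 3) :
    ∑ j, pd j (P.momentumFlux Z i j) x + Z.rho x * pd i P.pot x
      = -(hamOperatorGen Z (P.energyDeriv Z)).mom x i := by
  have hg := hP.energyDeriv_isContDiffOn hZ hreg
  have hZd := (hZ.of_le (m := 1) (by simp)).isDifferentiableAt hV hx
  have hgd := (hg.of_le (m := 1) (by simp)).isDifferentiableAt hV hx
  have hE : DifferentiableAt ℝ (P.energyDensity Z) x :=
    ((hP.energyDensity_contDiffOn (Γ := fun _ => Z) (c := fun x => x) contDiffOn_id hZ.1 hZ.2.1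
      hZ.2.2.1 hZ.2.2.2 fun x hx => ⟨hx, hreg x hx⟩).contDiffAt
        (hV.mem_nhds hx)).differentiableAt (by simp)
  have hpair : DifferentiableAt ℝ ((P.energyDeriv Z).pair Z) x :=
    ((hg.pair hZ).contDiffAt (hV.mem_nhds hx)).differentiableAt (by simp)
  have hpE := hP.pd_energyDensity hV hZ hreg hx i
  have hpp := pd_pair hgd hZd i
  obtain ⟨-, -, hgM, hgB⟩ := hgd
  obtain ⟨-, -, hZM, hZB⟩ := hZd
  have hflux : ∀ j, pd j (P.momentumFlux Z i j) x
      = pd j (fun y => Z.mom y i * (P.energyDeriv Z).mom y j) x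
      + (if i = j then pd i ((P.energyDeriv Z).pair Z) x - pd i (P.energyDensity Z) x else 0)
      - pd j (fun y => Z.mag y j * (P.energyDeriv Z).mag y i) x := by
    intro j
    rw [pd_congr_of_isOpen hV (fun y hy => momentumFlux_eq hP.1 (hreg y hy).1 (hreg y hy).2 i j) hx]
    have d1 := (hZM i).fun_mul (hgM j)
    have d3 := (hZB j).fun_mul (hgB i)
    split_ifs with hij
    · subst hij
      rw [pd_sub (d1.fun_add (hpair.fun_sub hE)) d3, pd_add d1 (hpair.fun_sub hE),
        pd_sub hpair hE]
    · simp only [add_zero]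
      rw [pd_sub d1 d3]
  have hsum : ∑ j, pd j (P.momentumFlux Z i j) x
      = ∑ j, pd j (fun y => Z.mom y i * (P.energyDeriv Z).mom y j) x
      + (pd i ((P.energyDeriv Z).pair Z) x - pd i (P.energyDensity Z) x)
      - ∑ j, pd j (fun y => Z.mag y j * (P.energyDeriv Z).mag y i) x := by
    simp only [hflux, Finset.sum_sub_distrib, Finset.sum_add_distrib, Finset.sum_ite_eq,
      Finset.mem_univ, if_true]
  rw [hsum, hpp, hpE]
  simp only [hamOperatorGen, Fin.sum_univ_three]
  ring

/-- From `∇×(u×B) = u ∇·B - B ∇·u + (B·∇)u - (u·∇)B`: subtracting `u ∇·B` leaves the magnetic row of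
`𝒟'` acting on `u`. -/
theorem curl_cross_sub {u B : Space → Space} {x : Space} (hu : DifferentiableAt ℝ u x)
    (hB : DifferentiableAt ℝ B x) (i : Fin 3) :
    curl (fun y => cross (u y) (B y)) x i - div B x * u x i
      = -(∑ j, pd j (fun y => B y i * u y j) x - ∑ k, B x k * pd k (fun y => u y i) x) := by
  have hu' : ∀ i, DifferentiableAt ℝ (fun y => u y i) x := fun i => differentiableAt_coord hu
  have hB' : ∀ i, DifferentiableAt ℝ (fun y => B y i) x := fun i => differentiableAt_coord hB
  have hc : ∀ a b c d k, pd k (fun y => u y a * B y b - u y c * B y d) x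
      = pd k (fun y => u y a) x * B x b + u x a * pd k (fun y => B y b) x
      - (pd k (fun y => u y c) x * B x d + u x c * pd k (fun y => B y d) x) := by
    intro a b c d k
    rw [pd_sub ((hu' a).fun_mul (hB' b)) ((hu' c).fun_mul (hB' d)), pd_mul (hu' a) (hB' b),
      pd_mul (hu' c) (hB' d)]
  fin_cases i <;>
  · simp [curl, cross, div, Fin.sum_univ_three, hc, pd_mul (hB' _) (hu' _)]
    ring

end Equations

/-! ### The rows of the Hamiltonian system as fluid equations -/

section System

variable {V : Set Space} {P : PlasmaData} {I : Set ℝ} {Z : ℝ → EulerFields}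

theorem massEq_iff :
    MassEq I V Z ↔ ∀ t ∈ I,
      EqOn (timeDeriv Z t).rho (hamOperatorGen (Z t) (P.energyDeriv (Z t))).rho V := by
  refine forall₂_congr fun t _ => forall₂_congr fun x _ => ?_
  rw [add_eq_zero_iff_eq_neg]
  -- The momentum entry of `energyDeriv` is the velocity by definition.
  rfl

/-- With `σ = ρS`, the `σ` equation minus `S` times mass continuity is `ρ` times entropy transport.
This is why continuity is a hypothesis, and `ρ > 0` permits the division. -/
theorem entropyEq_iff (h : IsSmoothEvolution I V Z) (hI : IsOpen I) (hV : IsOpen V)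
    (hreg : ∀ t ∈ I, (Z t).IsRegularOn V) (hmass : MassEq I V Z) :
    EntropyEq I V Z ↔ ∀ t ∈ I,
      EqOn (timeDeriv Z t).sigma (hamOperatorGen (Z t) (P.energyDeriv (Z t))).sigma V := by
  refine forall₂_congr fun t ht => forall₂_congr fun x hx => ?_
  have hm := hmass t ht x hx
  have hr0 := (hreg t ht x hx).1
  obtain ⟨d1, d2, -, -⟩ := h.hasDerivAt hI hV ht hx
  obtain ⟨c1, c2, c3, -⟩ := h.isContDiffOn ht
  have hr : ∀ y ∈ V, (Z t).rho y ≠ 0 := fun y hy => (hreg t ht y hy).1.ne'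
  have hd {w : Space → ℝ} (hw : ContDiffOn ℝ ∞ w V) : DifferentiableAt ℝ w x :=
    (hw.contDiffAt (hV.mem_nhds hx)).differentiableAt (by simp)
  have hS : DifferentiableAt ℝ (Z t).ent x := hd (c2.div c1 hr)
  have hu : ContDiffOn ℝ ∞ (Z t).vel V := (c1.inv hr).smul c3
  have hru : ∀ j, DifferentiableAt ℝ (fun y => (Z t).rho y * (Z t).vel y j) x := fun j =>
    hd (c1.mul (contDiffOn_coord hu j))
  have hdS : HasDerivAt (fun s => (Z s).ent x) (deriv (fun s => (Z s).ent x) t) t :=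
    (d2.div d1 hr0.ne').differentiableAt.hasDerivAt
  have et : (timeDeriv Z t).sigma x = (timeDeriv Z t).rho x * (Z t).ent x
      + (Z t).rho x * deriv (fun s => (Z s).ent x) t := by
    refine d2.unique ((d1.mul hdS).congr_of_eventuallyEq ?_)
    filter_upwards [hI.mem_nhds ht] with s hs
    have := (hreg s hs x hx).1.ne'
    simp only [EulerFields.ent, Pi.mul_apply]
    field_simp
  have ex : ∀ j, pd j (fun y => (Z t).sigma y * (P.energyDeriv (Z t)).mom y j) x
      = pd j (fun y => (Z t).rho y * (Z t).vel y j) x * (Z t).ent x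
        + (Z t).rho x * (Z t).vel x j * pd j (Z t).ent x := by
    intro j
    rw [← pd_mul (hru j) hS]
    refine pd_congr_of_isOpen hV (fun y hy => ?_) hx
    have := hr y hy
    simp only [EulerFields.ent, PlasmaData.energyDeriv]
    field_simp
  have hdiv : div (fun y => (Z t).rho y • (Z t).vel y) x
      = ∑ j, pd j (fun y => (Z t).rho y * (Z t).vel y j) x := rfl
  have hm' : (timeDeriv Z t).rho x + ∑ j, pd j (fun y => (Z t).rho y * (Z t).vel y j) x = 0 := hm
  rw [et]
  simp only [hamOperatorGen, ex]
  simp only [Fin.sum_univ_three] at hm' ⊢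
  constructor
  · intro H
    linear_combination (Z t).rho x * H + (Z t).ent x * hm'
  · intro H
    have : (Z t).rho x * (deriv (fun s => (Z s).ent x) t
        + ((Z t).vel x 0 * pd 0 (Z t).ent x + (Z t).vel x 1 * pd 1 (Z t).ent x
          + (Z t).vel x 2 * pd 2 (Z t).ent x)) = 0 := by
      linear_combination H - (Z t).ent x * hm'
    exact (mul_eq_zero.1 this).resolve_left hr0.ne'

theorem momentumEq_iff (hP : P.IsAdmissible V) (h : IsSmoothEvolution I V Z) (hI : IsOpen I)
    (hV : IsOpen V) (hreg : ∀ t ∈ I, (Z t).IsRegularOn V) :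
    MomentumEq P I V Z ↔ ∀ t ∈ I,
      EqOn (timeDeriv Z t).mom (hamOperatorGen (Z t) (P.energyDeriv (Z t))).mom V := by
  refine forall₂_congr fun t ht => forall₂_congr fun x hx => ?_
  have et : ∀ i, deriv (fun s => (Z s).rho x * (Z s).vel x i) t = (timeDeriv Z t).mom x i := by
    intro i
    have h1 : HasDerivAt (fun s => (Z s).mom x i) ((timeDeriv Z t).mom x i) t :=
      (EuclideanSpace.proj (𝕜 := ℝ) i).hasFDerivAt.comp_hasDerivAt t (h.hasDerivAt hI hV ht hx).2.2.1
    refine (h1.congr_of_eventuallyEq ?_).deriv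
    filter_upwards [hI.mem_nhds ht] with s hs
    have := (hreg s hs x hx).1.ne'
    simp only [EulerFields.vel, PiLp.smul_apply, smul_eq_mul]
    field_simp
  have key := div_momentumFlux hV hP (h.isContDiffOn ht) (hreg t ht) hx
  constructor
  · intro H
    ext i
    have := H i
    rw [et] at this
    linear_combination this - key i
  · intro H i
    rw [et, H]
    linear_combination key i

theorem faradayEqGen_iff (h : IsSmoothEvolution I V Z) (hV : IsOpen V)
    (hreg : ∀ t ∈ I, (Z t).IsRegularOn V) :
    FaradayEqGen I V Z ↔ ∀ t ∈ I,
      EqOn (timeDeriv Z t).mag (hamOperatorGen (Z t) (P.energyDeriv (Z t))).mag V := by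
  refine forall₂_congr fun t ht => forall₂_congr fun x hx => ?_
  obtain ⟨c1, -, c3, c4⟩ := h.isContDiffOn ht
  have hu : ContDiffOn ℝ ∞ (Z t).vel V :=
    (c1.inv fun y hy => (hreg t ht y hy).1.ne').smul c3
  have hd {w : Space → Space} (hw : ContDiffOn ℝ ∞ w V) : DifferentiableAt ℝ w x :=
    (hw.contDiffAt (hV.mem_nhds hx)).differentiableAt (by simp)
  have e : (hamOperatorGen (Z t) (P.energyDeriv (Z t))).mag x
      = curl (fun y => cross ((Z t).vel y) ((Z t).mag y)) x - div (Z t).mag x • (Z t).vel x := by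
    ext i
    exact (curl_cross_sub (hd hu) (hd c4) i).symm
  rw [e, ← sub_eq_zero (b := curl _ x - _), sub_sub_eq_add_sub, add_sub_right_comm]
  rfl

theorem faradayEq_iff (hB : ∀ t ∈ I, GaussLaw V (Z t)) : FaradayEq I V Z ↔ FaradayEqGen I V Z := by
  refine forall₂_congr fun t ht => forall₂_congr fun x hx => ?_
  rw [hB t ht x hx, zero_smul, add_zero]

/-- Mass conservation is settled first, in both directions, because the equivalence for the entropy
row uses it. -/
theorem agreeOn_iff_system (hP : P.IsAdmissible V) (h : IsSmoothEvolution I V Z) (hI : IsOpen I)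
    (hV : IsOpen V) (hreg : ∀ t ∈ I, (Z t).IsRegularOn V) :
    (∀ t ∈ I, (timeDeriv Z t).AgreeOn V (hamOperatorGen (Z t) (P.energyDeriv (Z t)))) ↔
      MassEq I V Z ∧ MomentumEq P I V Z ∧ EntropyEq I V Z ∧ FaradayEqGen I V Z := by
  constructor
  · intro H
    have hm : MassEq I V Z := (massEq_iff (P := P)).2 fun t ht => (H t ht).1
    exact ⟨hm, (momentumEq_iff hP h hI hV hreg).2 fun t ht => (H t ht).2.2.1,
      (entropyEq_iff (P := P) h hI hV hreg hm).2 fun t ht => (H t ht).2.1,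
      (faradayEqGen_iff (P := P) h hV hreg).2 fun t ht => (H t ht).2.2.2⟩
  · rintro ⟨hm, hM, hS, hF⟩ t ht
    exact ⟨massEq_iff.1 hm t ht, (entropyEq_iff h hI hV hreg hm).1 hS t ht,
      (momentumEq_iff hP h hI hV hreg).1 hM t ht, (faradayEqGen_iff h hV hreg).1 hF t ht⟩

end System

/-! ### The double adiabatic pressure equations -/

section Pressure

variable {V : Set Space} {P : PlasmaData} {I : Set ℝ} {Z : ℝ → EulerFields}

/-- The material derivative. -/
theorem hasDerivAt_material {W : Type*} [NormedAddCommGroup W] [NormedSpace ℝ W]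
    {q : ℝ → Space → W} {t : ℝ} {x : Space}
    (hq : DifferentiableAt ℝ (fun z : ℝ × Space => q z.1 z.2) (t, x)) (v : Space) :
    HasDerivAt (fun s => q s (x + (s - t) • v)) (deriv (fun s => q s x) t + fderiv ℝ (q t) x v) t := by
  have h := hq.hasFDerivAt
  have h1 : HasDerivAt (fun s => q s x)
      (fderiv ℝ (fun z : ℝ × Space => q z.1 z.2) (t, x) (1, 0)) t :=
    HasFDerivAt.comp_hasDerivAt (f := fun s => (s, x)) t h
      ((hasDerivAt_id t).prodMk (hasDerivAt_const t x))
  have h2 : HasFDerivAt (q t) ((fderiv ℝ (fun z : ℝ × Space => q z.1 z.2) (t, x)).comp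
      (ContinuousLinearMap.inr ℝ ℝ Space)) x :=
    h.comp x (hasFDerivAt_prodMk_right t x)
  have hc : HasDerivAt (fun s : ℝ => x + (s - t) • v) v t := by
    simpa using (((hasDerivAt_id t).sub_const t).smul_const v).const_add x
  have h3 : HasDerivAt (fun s => q s (x + (s - t) • v))
      (fderiv ℝ (fun z : ℝ × Space => q z.1 z.2) (t, x) (1, v)) t :=
    HasFDerivAt.comp_hasDerivAt_of_eq (f := fun s => (s, x + (s - t) • v)) t h
      ((hasDerivAt_id t).prodMk hc) (by simp)
  rw [h1.deriv, h2.fderiv, ContinuousLinearMap.comp_apply, ← map_add]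
  simpa using h3

theorem div_smul_eq {q : Space → ℝ} {u : Space → Space} {x : Space} (hq : DifferentiableAt ℝ q x)
    (hu : DifferentiableAt ℝ u x) :
    div (fun y => q y • u y) x = fderiv ℝ q x (u x) + q x * div u x := by
  have e : div (fun y => q y • u y) x = ∑ j, (pd j q x * u x j + q x * pd j (fun y => u y j) x) :=
    Finset.sum_congr rfl fun j _ => pd_mul hq (differentiableAt_coord hu)
  rw [e, fderiv_eq_sum_pd, div, Finset.sum_add_distrib, Finset.mul_sum]
  simp only [mul_comm]

/-- Density, entropy and field strength along the flow. -/
theorem hasDerivAt_flow (h : IsSmoothEvolution I V Z) (hI : IsOpen I) (hV : IsOpen V)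
    (hreg : ∀ t ∈ I, (Z t).IsRegularOn V) (hmass : MassEq I V Z) (hent : EntropyEq I V Z)
    (hfar : FaradayEqGen I V Z) {t : ℝ} (ht : t ∈ I) {x : Space} (hx : x ∈ V) :
    HasDerivAt (fun s => (Z s).rho (x + (s - t) • (Z t).vel x))
      (-((Z t).rho x * div (Z t).vel x)) t ∧
    HasDerivAt (fun s => (Z s).ent (x + (s - t) • (Z t).vel x)) 0 t ∧
    HasDerivAt (fun s => ‖(Z s).mag (x + (s - t) • (Z t).vel x)‖)
      (‖(Z t).mag x‖ * ((Z t).strain x - div (Z t).vel x)) t := by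
  have hr0 := (hreg t ht x hx).1
  have hB0 := (hreg t ht x hx).2
  have hn0 : ‖(Z t).mag x‖ ≠ 0 := norm_ne_zero_iff.2 hB0
  have hj {W : Type} [NormedAddCommGroup W] [NormedSpace ℝ W] {q : ℝ × Space → W}
      (hq : ContDiffOn ℝ ∞ q (I ×ˢ V)) : DifferentiableAt ℝ q (t, x) :=
    (hq.contDiffAt ((hI.prod hV).mem_nhds ⟨ht, hx⟩)).differentiableAt (by simp)
  have hd {W : Type} [NormedAddCommGroup W] [NormedSpace ℝ W] {w : Space → W}
      (hw : ContDiffOn ℝ ∞ w V) : DifferentiableAt ℝ w x :=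
    (hw.contDiffAt (hV.mem_nhds hx)).differentiableAt (by simp)
  obtain ⟨c1, -, c3, c4⟩ := h.isContDiffOn ht
  have hu : DifferentiableAt ℝ (Z t).vel x :=
    hd ((c1.inv fun y hy => (hreg t ht y hy).1.ne').smul c3)
  have hu' : ∀ j, DifferentiableAt ℝ (fun y => (Z t).vel y j) x := fun j =>
    differentiableAt_coord hu
  have hB' : ∀ j, DifferentiableAt ℝ (fun y => (Z t).mag y j) x := fun j =>
    differentiableAt_coord (hd c4)
  have hS : DifferentiableAt ℝ (fun z : ℝ × Space => (Z z.1).ent z.2) (t, x) :=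
    hj (h.2.1.div h.1 fun z hz => (hreg z.1 hz.1 z.2 hz.2).1.ne')
  have m1 := hasDerivAt_material (q := fun s => (Z s).rho) (hj h.1) ((Z t).vel x)
  have m2 := hasDerivAt_material (q := fun s => (Z s).ent) hS ((Z t).vel x)
  have m3 := hasDerivAt_material (q := fun s => (Z s).mag) (hj h.2.2.2) ((Z t).vel x)
  refine ⟨?_, ?_, ?_⟩
  · convert! m1 using 1
    have := hmass t ht x hx
    rw [div_smul_eq (hd c1) hu] at this
    linear_combination -this
  · convert! m2 using 1
    rw [fderiv_eq_sum_pd]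
    exact (hent t ht x hx).symm
  -- The induction law gives `DB/Dt = (B·∇)u - B ∇·u` with no `∇·B` left; its product with `B/|B|`
  -- is the rate of `|B|`.
  · have hx0 : x + (t - t) • (Z t).vel x = x := by simp
    have m4 := hasDerivAt_norm_of_ne m3 (by rw [hx0]; exact hB0)
    rw [hx0] at m4
    convert! m4 using 1
    have hF' : ∀ i, deriv (fun s => (Z s).mag x) t i
        = -(∑ j, pd j (fun y => (Z t).mag y i * (Z t).vel y j) x
          - ∑ k, (Z t).mag x k * pd k (fun y => (Z t).vel y i) x) := fun i => by
      have h1 : deriv (fun s => (Z s).mag x) t i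
          - curl (fun y => cross ((Z t).vel y) ((Z t).mag y)) x i
          + div (Z t).mag x * (Z t).vel x i = 0 :=
        congrArg (fun v : Space => v i) (hfar t ht x hx)
      linear_combination h1 + curl_cross_sub hu (hd c4) i
    have hadv : ∀ i, fderiv ℝ (Z t).mag x ((Z t).vel x) i
        = ∑ k, (Z t).vel x k * pd k (fun y => (Z t).mag y i) x := fun i => by
      rw [clm_apply_coord]
      exact Finset.sum_congr rfl fun k _ => by rw [pd_coord _ (hd c4)]
    have hst : (Z t).strain x * ‖(Z t).mag x‖ ^ 2
        = ∑ i, ∑ j, (Z t).mag x i * (Z t).mag x j * pd j (fun y => (Z t).vel y i) x := by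
      simp only [EulerFields.strain, EulerFields.tau, PiLp.smul_apply, smul_eq_mul, Finset.sum_mul]
      refine Finset.sum_congr rfl fun i _ => Finset.sum_congr rfl fun j _ => ?_
      field_simp
    have hnn : ‖(Z t).mag x‖ ^ 2 = ∑ i, (Z t).mag x i * (Z t).mag x i := by
      rw [← real_inner_self_eq_norm_sq, inner_eq_sum]
    rw [eq_div_iff hn0]
    have : ‖(Z t).mag x‖ * ((Z t).strain x - div (Z t).vel x) * ‖(Z t).mag x‖
        = (Z t).strain x * ‖(Z t).mag x‖ ^ 2 - ‖(Z t).mag x‖ ^ 2 * div (Z t).vel x := by ring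
    rw [this, hst, hnn, inner_eq_sum]
    simp only [PiLp.add_apply, hF', hadv, pd_mul (hB' _) (hu' _), div, Fin.sum_univ_three]
    ring

/-- In `p_⊥ = p_∥ + ρBe_B` the `c_∥` part of `e_B` cancels `p_∥` exactly, so each pressure involves
only one of the two entropy functions. -/
theorem pressures_of_doubleAdiabatic {cPerp cPar : ℝ → ℝ}
    (hc : ∀ r s b : ℝ, 0 < r → 0 < b →
      P.en r s b = cPerp s * b + cPar s * (r ^ 2 / (2 * b ^ 2)))
    {Z : EulerFields} {x : Space} (hr : 0 < Z.rho x) (hB : Z.mag x ≠ 0) :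
    P.pPar Z x = cPar (Z.ent x) * Z.rho x ^ 3 / ‖Z.mag x‖ ^ 2 ∧
      P.pPerp Z x = cPerp (Z.ent x) * Z.rho x * ‖Z.mag x‖ := by
  have hn : 0 < ‖Z.mag x‖ := norm_pos_iff.2 hB
  have d1 : deriv (fun r => P.en r (Z.ent x) ‖Z.mag x‖) (Z.rho x)
      = cPar (Z.ent x) * (Z.rho x / ‖Z.mag x‖ ^ 2) := by
    have h := (((hasDerivAt_pow 2 (Z.rho x)).div_const (2 * ‖Z.mag x‖ ^ 2)).const_mul
      (cPar (Z.ent x))).const_add (cPerp (Z.ent x) * ‖Z.mag x‖)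
    have h' := h.congr_of_eventuallyEq (f₁ := fun r => P.en r (Z.ent x) ‖Z.mag x‖) (by
      filter_upwards [lt_mem_nhds hr] with r hr'
      exact hc r _ _ hr' hn)
    rw [h'.deriv]
    field_simp
    norm_num
  have d2 : deriv (fun b => P.en (Z.rho x) (Z.ent x) b) ‖Z.mag x‖
      = cPerp (Z.ent x) - cPar (Z.ent x) * (Z.rho x ^ 2 / ‖Z.mag x‖ ^ 3) := by
    have h := ((hasDerivAt_id ‖Z.mag x‖).const_mul (cPerp (Z.ent x))).add
      (((hasDerivAt_const ‖Z.mag x‖ (Z.rho x ^ 2)).div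
        ((hasDerivAt_pow 2 ‖Z.mag x‖).const_mul 2) (by positivity)).const_mul (cPar (Z.ent x)))
    have h' := h.congr_of_eventuallyEq (f₁ := fun b => P.en (Z.rho x) (Z.ent x) b) (by
      filter_upwards [lt_mem_nhds hn] with b hb
      exact hc _ _ b hr hb)
    rw [h'.deriv]
    push_cast
    field_simp
    ring
  have e1 : P.pPar Z x = cPar (Z.ent x) * Z.rho x ^ 3 / ‖Z.mag x‖ ^ 2 := by
    rw [PlasmaData.pPar, d1]
    ring
  refine ⟨e1, ?_⟩
  rw [PlasmaData.pPerp, e1, d2]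
  field_simp
  ring

/-- Only `e` is assumed smooth. Evaluating it at `B = 1` with `ρ = 1` and `ρ = 2` gives an
invertible linear system for `c_⊥` and `c_∥`, which therefore inherit differentiability in `S`. -/
theorem differentiable_of_doubleAdiabatic (hP : P.IsAdmissible V) {cPerp cPar : ℝ → ℝ}
    (hc : ∀ r s b : ℝ, 0 < r → 0 < b →
      P.en r s b = cPerp s * b + cPar s * (r ^ 2 / (2 * b ^ 2))) :
    Differentiable ℝ cPerp ∧ Differentiable ℝ cPar := by
  have hen : ∀ r : ℝ, 0 < r → Differentiable ℝ fun s => P.en r s 1 := fun r hr s =>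
    (HasFDerivAt.comp_hasDerivAt (f := fun s => (r, s, (1 : ℝ))) s
      (hP.hasFDerivAt_internal (s := s) hr one_pos)
      ((hasDerivAt_const s r).prodMk ((hasDerivAt_id s).prodMk
        (hasDerivAt_const s 1)))).differentiableAt
  have h1 := hen 1 one_pos
  have h2 := hen 2 two_pos
  have e2 : cPar = fun s => 2 / 3 * (P.en 2 s 1 - P.en 1 s 1) := by
    ext s
    rw [hc 2 s 1 two_pos one_pos, hc 1 s 1 one_pos one_pos]
    ring
  have e1 : cPerp = fun s => P.en 1 s 1 - 1 / 3 * (P.en 2 s 1 - P.en 1 s 1) := by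
    ext s
    rw [hc 2 s 1 two_pos one_pos, hc 1 s 1 one_pos one_pos]
    ring
  exact ⟨e1 ▸ h1.fun_sub ((h2.fun_sub h1).const_mul _), e2 ▸ (h2.fun_sub h1).const_mul _⟩

/-- A pressure transported along the flow at the rate `-p r` obeys a balance law. -/
theorem pressure_balance {p : ℝ → Space → ℝ} {u : Space → Space} {t r : ℝ} {x : Space}
    (hp : DifferentiableAt ℝ (fun z : ℝ × Space => p z.1 z.2) (t, x))
    (hu : DifferentiableAt ℝ u x)
    (hD : HasDerivAt (fun s => p s (x + (s - t) • u x)) (-(p t x * r)) t) :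
    deriv (fun s => p s x) t + div (fun y => p t y • u y) x + p t x * (r - div u x) = 0 := by
  have hpt : DifferentiableAt ℝ (p t) x :=
    (hp.hasFDerivAt.comp x (hasFDerivAt_prodMk_right t x)).differentiableAt
  rw [div_smul_eq hpt hu]
  linear_combination (hasDerivAt_material hp (u x)).unique hD

/-- Along the flow `S` is constant, `ρ` has relative rate `-∇·u`, and `|B|` has relative rate `ττ:∇u
- ∇·u`. Hence `ρ³/B²` has relative rate `-(∇·u + 2ττ:∇u)`, and `ρB` has `-(2∇·u - ττ:∇u)`. All rates
are used in multiplied form, so the pressures may vanish. -/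
theorem pressureEqs_of_doubleAdiabatic (hP : P.IsAdmissible V) (h : IsSmoothEvolution I V Z)
    (hI : IsOpen I) (hV : IsOpen V) (hreg : ∀ t ∈ I, (Z t).IsRegularOn V)
    (hDA : P.IsDoubleAdiabatic) (hmass : MassEq I V Z) (hent : EntropyEq I V Z)
    (hfar : FaradayEqGen I V Z) : ParallelPressureEq P I V Z ∧ PerpPressureEq P I V Z := by
  obtain ⟨cPerp, cPar, hc⟩ := hDA
  obtain ⟨k1, k2⟩ := differentiable_of_doubleAdiabatic hP hc
  have main : ∀ t ∈ I, ∀ x ∈ V,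
      (deriv (fun s => P.pPar (Z s) x) t + div (fun y => P.pPar (Z t) y • (Z t).vel y) x
        + 2 * (P.pPar (Z t) x * (Z t).strain x) = 0) ∧
      deriv (fun s => P.pPerp (Z s) x) t + div (fun y => P.pPerp (Z t) y • (Z t).vel y) x
        + P.pPerp (Z t) x * (div (Z t).vel x - (Z t).strain x) = 0 := by
    intro t ht x hx
    have hnhds := (hI.prod hV).mem_nhds (show (t, x) ∈ I ×ˢ V from ⟨ht, hx⟩)
    have hj {W : Type} [NormedAddCommGroup W] [NormedSpace ℝ W] {q : ℝ × Space → W}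
        (hq : ContDiffOn ℝ ∞ q (I ×ˢ V)) : DifferentiableAt ℝ q (t, x) :=
      (hq.contDiffAt hnhds).differentiableAt (by simp)
    have hr0 := (hreg t ht x hx).1
    have hB0 := (hreg t ht x hx).2
    have hn0 : ‖(Z t).mag x‖ ≠ 0 := norm_ne_zero_iff.2 hB0
    have jr := hj h.1
    have jS : DifferentiableAt ℝ (fun z : ℝ × Space => (Z z.1).ent z.2) (t, x) :=
      hj (h.2.1.div h.1 fun z hz => (hreg z.1 hz.1 z.2 hz.2).1.ne')
    have jn : DifferentiableAt ℝ (fun z : ℝ × Space => ‖(Z z.1).mag z.2‖) (t, x) :=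
      (hj h.2.2.2).norm ℝ hB0
    obtain ⟨c1, -, c3, -⟩ := h.isContDiffOn ht
    have hu : DifferentiableAt ℝ (Z t).vel x :=
      (((c1.inv fun y hy => (hreg t ht y hy).1.ne').smul c3).contDiffAt
        (hV.mem_nhds hx)).differentiableAt (by simp)
    have hpr : ∀ s ∈ I, ∀ y ∈ V,
        P.pPar (Z s) y = cPar ((Z s).ent y) * (Z s).rho y ^ 3 / ‖(Z s).mag y‖ ^ 2 ∧
        P.pPerp (Z s) y = cPerp ((Z s).ent y) * (Z s).rho y * ‖(Z s).mag y‖ := fun s hs y hy =>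
      pressures_of_doubleAdiabatic hc (hreg s hs y hy).1 (hreg s hs y hy).2
    obtain ⟨f1, f2, f3⟩ := hasDerivAt_flow h hI hV hreg hmass hent hfar ht hx
    have hx0 : x + (t - t) • (Z t).vel x = x := by simp
    -- The path is the tangent line to the particle trajectory; only first derivatives at `t`
    -- matter, so it need only stay in the domain for times near `t`.
    have hflow : ∀ᶠ s in 𝓝 t, s ∈ I ∧ x + (s - t) • (Z t).vel x ∈ V := by
      have hcont : Continuous fun s : ℝ => (s, x + (s - t) • (Z t).vel x) := by fun_prop
      have := hcont.continuousAt.eventually_mem (x := t) ((hI.prod hV).mem_nhds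
        (show (t, x + (t - t) • (Z t).vel x) ∈ I ×ˢ V from ⟨ht, hx0.symm ▸ hx⟩))
      exact this
    obtain ⟨p1, p2⟩ := hpr t ht x hx
    have g1 : HasDerivAt (fun s => cPar ((Z s).ent (x + (s - t) • (Z t).vel x))) 0 t := by
      exact (HasDerivAt.comp t (k2 _).hasDerivAt f2).congr_deriv (mul_zero _)
    have g2 : HasDerivAt (fun s => cPerp ((Z s).ent (x + (s - t) • (Z t).vel x))) 0 t := by
      exact (HasDerivAt.comp t (k1 _).hasDerivAt f2).congr_deriv (mul_zero _)
    constructor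
    · have hp : DifferentiableAt ℝ (fun z : ℝ × Space => P.pPar (Z z.1) z.2) (t, x) := by
        have : DifferentiableAt ℝ (fun z : ℝ × Space =>
            cPar ((Z z.1).ent z.2) * (Z z.1).rho z.2 ^ 3 / ‖(Z z.1).mag z.2‖ ^ 2) (t, x) :=
          (((k2 _).comp (t, x) jS).fun_mul (jr.fun_pow 3)).fun_mul
            ((jn.fun_pow 2).fun_inv (pow_ne_zero 2 hn0))
        refine this.congr_of_eventuallyEq ?_
        filter_upwards [hnhds] with z hz
        exact (hpr z.1 hz.1 z.2 hz.2).1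
      have hD : HasDerivAt (fun s => P.pPar (Z s) (x + (s - t) • (Z t).vel x))
          (-(P.pPar (Z t) x * (div (Z t).vel x + 2 * (Z t).strain x))) t := by
        have hg := (g1.mul (f1.pow 3)).div (f3.pow 2) (by simpa using hB0)
        refine (hg.congr_of_eventuallyEq ?_).congr_deriv ?_
        · filter_upwards [hflow] with s hs
          exact (hpr s hs.1 _ hs.2).1
        · simp only [hx0, Pi.pow_apply, Pi.mul_apply, p1]
          push_cast
          field_simp
          ring
      linear_combination pressure_balance hp hu hD
    · have hp : DifferentiableAt ℝ (fun z : ℝ × Space => P.pPerp (Z z.1) z.2) (t, x) := by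
        have : DifferentiableAt ℝ (fun z : ℝ × Space =>
            cPerp ((Z z.1).ent z.2) * (Z z.1).rho z.2 * ‖(Z z.1).mag z.2‖) (t, x) :=
          (((k1 _).comp (t, x) jS).fun_mul jr).fun_mul jn
        refine this.congr_of_eventuallyEq ?_
        filter_upwards [hnhds] with z hz
        exact (hpr z.1 hz.1 z.2 hz.2).2
      have hD : HasDerivAt (fun s => P.pPerp (Z s) (x + (s - t) • (Z t).vel x))
          (-(P.pPerp (Z t) x * (2 * div (Z t).vel x - (Z t).strain x))) t := by
        have hg := (g2.mul f1).mul f3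
        refine (hg.congr_of_eventuallyEq ?_).congr_deriv ?_
        · filter_upwards [hflow] with s hs
          exact (hpr s hs.1 _ hs.2).2
        · simp only [hx0, Pi.mul_apply, p2]
          ring
      linear_combination pressure_balance hp hu hD
  exact ⟨fun t ht x hx => (main t ht x hx).1, fun t ht x hx => (main t ht x hx).2⟩

end Pressure

/-! ### Independence of the chosen variational derivative -/

section Evolution

variable {V : Set Space} {P : PlasmaData} {I : Set ℝ} {Z : ℝ → EulerFields}

theorem IsEvolution.isSmoothEvolution (h : IsEvolution P I V Z) : IsSmoothEvolution I V Z :=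
  ⟨h.1, h.2.1, h.2.2.1, h.2.2.2.1⟩

/-- By uniqueness, any `C¹` variational derivative of the energy agrees on `V` with the explicit
one, and `𝒟'` sees only values on `V`. -/
theorem agreeOn_hamOperatorGen_iff (hV : IsOpen V) (hP : P.IsAdmissible V)
    (hZ : IsEvolution P I V Z) {h : ℝ → EulerFields}
    (hh : ∀ t ∈ I, (h t).IsContDiffOn 1 V ∧ HasEulerVarDeriv V (P.energy V) (Z t) (h t)) :
    (∀ t ∈ I, (timeDeriv Z t).AgreeOn V (hamOperatorGen (Z t) (h t))) ↔
      ∀ t ∈ I, (timeDeriv Z t).AgreeOn V (hamOperatorGen (Z t) (P.energyDeriv (Z t))) := by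
  refine forall₂_congr fun t ht => ?_
  have hs := hZ.isSmoothEvolution.isContDiffOn ht
  have hreg : (Z t).IsRegularOn V := hZ.2.2.2.2.1 t ht
  obtain ⟨a1, a2, a3, a4⟩ := hamOperatorGen_congr (Z := Z t) hV
    ((hh t ht).2.agreeOn hV hs (hP.hasEulerVarDeriv_energy hV hreg (hZ.2.2.2.2.2 t ht))
      (hh t ht).1.isContinuousOn (hP.energyDeriv_isContDiffOn hs hreg).isContinuousOn)
  exact ⟨fun ⟨b1, b2, b3, b4⟩ => ⟨b1.trans a1, b2.trans a2, b3.trans a3, b4.trans a4⟩,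
    fun ⟨b1, b2, b3, b4⟩ => ⟨b1.trans a1.symm, b2.trans a2.symm, b3.trans a3.symm,
      b4.trans a4.symm⟩⟩

end Evolution

end CGL

/-! ### Assembly of the four statements -/

theorem mainTheorem4 {V₀ V : Set Space} (hV₀ : IsOpen V₀) (hV : IsOpen V) :
    -- Canonical variables to Eulerian variables.
    (∀ (d : LabelData) (ζ : CanonicalFields), d.IsAdmissible V₀ →
      IsLagrangianMap V₀ V ζ.pos → ContDiffOn ℝ ∞ ζ.mom V₀ →
      -- The chain rule for variational derivatives.
      (∀ (F : EulerFields → ℝ) (f : EulerFields),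
        f.IsContDiffOn 1 V → HasEulerVarDeriv V F (toEuler V₀ d ζ) f →
        HasCanonicalVarDeriv V₀ V (fun ξ => F (toEuler V₀ d ξ)) ζ
          (chainRule ζ.pos (toEuler V₀ d ζ) f) ∧
        ∀ k : CanonicalFields, ContinuousOn k.pos V₀ → ContinuousOn k.mom V₀ →
          HasCanonicalVarDeriv V₀ V (fun ξ => F (toEuler V₀ d ξ)) ζ k →
          ∀ a ∈ V₀, k.pos a = (chainRule ζ.pos (toEuler V₀ d ζ) f).pos a ∧
            k.mom a = (chainRule ζ.pos (toEuler V₀ d ζ) f).mom a) ∧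
      -- The canonical bracket is the CGL bracket up to a boundary divergence.
      (∀ (F G : EulerFields → ℝ) (f g : EulerFields) (k l : CanonicalFields),
        f.IsContDiffOn 1 V → HasEulerVarDeriv V F (toEuler V₀ d ζ) f →
        g.IsContDiffOn 1 V → HasEulerVarDeriv V G (toEuler V₀ d ζ) g →
        ContinuousOn k.pos V₀ → ContinuousOn k.mom V₀ →
        HasCanonicalVarDeriv V₀ V (fun ξ => F (toEuler V₀ d ξ)) ζ k →
        ContinuousOn l.pos V₀ → ContinuousOn l.mom V₀ →
        HasCanonicalVarDeriv V₀ V (fun ξ => G (toEuler V₀ d ξ)) ζ l →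
        IntegrableOn (cglDensity (toEuler V₀ d ζ) f g) V →
        (IntegrableOn (div (discardedFlux (toEuler V₀ d ζ) f g)) V →
          IntegrableOn (canonicalDensity k l) V₀ ∧
          canonicalBracket V₀ k l = cglBracket V (toEuler V₀ d ζ) f g
            - ∫ x in V, div (discardedFlux (toEuler V₀ d ζ) f g) x) ∧
        (VanishesNearBoundary V (discardedFlux (toEuler V₀ d ζ) f g) →
          IntegrableOn (canonicalDensity k l) V₀ ∧
          canonicalBracket V₀ k l = cglBracket V (toEuler V₀ d ζ) f g))) ∧
    -- The Hamiltonian operator of the CGL bracket.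
    (∀ Z f g : EulerFields, Z.IsContDiffOn 1 V → f.IsContDiffOn 1 V → g.IsContDiffOn 1 V →
      IntegrableOn (cglDensity Z f g) V →
      (IntegrableOn (div (operatorFlux Z f g)) V →
        cglBracket V Z f g = (∫ x in V, f.pair (hamOperatorGen Z g) x)
            + ∫ x in V, div (operatorFlux Z f g) x) ∧
      (VanishesNearBoundary V (operatorFlux Z f g) →
        cglBracket V Z f g = ∫ x in V, f.pair (hamOperatorGen Z g) x) ∧
      (GaussLaw V Z → IntegrableOn (div (operatorFlux Z f g)) V →
        cglBracket V Z f g = (∫ x in V, f.pair (hamOperator Z g) x)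
            + ∫ x in V, div (operatorFlux Z f g) x) ∧
      (GaussLaw V Z → VanishesNearBoundary V (operatorFlux Z f g) →
        cglBracket V Z f g = ∫ x in V, f.pair (hamOperator Z g) x)) ∧
    -- The total energy generates the CGL equations.
    (∀ (P : PlasmaData) (I : Set ℝ) (Z : ℝ → EulerFields), P.IsAdmissible V → IsOpen I →
      IsEvolution P I V Z →
      (∀ t ∈ I, ∃ h : EulerFields, h.IsContDiffOn 1 V ∧
        HasEulerVarDeriv V (P.energy V) (Z t) h) ∧
      (∀ h : ℝ → EulerFields, (∀ t ∈ I, (h t).IsContDiffOn 1 V ∧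
          HasEulerVarDeriv V (P.energy V) (Z t) (h t)) →
        (BracketHamiltonEq I V Z h ↔
          MassEq I V Z ∧ MomentumEq P I V Z ∧ EntropyEq I V Z ∧ FaradayEqGen I V Z) ∧
        ((∀ t ∈ I, GaussLaw V (Z t)) →
          (BracketHamiltonEq I V Z h ↔
            MassEq I V Z ∧ MomentumEq P I V Z ∧ EntropyEq I V Z ∧ FaradayEq I V Z) ∧
          (OperatorHamiltonEq I V Z h ↔
            MassEq I V Z ∧ MomentumEq P I V Z ∧ EntropyEq I V Z ∧ FaradayEq I V Z)) ∧
        (P.IsDoubleAdiabatic → BracketHamiltonEq I V Z h →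
          ParallelPressureEq P I V Z ∧ PerpPressureEq P I V Z))) := by
  refine ⟨fun d ζ hd hX hM => ⟨fun F f hf hF => ⟨?_, fun k hk1 hk2 hk => ?_⟩, ?_⟩, ?_, ?_⟩
  · exact hasCanonicalVarDeriv_chainRule hV₀ hV hd hX hM hf hF
  · exact hasCanonicalVarDeriv_eq_chainRule hV₀ hV hd hX hM hf hF hk1 hk2 hk
  · intro F G f g k l hf hF hg hG hk1 hk2 hk hl1 hl2 hl hi
    have hZ := (toEuler_isContDiffOn hV₀ hd hX hM).of_le (m := 1) (by simp)
    have ek := hasCanonicalVarDeriv_eq_chainRule hV₀ hV hd hX hM hf hF hk1 hk2 hk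
    have el := hasCanonicalVarDeriv_eq_chainRule hV₀ hV hd hX hM hg hG hl1 hl2 hl
    refine ⟨fun hw => canonicalBracket_eq hV₀ hV hX hZ hf hg ek el hi hw, fun hw => ?_⟩
    obtain ⟨h1, h2⟩ :=
      div_integral_of_vanishesNearBoundary hV (discardedFlux_contDiffOn hZ hf hg) hw
    obtain ⟨h3, h4⟩ := canonicalBracket_eq hV₀ hV hX hZ hf hg ek el hi h1
    exact ⟨h3, by rw [h4, h2, sub_zero]⟩
  · intro Z f g hZ hf hg hi
    refine ⟨fun hd => cglBracket_eq_integral_hamOperatorGen hV hZ hf hg hi hd,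
      fun hw => cglBracket_eq_integral_hamOperatorGen_of_vanishes hV hZ hf hg hi hw,
      fun hB hd => ?_, fun hB hw => ?_⟩
    · rw [integral_pair_hamOperator_eq hV hZ hg hB]
      exact cglBracket_eq_integral_hamOperatorGen hV hZ hf hg hi hd
    · rw [integral_pair_hamOperator_eq hV hZ hg hB]
      exact cglBracket_eq_integral_hamOperatorGen_of_vanishes hV hZ hf hg hi hw
  · intro P I Z hP hI hZ
    have hs := hZ.isSmoothEvolution
    have hreg : ∀ t ∈ I, (Z t).IsRegularOn V := hZ.2.2.2.2.1
    refine ⟨fun t ht => ⟨P.energyDeriv (Z t),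
      (hP.energyDeriv_isContDiffOn (hs.isContDiffOn ht) (hreg t ht)).of_le (by simp),
      hP.hasEulerVarDeriv_energy hV (hreg t ht) (hZ.2.2.2.2.2 t ht)⟩, fun h hh => ?_⟩
    have hc : ∀ t ∈ I, (h t).IsContDiffOn 1 V := fun t ht => (hh t ht).1
    have hsys := (agreeOn_hamOperatorGen_iff hV hP hZ hh).trans
      (agreeOn_iff_system hP hs hI hV hreg)
    have hbr := (bracketHamiltonEq_iff hs hI hV hc).trans hsys
    refine ⟨hbr, fun hB => ?_, fun hDA H => ?_⟩
    · rw [faradayEq_iff hB]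
      exact ⟨hbr, (operatorHamiltonEq_iff hs hV hc hB).trans hsys⟩
    · obtain ⟨hm, -, he, hf⟩ := hbr.1 H
      exact pressureEqs_of_doubleAdiabatic hP hs hI hV hreg hDA hm he hf
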